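/- Notation. Ideals of C*-algebras are closed and two-sided, and *-homomorphisms are not assumed to be unital. A ccp map is a contractive completely positive linear map. $K$ is the C*-algebra of compact operators on $\ell^2(\mathbb N)$, and $M(X)$ is the multiplier algebra of a C*-algebra $X$. A C*-algebra is $\sigma$-unital if it has a countable approximate unit. For an ideal $I$ of $B$ let $\tilde\pi_I : M(B\otimes K)\to M(B/I\otimes K)$ be the canonical extension of the surjection $B\otimes K\to B/I\otimes K$. For *-homomorphisms $f:A\to B/I$ and $g:A\to M(B/I\otimes K)$, let $f\oplus g : A\to M(B/I\otimes K)$ be the block diagonal *-homomorphism $a\mapsto f(a)\otimes e_{00}+(1\otimes s)\,g(a)\,(1\otimes s)^*$, where $s$ is the unilateral shift. A map $F:A\to M(B\otimes K)$ lifts $f\oplus g$ if $\tilde\pi_I\circ F=f\oplus g$. A unital C*-algebra $A$ has the lifting property (LP) if for every C*-algebra $D$ and every ideal $J$ of $D$ every ccp map $A\to D/J$ lifts to a ccp map $A\to D$; a non-unital C*-algebra has the LP if its unitization has it. For a C*-algebra $A$, a C*-algebra $B$ and an ideal $I$ of $B$ consider the conditions (i)$_{B,I}$ every ccp map $A\to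 B/I$ lifts to a ccp map $A\to B$; (ii)$_{B,I}$ for every *-homomorphism $f:A\to B/I$ there is a *-homomorphism $g:A\to M(B/I\otimes K)$ such that $f\oplus g$ lifts to a *-homomorphism $A\to M(B\otimes K)$; (iii)$_{B,I}$ for every *-homomorphism $f:A\to B/I$ there is a *-homomorphism $g:A\to M(B/I\otimes K)$ such that $f\oplus g$ lifts to a ccp map $A\to M(B\otimes K)$. Theorem. Let $A$ be a separable C*-algebra. (1) The following are equivalent: (a) $A$ has the LP; (b) (ii)$_{B,I}$ holds for every $\sigma$-unital C*-algebra $B$ and every ideal $I$ of $B$; (c) (iii)$_{B,I}$ holds for every $\sigma$-unital C*-algebra $B$ and every ideal $I$ of $B$. (2) Let $B$ be a $\sigma$-unital C*-algebra and $I$ an ideal of $B$. Then (i)$_{B,I}$ implies (ii)$_{B,I}$, and (ii)$_{B,I}$ implies (iii)$_{B,I}$. Moreover, if (iii) holds for the C*-algebra $M(B\otimes K)$ and its ideal $\ker\tilde\pi_I$, then (i)$_{B,I}$ holds. -/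

import Mathlib

open scoped MultiplierAlgebra

universe u v

theorem NonUnitalStarAlgHom.continuous' {A B : Type*} [NonUnitalCStarAlgebra A]
    [NonUnitalCStarAlgebra B] (φ : A →⋆ₙₐ[ℂ] B) : Continuous φ :=
  AddMonoidHomClass.continuous_of_bound φ 1 fun a => by
    rw [one_mul]; exact NonUnitalStarAlgHom.norm_apply_le φ a

/-- An ideal of a C*-algebra, always meaning a closed two-sided ideal. -/
structure ClosedIdeal (B : Type*) [NonUnitalCStarAlgebra B] extends Submodule ℂ B where
  mul_mem_left' : ∀ (a : B) {x : B}, x ∈ carrier → a * x ∈ carrier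
  mul_mem_right' : ∀ (a : B) {x : B}, x ∈ carrier → x * a ∈ carrier
  isClosed' : IsClosed carrier

namespace ClosedIdeal

variable {B : Type*} [NonUnitalCStarAlgebra B] (I : ClosedIdeal B)

theorem mul_mem_left (a : B) {x : B} (hx : x ∈ I.toSubmodule) : a * x ∈ I.toSubmodule :=
  I.mul_mem_left' a hx

theorem mul_mem_right (a : B) {x : B} (hx : x ∈ I.toSubmodule) : x * a ∈ I.toSubmodule :=
  I.mul_mem_right' a hx

theorem isClosed : IsClosed (I.toSubmodule : Set B) := I.isClosed'

theorem exists_approx_unit {y : B} (hy : y ∈ I.toSubmodule) {ε : ℝ} (hε : 0 < ε) :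
    ∃ e ∈ I.toSubmodule, star e = e ∧ ‖(1 : Unitization ℂ B) - (e : Unitization ℂ B)‖ ≤ 1 ∧
      ‖y - y * e‖ ≤ ε := by
  let _ := CStarAlgebra.spectralOrder (Unitization ℂ B)
  have _ := CStarAlgebra.spectralOrderedRing (Unitization ℂ B)
  set h : B := star y * y with hh
  have hsa : IsSelfAdjoint h := IsSelfAdjoint.star_mul_self y
  have hI : h ∈ I.toSubmodule := I.mul_mem_left _ hy
  set δ : ℝ := ε ^ 2 with hδ
  have hδ0 : 0 < δ := by positivity
  have hden : ∀ t : ℝ, 0 < |t| + δ := fun t => by positivity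
  set f : ℝ → ℝ := fun t => |t| / (|t| + δ) with hf
  have hfc : Continuous f := by
    refine Continuous.div (by fun_prop) (by fun_prop) fun t => (hden t).ne'
  set e : B := cfcₙ f h with he
  have hf0 : f 0 = 0 := by simp [hf]
  have hesa : IsSelfAdjoint e := cfcₙ_predicate f h
  have heI : e ∈ I.toSubmodule := by
    have h1 : e ∈ NonUnitalStarAlgebra.elemental ℝ h := cfcₙ_mem_elemental f h
    have h2 : ((NonUnitalStarAlgebra.adjoin ℝ ({h} : Set B)) : Set B) ⊆ I.toSubmodule := by
      intro z hz
      have hz' : z ∈ NonUnitalAlgebra.adjoin ℝ ({h} ∪ star {h} : Set B) := hz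
      induction hz' using NonUnitalAlgebra.adjoin_induction with
      | mem x hx =>
        rcases hx with hx | hx
        · rw [Set.mem_singleton_iff] at hx; rw [hx]; exact hI
        · rw [Set.star_singleton, Set.mem_singleton_iff, hsa.star_eq] at hx; rw [hx]; exact hI
      | add x y _ _ hx hy => exact I.toSubmodule.add_mem (hx ‹_›) (hy ‹_›)
      | zero => exact I.toSubmodule.zero_mem
      | mul x y _ _ hx hy => exact I.mul_mem_left _ (hy ‹_›)
      | smul r x _ hx =>
        have := I.toSubmodule.smul_mem (r : ℂ) (hx ‹_›)
        simpa using this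
    exact closure_minimal h2 I.isClosed h1
  set u : Unitization ℂ B := (h : Unitization ℂ B) with hu
  have husa : IsSelfAdjoint u := by
    rw [IsSelfAdjoint, hu, ← Unitization.inr_star, hsa.star_eq]
  have heu : (e : Unitization ℂ B) = cfc f u := by
    rw [he, Unitization.real_cfcₙ_eq_cfc_inr h f hf0]
  have h1e : (1 : Unitization ℂ B) - (e : Unitization ℂ B) = cfc (fun t => 1 - f t) u := by
    rw [cfc_sub (fun _ => (1 : ℝ)) f u (by fun_prop) hfc.continuousOn, cfc_const_one ℝ u, heu]
  have hb : ∀ t, 1 - f t = δ / (|t| + δ) := fun t => by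
    have := (hden t).ne'
    simp only [hf]; field_simp; ring
  refine ⟨e, heI, hesa.star_eq, ?_, ?_⟩
  · rw [h1e]
    refine norm_cfc_le zero_le_one fun t _ => ?_
    rw [hb, Real.norm_eq_abs, abs_of_nonneg (by positivity), div_le_one (hden t)]
    have := abs_nonneg t
    linarith
  · have key : ((y - y * e : B) : Unitization ℂ B) = (y : Unitization ℂ B) * (1 - e) := by
      simp [mul_sub]
    have h3 : ‖y - y * e‖ * ‖y - y * e‖ ≤ ε * ε := by
      rw [← Unitization.norm_inr (𝕜 := ℂ) (y - y * e), ← CStarRing.norm_star_mul_self, key, star_mul]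
      have e1 : star (1 - (e : Unitization ℂ B)) = 1 - e := by
        rw [star_sub, star_one, ← Unitization.inr_star, hesa.star_eq]
      have e2 : star (1 - (e : Unitization ℂ B)) * star (y : Unitization ℂ B) * (y * (1 - e))
          = (1 - e) * u * (1 - e) := by
        rw [e1, hu, hh]; simp [mul_assoc]
      have e3 : (1 - (e : Unitization ℂ B)) * u * (1 - e) =
          cfc (fun t => (1 - f t) * t * (1 - f t)) u := by
        have c1 : ContinuousOn (fun t => 1 - f t) (spectrum ℝ u) := by fun_prop
        have c2 : ContinuousOn (fun t => (1 - f t) * t) (spectrum ℝ u) := by fun_prop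
        rw [cfc_mul (fun t => (1 - f t) * t) (fun t => 1 - f t) u c2 c1,
          cfc_mul (fun t => 1 - f t) (fun t => t) u c1 (by fun_prop), cfc_id' ℝ u, h1e]
      rw [e2, e3]
      refine norm_cfc_le (by positivity) fun t _ => ?_
      rw [hb, Real.norm_eq_abs, abs_mul, abs_mul, abs_of_nonneg (a := δ / (|t| + δ)) (by positivity)]
      rw [← pow_two ε, ← hδ]
      have := abs_nonneg t
      rw [div_mul_eq_mul_div, div_mul_div_comm, div_le_iff₀ (by positivity)]
      nlinarith [mul_nonneg this hδ0.le, mul_nonneg this this, mul_nonneg hδ0.le (mul_nonneg this this), mul_pos hδ0 hδ0, mul_nonneg this (mul_nonneg hδ0.le hδ0.le)]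
    nlinarith [norm_nonneg (y - y * e)]

theorem star_mem {x : B} (hx : x ∈ I.toSubmodule) : star x ∈ I.toSubmodule := by
  have : star x ∈ closure (I.toSubmodule : Set B) := by
    rw [Metric.mem_closure_iff]
    intro ε hε
    obtain ⟨e, he, hes, -, h⟩ := I.exists_approx_unit hx (half_pos hε)
    refine ⟨e * star x, I.mul_mem_right _ he, ?_⟩
    rw [dist_eq_norm]
    have : star x - e * star x = star (x - x * e) := by simp [hes]
    rw [this, norm_star]
    linarith
  exact I.isClosed.closure_subset this

/-- The quotient C*-algebra `B/I`, with the quotient norm. -/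
def Quotient : Type _ := B ⧸ I.toSubmodule

instance : IsClosed (I.toSubmodule : Set B) := I.isClosed

noncomputable instance : NormedAddCommGroup I.Quotient :=
  inferInstanceAs (NormedAddCommGroup (B ⧸ I.toSubmodule))

noncomputable instance : NormedSpace ℂ I.Quotient :=
  inferInstanceAs (NormedSpace ℂ (B ⧸ I.toSubmodule))

instance : CompleteSpace I.Quotient :=
  inferInstanceAs (CompleteSpace (B ⧸ I.toSubmodule))

/-- The quotient map, as a linear map. -/
def mkₗ : B →ₗ[ℂ] I.Quotient := I.toSubmodule.mkQ

theorem mkₗ_surjective : Function.Surjective I.mkₗ := I.toSubmodule.mkQ_surjective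

theorem mkₗ_eq_iff {x y : B} : I.mkₗ x = I.mkₗ y ↔ x - y ∈ I.toSubmodule :=
  Submodule.Quotient.eq _

theorem norm_mkₗ_le (x : B) : ‖I.mkₗ x‖ ≤ ‖x‖ := Submodule.Quotient.norm_mk_le _ x

theorem exists_norm_lt (x : I.Quotient) {ε : ℝ} (hε : 0 < ε) :
    ∃ b, I.mkₗ b = x ∧ ‖b‖ < ‖x‖ + ε := Submodule.Quotient.norm_mk_lt x hε

instance : Mul I.Quotient where
  mul := Quotient.map₂ (· * ·) (by
    intro a a' ha b b' hb
    have ha' := (Submodule.quotientRel_def _).1 ha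
    have hb' := (Submodule.quotientRel_def _).1 hb
    refine (Submodule.quotientRel_def _).2 ?_
    have : a * b - a' * b' = a * (b - b') + (a - a') * b' := by
      rw [mul_sub, sub_mul]; abel
    rw [this]
    exact I.toSubmodule.add_mem (I.mul_mem_left _ hb') (I.mul_mem_right _ ha'))

instance : Star I.Quotient where
  star := Quotient.map star (by
    intro a a' ha
    have ha' := (Submodule.quotientRel_def _).1 ha
    refine (Submodule.quotientRel_def _).2 ?_
    rw [← star_sub]
    exact I.star_mem ha')

theorem mkₗ_mul (x y : B) : I.mkₗ (x * y) = I.mkₗ x * I.mkₗ y := rfl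

theorem mkₗ_star (x : B) : I.mkₗ (star x) = star (I.mkₗ x) := rfl

noncomputable instance : NonUnitalNormedRing I.Quotient where
  __ := (inferInstance : NormedAddCommGroup I.Quotient)
  __ := (inferInstance : Mul I.Quotient)
  left_distrib := by
    simp only [I.mkₗ_surjective.forall, ← map_add, ← mkₗ_mul, mul_add, implies_true]
  right_distrib := by
    simp only [I.mkₗ_surjective.forall, ← map_add, ← mkₗ_mul, add_mul, implies_true]
  zero_mul := by
    simp only [I.mkₗ_surjective.forall]
    intro x
    rw [← map_zero I.mkₗ, ← mkₗ_mul, zero_mul]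
  mul_zero := by
    simp only [I.mkₗ_surjective.forall]
    intro x
    rw [← map_zero I.mkₗ, ← mkₗ_mul, mul_zero]
  mul_assoc := by
    simp only [I.mkₗ_surjective.forall, ← mkₗ_mul, mul_assoc, implies_true]
  norm_mul_le := by
    intro x y
    have key : ∀ ε > 0, ‖x * y‖ ≤ (‖x‖ + ε) * (‖y‖ + ε) := by
      intro ε hε
      obtain ⟨a, rfl, ha⟩ := I.exists_norm_lt x hε
      obtain ⟨b, rfl, hb⟩ := I.exists_norm_lt y hε
      rw [← mkₗ_mul]
      refine (I.norm_mkₗ_le _).trans ((norm_mul_le a b).trans ?_)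
      gcongr
    have lim : Filter.Tendsto (fun ε : ℝ => (‖x‖ + ε) * (‖y‖ + ε)) (nhdsWithin 0 (Set.Ioi 0))
        (nhds (‖x‖ * ‖y‖)) := by
      have : Continuous (fun ε : ℝ => (‖x‖ + ε) * (‖y‖ + ε)) := by fun_prop
      have h := this.tendsto 0
      simp only [add_zero] at h
      exact h.mono_left nhdsWithin_le_nhds
    refine ge_of_tendsto lim ?_
    filter_upwards [self_mem_nhdsWithin] with ε hε using key ε hε

noncomputable instance : StarRing I.Quotient where
  star_involutive := by
    intro x
    obtain ⟨x, rfl⟩ := I.mkₗ_surjective x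
    rw [← mkₗ_star, ← mkₗ_star, star_star]
  star_mul := by
    simp only [I.mkₗ_surjective.forall, ← mkₗ_mul, ← mkₗ_star, star_mul, implies_true]
  star_add := by
    simp only [I.mkₗ_surjective.forall, ← map_add, ← mkₗ_star, star_add, implies_true]

instance : CStarRing I.Quotient where
  norm_mul_self_le := by
    intro x
    obtain ⟨x, rfl⟩ := I.mkₗ_surjective x
    rw [← mkₗ_star, ← mkₗ_mul]
    refine le_of_forall_pos_le_add fun ε hε => ?_
    obtain ⟨z, hz, hzn⟩ := I.exists_norm_lt (I.mkₗ (star x * x)) (half_pos hε)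
    have hy : star x * x - z ∈ I.toSubmodule := (I.mkₗ_eq_iff).1 hz.symm
    set y := star x * x - z with hyd
    obtain ⟨e, he, hes, he1, hey⟩ := I.exists_approx_unit hy (half_pos hε)
    have h1 : I.mkₗ x = I.mkₗ (x - x * e) := by
      rw [mkₗ_eq_iff]; simpa using I.mul_mem_left x he
    have h2 : ‖I.mkₗ x‖ ≤ ‖x - x * e‖ := by rw [h1]; exact I.norm_mkₗ_le _
    set p : Unitization ℂ B := 1 - e with hp
    have hps : star p = p := by
      rw [hp, star_sub, star_one, ← Unitization.inr_star, hes]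
    have hxe : ((x - x * e : B) : Unitization ℂ B) = x * p := by simp [hp, mul_sub]
    have hye : ((y - y * e : B) : Unitization ℂ B) = y * p := by simp [hp, mul_sub]
    have h3 : ‖x - x * e‖ * ‖x - x * e‖ ≤ ‖z‖ + ‖y - y * e‖ := by
      rw [← Unitization.norm_inr (𝕜 := ℂ) (x - x * e), ← CStarRing.norm_star_mul_self, hxe, star_mul,
        hps]
      have : p * star (x : Unitization ℂ B) * (x * p) = p * (z : Unitization ℂ B) * p
          + p * ((y - y * e : B) : Unitization ℂ B) := by
        rw [hye, ← mul_assoc p, ← add_mul, ← mul_add, ← Unitization.inr_add, hyd]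
        simp [mul_assoc]
      rw [this]
      refine (norm_add_le _ _).trans (add_le_add ?_ ?_)
      · calc ‖p * (z : Unitization ℂ B) * p‖ ≤ ‖p‖ * ‖(z : Unitization ℂ B)‖ * ‖p‖ :=
              (norm_mul_le _ _).trans (mul_le_mul_of_nonneg_right (norm_mul_le _ _) (norm_nonneg _))
          _ ≤ 1 * ‖(z : Unitization ℂ B)‖ * 1 := by gcongr
          _ = ‖z‖ := by rw [one_mul, mul_one, Unitization.norm_inr]
      · calc _ ≤ ‖p‖ * ‖((y - y * e : B) : Unitization ℂ B)‖ := norm_mul_le _ _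
          _ ≤ 1 * ‖((y - y * e : B) : Unitization ℂ B)‖ := by gcongr
          _ = ‖y - y * e‖ := by rw [one_mul, Unitization.norm_inr]
    have h4 : ‖I.mkₗ x‖ * ‖I.mkₗ x‖ ≤ ‖x - x * e‖ * ‖x - x * e‖ :=
      mul_self_le_mul_self (norm_nonneg _) h2
    linarith

noncomputable instance : NonUnitalCStarAlgebra I.Quotient where
  smul_assoc r x y := by
    obtain ⟨x, rfl⟩ := I.mkₗ_surjective x
    obtain ⟨y, rfl⟩ := I.mkₗ_surjective y
    simp only [smul_eq_mul, ← map_smul, ← mkₗ_mul, smul_mul_assoc]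
  smul_comm r x y := by
    obtain ⟨x, rfl⟩ := I.mkₗ_surjective x
    obtain ⟨y, rfl⟩ := I.mkₗ_surjective y
    simp only [smul_eq_mul, ← map_smul, ← mkₗ_mul, mul_smul_comm]
  star_smul r x := by
    obtain ⟨x, rfl⟩ := I.mkₗ_surjective x
    simp only [← map_smul, ← mkₗ_star, star_smul]

/-- The quotient map `B → B/I`. -/
def mkHom : B →⋆ₙₐ[ℂ] I.Quotient where
  __ := I.mkₗ
  map_mul' := I.mkₗ_mul
  map_star' := I.mkₗ_star
  map_zero' := map_zero I.mkₗ

theorem mkHom_surjective : Function.Surjective I.mkHom := I.mkₗ_surjective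

theorem mkHom_eq_iff {x y : B} : I.mkHom x = I.mkHom y ↔ x - y ∈ I.toSubmodule := I.mkₗ_eq_iff

theorem mkHom_eq_zero_iff {x : B} : I.mkHom x = 0 ↔ x ∈ I.toSubmodule := by
  rw [← map_zero I.mkHom, mkHom_eq_iff, sub_zero]

/-- The kernel of a *-homomorphism. -/
def ker {C : Type*} [NonUnitalCStarAlgebra C] (φ : B →⋆ₙₐ[ℂ] C) : ClosedIdeal B where
  carrier := {x | φ x = 0}
  add_mem' {x y} hx hy := by
    change φ (x + y) = 0
    rw [map_add, show φ x = 0 from hx, show φ y = 0 from hy, add_zero]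
  zero_mem' := map_zero φ
  smul_mem' c x hx := by
    change φ (c • x) = 0
    rw [map_smul, show φ x = 0 from hx, smul_zero]
  mul_mem_left' a x hx := by
    change φ (a * x) = 0
    rw [map_mul, show φ x = 0 from hx, mul_zero]
  mul_mem_right' a x hx := by
    change φ (x * a) = 0
    rw [map_mul, show φ x = 0 from hx, zero_mul]
  isClosed' := isClosed_eq φ.continuous' continuous_const

/-- A *-homomorphism that vanishes on `I` factors through `B/I`. -/
def lift {C : Type*} [NonUnitalCStarAlgebra C] (φ : B →⋆ₙₐ[ℂ] C)
    (h : ∀ x ∈ I.toSubmodule, φ x = 0) : I.Quotient →⋆ₙₐ[ℂ] C where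
  toFun := I.toSubmodule.liftQ (φ : B →ₗ[ℂ] C) h
  map_smul' := map_smul _
  map_zero' := map_zero _
  map_add' := map_add _
  map_mul' x y := by
    obtain ⟨x, rfl⟩ := I.mkₗ_surjective x
    obtain ⟨y, rfl⟩ := I.mkₗ_surjective y
    exact map_mul φ x y
  map_star' x := by
    obtain ⟨x, rfl⟩ := I.mkₗ_surjective x
    exact map_star φ x

theorem lift_mkHom {C : Type*} [NonUnitalCStarAlgebra C] (φ : B →⋆ₙₐ[ℂ] C)
    (h : ∀ x ∈ I.toSubmodule, φ x = 0) (x : B) : I.lift φ h (I.mkHom x) = φ x := rfl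

end ClosedIdeal

noncomputable section

open Filter Topology
open scoped ENNReal

/-- The canonical order of the C*-algebra `B̃` obtained from `B` by adjoining a unit. -/
instance Unitization.instPartialOrderSpectral (B : Type*) [NonUnitalCStarAlgebra B] :
    PartialOrder (Unitization ℂ B) := CStarAlgebra.spectralOrder _

instance Unitization.instStarOrderedRingSpectral (B : Type*) [NonUnitalCStarAlgebra B] :
    StarOrderedRing (Unitization ℂ B) := CStarAlgebra.spectralOrderedRing _

/-- The C*-algebra `M_n(B̃)`. -/
abbrev UMat (B : Type*) [NonUnitalCStarAlgebra B] (n : ℕ) : Type _ :=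
  CStarMatrix (Fin n) (Fin n) (Unitization ℂ B)

/-- The C*-algebra `∏ₙ M_n(B̃)` of bounded sequences. -/
def ProdMat (B : Type*) [NonUnitalCStarAlgebra B] : Type _ := lp (fun n => UMat B n) ∞

instance ProdMat.instNonUnitalCStarAlgebra (B : Type*) [NonUnitalCStarAlgebra B] :
    NonUnitalCStarAlgebra (ProdMat B) :=
  inferInstanceAs (NonUnitalCStarAlgebra (lp (fun n => UMat B n) ∞))

instance ProdMat.instCoeFun (B : Type*) [NonUnitalCStarAlgebra B] :
    CoeFun (ProdMat B) (fun _ => ∀ n, UMat B n) := ⟨fun x => x.1⟩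

namespace ProdMat

variable (B : Type*) [NonUnitalCStarAlgebra B]

variable {B} in
theorem norm_apply_le (x : ProdMat B) (n : ℕ) : ‖x n‖ ≤ ‖x‖ :=
  lp.norm_apply_le_norm (E := fun n => UMat B n) ENNReal.top_ne_zero x n

/-- The ideal `⨁ₙ M_n(B̃)` of sequences that tend to zero in norm. -/
def c₀ : ClosedIdeal (ProdMat B) where
  carrier := {x | Tendsto (fun n => ‖x n‖) atTop (𝓝 0)}
  add_mem' {x y} hx hy := by
    refine squeeze_zero (fun n => norm_nonneg _) (fun n => norm_add_le (x n) (y n)) ?_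
    simpa using Tendsto.add (show Tendsto (fun n => ‖x n‖) atTop (𝓝 0) from hx)
      (show Tendsto (fun n => ‖y n‖) atTop (𝓝 0) from hy)
  zero_mem' := by
    change Tendsto (fun n => ‖(0 : UMat B n)‖) atTop (𝓝 0)
    simp
  smul_mem' c x hx := by
    change Tendsto (fun n => ‖c • x n‖) atTop (𝓝 0)
    simp only [norm_smul]
    simpa using Tendsto.const_mul ‖c‖ (show Tendsto (fun n => ‖x n‖) atTop (𝓝 0) from hx)
  mul_mem_left' a x hx := by
    refine squeeze_zero (g := fun n => ‖a‖ * ‖x n‖) (fun n => norm_nonneg _) (fun n => ?_) ?_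
    · change ‖a n * x n‖ ≤ _
      exact (norm_mul_le _ _).trans (by gcongr; exact norm_apply_le a n)
    · simpa using Tendsto.const_mul ‖a‖ (show Tendsto (fun n => ‖x n‖) atTop (𝓝 0) from hx)
  mul_mem_right' a x hx := by
    refine squeeze_zero (g := fun n => ‖x n‖ * ‖a‖) (fun n => norm_nonneg _) (fun n => ?_) ?_
    · change ‖x n * a n‖ ≤ _
      exact (norm_mul_le _ _).trans (by gcongr; exact norm_apply_le a n)
    · simpa using Tendsto.mul_const ‖a‖ (show Tendsto (fun n => ‖x n‖) atTop (𝓝 0) from hx)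
  isClosed' := by
    rw [← isSeqClosed_iff_isClosed]
    intro u x hu hx
    change Tendsto (fun n => ‖x n‖) atTop (𝓝 0)
    rw [Metric.tendsto_atTop]
    intro ε hε
    obtain ⟨m, hm⟩ := (Metric.tendsto_atTop.1 hx) (ε / 2) (half_pos hε)
    obtain ⟨N, hN⟩ := (Metric.tendsto_atTop.1
      (show Tendsto (fun n => ‖u m n‖) atTop (𝓝 0) from hu m)) (ε / 2) (half_pos hε)
    refine ⟨N, fun n hn => ?_⟩
    have h1 := hm m le_rfl
    have h2 := hN n hn
    rw [dist_zero_right, norm_norm] at h2 ⊢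
    rw [dist_comm, dist_eq_norm] at h1
    have h3 : ‖x n - u m n‖ ≤ ‖x - u m‖ := norm_apply_le (x - u m) n
    have h4 : ‖x n‖ ≤ ‖x n - u m n‖ + ‖u m n‖ := by
      simpa using norm_add_le (x n - u m n) (u m n)
    linarith

variable {B}

theorem norm_umat_le {n : ℕ} (M : UMat B n) : ‖M‖ ≤ ∑ j, ∑ i, ‖M i j‖ := by
  rw [CStarMatrix.norm_def]
  refine (CStarMatrix.toCLM M).opNorm_le_bound (by positivity) fun v => ?_
  simp only [CStarMatrix.toCLM_apply_eq_sum, Finset.sum_mul]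
  apply WithCStarModule.pi_norm_le_sum_norm _ |>.trans
  gcongr with i _
  rw [WithCStarModule.equiv_symm_pi_apply]
  apply norm_sum_le _ _ |>.trans
  gcongr with j _
  apply norm_mul_le _ _ |>.trans
  rw [mul_comm]
  gcongr
  exact WithCStarModule.norm_apply_le_norm v j

/-- The infinite matrix `b` vanishes outside its upper left `k × k` block. -/
def IsFin (k : ℕ) (b : ℕ → ℕ → B) : Prop := ∀ i j, k ≤ i ∨ k ≤ j → b i j = 0

/-- The `n × n` truncation of an infinite matrix. -/
def trunc (b : ℕ → ℕ → B) (n : ℕ) : UMat B n :=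
  CStarMatrix.ofMatrix (Matrix.of fun i j => (b i j : Unitization ℂ B))

theorem sum_le_sum_range {g : ℕ → ℝ} {n k : ℕ} (h0 : ∀ i, 0 ≤ g i) (h : ∀ i, k ≤ i → g i = 0) :
    ∑ i ∈ Finset.range n, g i ≤ ∑ i ∈ Finset.range k, g i := by
  rw [Finset.sum_subset (Finset.range_mono (le_max_right n k))
    fun i _ hi => h i (by simpa using hi)]
  exact Finset.sum_le_sum_of_subset_of_nonneg (Finset.range_mono (le_max_left n k))
    fun i _ _ => h0 i

theorem memℓp_trunc {k : ℕ} {b : ℕ → ℕ → B} (hb : IsFin k b) :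
    Memℓp (E := fun n => UMat B n) (trunc b) ∞ := by
  refine memℓp_infty ⟨∑ j ∈ Finset.range k, ∑ i ∈ Finset.range k, ‖b i j‖, ?_⟩
  rintro _ ⟨n, rfl⟩
  refine (norm_umat_le _).trans ?_
  have h1 : ∀ j : Fin n, ∑ i : Fin n, ‖trunc b n i j‖ = ∑ i ∈ Finset.range n, ‖b i j‖ := by
    intro j
    rw [← Fin.sum_univ_eq_sum_range (fun i => ‖b i j‖) n]
    exact Finset.sum_congr rfl fun i _ => Unitization.norm_inr (𝕜 := ℂ) (b i j)
  simp only [h1]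
  rw [Fin.sum_univ_eq_sum_range (fun j => ∑ i ∈ Finset.range n, ‖b i j‖) n]
  have h2 : ∀ j, ∑ i ∈ Finset.range n, ‖b i j‖ ≤ ∑ i ∈ Finset.range k, ‖b i j‖ := by
    intro j
    refine sum_le_sum_range (fun i => norm_nonneg _) fun i hi => ?_
    rw [hb i j (Or.inl hi), norm_zero]
  refine (Finset.sum_le_sum fun j _ => h2 j).trans ?_
  refine sum_le_sum_range (fun j => Finset.sum_nonneg fun i _ => norm_nonneg _) fun j hj => ?_
  exact Finset.sum_eq_zero fun i _ => by rw [hb i j (Or.inr hj), norm_zero]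

/-- The sequence of truncations of a finite matrix. -/
def ofFin {k : ℕ} {b : ℕ → ℕ → B} (hb : IsFin k b) : ProdMat B := ⟨trunc b, memℓp_trunc hb⟩

theorem ofFin_apply {k : ℕ} {b : ℕ → ℕ → B} (hb : IsFin k b) (n : ℕ) (i j : Fin n) :
    ofFin hb n i j = (b i j : Unitization ℂ B) := rfl

/-- `x` is eventually the sequence of truncations of the matrix `b`. -/
def Represents (x : ProdMat B) (k : ℕ) (b : ℕ → ℕ → B) : Prop :=
  IsFin k b ∧ ∀ n, k ≤ n → ∀ i j : Fin n, x n i j = (b i j : Unitization ℂ B)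

theorem represents_ofFin {k : ℕ} {b : ℕ → ℕ → B} (hb : IsFin k b) : Represents (ofFin hb) k b :=
  ⟨hb, fun _ _ _ _ => rfl⟩

theorem Represents.mono {x : ProdMat B} {k l : ℕ} {b : ℕ → ℕ → B} (h : Represents x k b)
    (hkl : k ≤ l) : Represents x l b :=
  ⟨fun i j hij => h.1 i j (hij.imp hkl.trans hkl.trans), fun n hn => h.2 n (hkl.trans hn)⟩

theorem Represents.add {x y : ProdMat B} {k : ℕ} {b c : ℕ → ℕ → B} (hx : Represents x k b)
    (hy : Represents y k c) : Represents (x + y) k (fun i j => b i j + c i j) := by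
  refine ⟨fun i j h => by simp only [hx.1 i j h, hy.1 i j h, add_zero], fun n hn i j => ?_⟩
  change x n i j + y n i j = _
  rw [hx.2 n hn, hy.2 n hn, Unitization.inr_add]

theorem Represents.mul {x y : ProdMat B} {k : ℕ} {b c : ℕ → ℕ → B} (hx : Represents x k b)
    (hy : Represents y k c) :
    Represents (x * y) k (fun i j => ∑ l ∈ Finset.range k, b i l * c l j) := by
  refine ⟨fun i j h => Finset.sum_eq_zero fun l _ => ?_, fun n hn i j => ?_⟩
  · rcases h with h | h
    · rw [hx.1 i l (Or.inl h), zero_mul]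
    · rw [hy.1 l j (Or.inr h), mul_zero]
  · change (x n * y n) i j = _
    rw [CStarMatrix.mul_apply]
    simp only [hx.2 n hn, hy.2 n hn, ← Unitization.inr_mul]
    rw [Fin.sum_univ_eq_sum_range
      (fun l => ((b i l * c l j : B) : Unitization ℂ B)) n]
    have : ∀ s : Finset ℕ, ∑ l ∈ s, ((b i l * c l j : B) : Unitization ℂ B)
        = ((∑ l ∈ s, b i l * c l j : B) : Unitization ℂ B) := fun s =>
      (map_sum (Unitization.inrNonUnitalAlgHom ℂ B) _ _).symm
    rw [this]
    congr 1
    refine (Finset.sum_subset (Finset.range_mono hn) fun l _ hl => ?_).symm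
    rw [hx.1 i l (Or.inr (by simpa using hl)), zero_mul]

theorem Represents.smul {x : ProdMat B} {k : ℕ} {b : ℕ → ℕ → B} (hx : Represents x k b) (r : ℂ) :
    Represents (r • x) k (fun i j => r • b i j) := by
  refine ⟨fun i j h => by simp only [hx.1 i j h, smul_zero], fun n hn i j => ?_⟩
  change r • x n i j = _
  rw [hx.2 n hn, Unitization.inr_smul]

theorem Represents.star {x : ProdMat B} {k : ℕ} {b : ℕ → ℕ → B} (hx : Represents x k b) :
    Represents (Star.star x) k (fun i j => Star.star (b j i)) := by
  refine ⟨fun i j h => by simp only [hx.1 j i h.symm, star_zero], fun n hn i j => ?_⟩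
  change Star.star (x n j i) = _
  rw [hx.2 n hn, Unitization.inr_star]

theorem Represents.exists_common {x y : ProdMat B} {k l : ℕ} {b c : ℕ → ℕ → B}
    (hx : Represents x k b) (hy : Represents y l c) :
    ∃ m, Represents x m b ∧ Represents y m c :=
  ⟨max k l, hx.mono (le_max_left _ _), hy.mono (le_max_right _ _)⟩

/-- Two sequences that represent the same matrix agree modulo `c₀`. -/
theorem Represents.mkHom_eq {x y : ProdMat B} {k l : ℕ} {b : ℕ → ℕ → B} (hx : Represents x k b)
    (hy : Represents y l b) : (c₀ B).mkHom x = (c₀ B).mkHom y := by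
  obtain ⟨m, hx, hy⟩ := hx.exists_common hy
  rw [ClosedIdeal.mkHom_eq_iff]
  refine tendsto_const_nhds.congr' ?_
  filter_upwards [eventually_ge_atTop m] with n hn
  have : x n = y n := CStarMatrix.ext fun i j => by rw [hx.2 n hn, hy.2 n hn]
  change _ = ‖x n - y n‖
  rw [this, sub_self, norm_zero]

variable (B)

/-- The *-algebra of sequences which are eventually the truncations of a finite matrix over `B`. -/
def finite : NonUnitalStarSubalgebra ℂ (ProdMat B) where
  carrier := {x | ∃ k b, Represents x k b}
  add_mem' := by
    rintro x y ⟨k, b, hx⟩ ⟨l, c, hy⟩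
    obtain ⟨m, hx, hy⟩ := hx.exists_common hy
    exact ⟨m, _, hx.add hy⟩
  zero_mem' := ⟨0, fun _ _ => 0, fun _ _ _ => rfl, fun _ _ _ _ => (Unitization.inr_zero ℂ).symm⟩
  mul_mem' := by
    rintro x y ⟨k, b, hx⟩ ⟨l, c, hy⟩
    obtain ⟨m, hx, hy⟩ := hx.exists_common hy
    exact ⟨m, _, hx.mul hy⟩
  smul_mem' := by
    rintro r x ⟨k, b, hx⟩
    exact ⟨k, _, hx.smul r⟩
  star_mem' := by
    rintro x ⟨k, b, hx⟩
    exact ⟨k, _, hx.star⟩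

/-- The closure of the finite matrices over `B` inside `∏ₙ M_n(B̃) / ⨁ₙ M_n(B̃)`. -/
def stab : NonUnitalStarSubalgebra ℂ (c₀ B).Quotient :=
  ((finite B).map (c₀ B).mkHom).topologicalClosure

end ProdMat

namespace ProdMat

variable {B : Type*} [NonUnitalCStarAlgebra B]

/-- The scalar matrix of the (truncated) unilateral shift, with entries `1` at `(j + 1, j)`. -/
def shiftMat (B : Type*) [NonUnitalCStarAlgebra B] (n : ℕ) : UMat B n :=
  CStarMatrix.ofMatrix (Matrix.of fun i j => if (i : ℕ) = j + 1 then 1 else 0)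

theorem shiftMat_apply (n : ℕ) (i j : Fin n) :
    shiftMat B n i j = if (i : ℕ) = j + 1 then 1 else 0 := rfl

theorem mul_shiftMat_apply {n : ℕ} (M : UMat B n) (i j : Fin n) :
    (M * shiftMat B n) i j = if h : (j : ℕ) + 1 < n then M i ⟨j + 1, h⟩ else 0 := by
  rw [CStarMatrix.mul_apply]
  simp only [shiftMat_apply, mul_ite, mul_one, mul_zero]
  split_ifs with h
  · rw [Finset.sum_eq_single ⟨j + 1, h⟩]
    · simp
    · intro l _ hl
      rw [if_neg]
      exact fun h' => hl (Fin.ext h')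
    · simp
  · refine Finset.sum_eq_zero fun l _ => if_neg fun h' => h ?_
    rw [← h']; exact l.2

theorem shiftMat_mul_zero {n : ℕ} (M : UMat B n) (i j : Fin n) (hi : (i : ℕ) = 0) :
    (shiftMat B n * M) i j = 0 := by
  rw [CStarMatrix.mul_apply]
  refine Finset.sum_eq_zero fun l _ => ?_
  rw [shiftMat_apply, if_neg (by omega), zero_mul]

theorem shiftMat_mul_succ {n : ℕ} (M : UMat B n) (i i' j : Fin n) (hi : (i : ℕ) = i' + 1) :
    (shiftMat B n * M) i j = M i' j := by
  rw [CStarMatrix.mul_apply, Finset.sum_eq_single i']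
  · rw [shiftMat_apply, if_pos hi, one_mul]
  · intro l _ hl
    rw [shiftMat_apply, if_neg, zero_mul]
    exact fun h' => hl (Fin.ext (by omega))
  · simp

theorem star_shiftMat_mul_apply {n : ℕ} (M : UMat B n) (i j : Fin n) :
    (star (shiftMat B n) * M) i j = if h : (i : ℕ) + 1 < n then M ⟨i + 1, h⟩ j else 0 := by
  have : star (shiftMat B n) * M = star (star M * shiftMat B n) := by rw [star_mul, star_star]
  rw [this, CStarMatrix.star_apply, mul_shiftMat_apply]
  split_ifs with h
  · rw [CStarMatrix.star_apply, star_star]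
  · exact star_zero _

theorem star_shiftMat_mul_shiftMat_mul_apply {n : ℕ} (M : UMat B n) (i j : Fin n) :
    (star (shiftMat B n) * (shiftMat B n * M)) i j = if (i : ℕ) + 1 < n then M i j else 0 := by
  rw [star_shiftMat_mul_apply]
  split_ifs with h
  · exact shiftMat_mul_succ M ⟨i + 1, h⟩ i j rfl
  · rfl

theorem norm_shiftMat_le (n : ℕ) : ‖shiftMat B n‖ ≤ 1 := by
  set s := shiftMat B n with hs
  have h1 : s * (star s * s) = s := by
    refine CStarMatrix.ext fun i j => ?_
    rw [← mul_assoc, hs, mul_shiftMat_apply, shiftMat_apply]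
    split_ifs with h1 h2 h2
    · have : (shiftMat B n * star (shiftMat B n)) i ⟨j + 1, h1⟩ = star (shiftMat B n) j ⟨j + 1, h1⟩ :=
        shiftMat_mul_succ _ _ _ _ h2
      rw [this, CStarMatrix.star_apply, shiftMat_apply, if_pos rfl, star_one]
    · rcases Nat.eq_zero_or_pos (i : ℕ) with h0 | h0
      · exact shiftMat_mul_zero _ _ _ h0
      · have hi : (i : ℕ) = (⟨i - 1, by omega⟩ : Fin n) + 1 := by simp; omega
        rw [shiftMat_mul_succ _ _ _ _ hi, CStarMatrix.star_apply, shiftMat_apply, if_neg, star_zero]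
        simp; omega
    · exact absurd i.2 (by omega)
    · rfl
  have h2 : ‖s‖ * ‖s‖ ≤ 1 * 1 := by
    rw [← CStarRing.norm_star_mul_self (x := s)]
    have h3 : star s * s * (star s * s) = star s * s := by rw [mul_assoc, h1]
    have h4 : ‖star s * s‖ * ‖star s * s‖ = ‖star s * s‖ := by
      conv_rhs => rw [← h3]
      have := CStarRing.norm_star_mul_self (x := star s * s)
      rw [star_mul, star_star] at this
      exact this.symm
    nlinarith [norm_nonneg (star s * s)]
  nlinarith [norm_nonneg s]

variable (B) in
/-- The sequence of truncated shifts. -/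
def shift : ProdMat B :=
  ⟨shiftMat B, memℓp_infty ⟨1, by rintro _ ⟨n, rfl⟩; exact norm_shiftMat_le n⟩⟩

theorem Represents.mul_shift {x : ProdMat B} {k : ℕ} {b : ℕ → ℕ → B} (hx : Represents x k b) :
    Represents (x * shift B) k (fun i j => b i (j + 1)) := by
  refine ⟨fun i j h => hx.1 i (j + 1) (by omega), fun n hn i j => ?_⟩
  change (x n * shiftMat B n) i j = _
  rw [mul_shiftMat_apply]
  split_ifs with h
  · rw [hx.2 n hn]
  · dsimp only
    rw [hx.1 i (j + 1) (by omega), Unitization.inr_zero]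

theorem Represents.shift_mul {x : ProdMat B} {k : ℕ} {b : ℕ → ℕ → B} (hx : Represents x k b) :
    Represents (shift B * x) (k + 1) (fun i j => if i = 0 then 0 else b (i - 1) j) := by
  refine ⟨fun i j h => ?_, fun n hn i j => ?_⟩
  · dsimp only
    split_ifs with hi
    · rfl
    · exact hx.1 (i - 1) j (by omega)
  · change (shiftMat B n * x n) i j = _
    dsimp only
    split_ifs with hi
    · rw [shiftMat_mul_zero _ _ _ hi, Unitization.inr_zero]
    · have hi' : (i : ℕ) = (⟨i - 1, by omega⟩ : Fin n) + 1 := by simp; omega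
      rw [shiftMat_mul_succ _ _ _ _ hi', hx.2 n (by omega)]

theorem Represents.star_shift_mul_shift_mul {x : ProdMat B} {k : ℕ} {b : ℕ → ℕ → B}
    (hx : Represents x k b) : Represents (Star.star (shift B) * (shift B * x)) (k + 1) b := by
  refine ⟨fun i j h => hx.1 i j (by omega), fun n hn i j => ?_⟩
  change (Star.star (shiftMat B n) * (shiftMat B n * x n)) i j = _
  rw [star_shiftMat_mul_shiftMat_mul_apply]
  split_ifs with h
  · rw [hx.2 n (by omega)]
  · rw [hx.1 i j (by omega), Unitization.inr_zero]

theorem mem_finite_iff {x : ProdMat B} : x ∈ finite B ↔ ∃ k b, Represents x k b := Iff.rfl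

theorem mkHom_mem_stab {x : ProdMat B} (hx : x ∈ finite B) : (c₀ B).mkHom x ∈ stab B :=
  subset_closure ⟨x, hx, rfl⟩

/-- To check a closed condition on `stab B` it is enough to check it on finite matrices. -/
theorem stab_induction {P : (c₀ B).Quotient → Prop} (hP : IsClosed {q | P q})
    (h : ∀ x k b, Represents x k b → P ((c₀ B).mkHom x)) {q : (c₀ B).Quotient} (hq : q ∈ stab B) :
    P q := by
  refine closure_minimal (t := {q | P q}) ?_ hP hq
  rintro _ ⟨x, ⟨k, b, hx⟩, rfl⟩
  exact h x k b hx

theorem isClosed_stab : IsClosed (stab B : Set (c₀ B).Quotient) := isClosed_closure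

instance : IsClosed (stab B : Set (c₀ B).Quotient) := isClosed_stab

theorem shift_mul_mem {q : (c₀ B).Quotient} (hq : q ∈ stab B) :
    (c₀ B).mkHom (shift B) * q ∈ stab B := by
  refine stab_induction (P := fun q => (c₀ B).mkHom (shift B) * q ∈ stab B)
    (isClosed_stab.preimage (by fun_prop)) (fun x k b hx => ?_) hq
  rw [← map_mul]
  exact mkHom_mem_stab ⟨_, _, hx.shift_mul⟩

theorem mul_shift_mem {q : (c₀ B).Quotient} (hq : q ∈ stab B) :
    q * (c₀ B).mkHom (shift B) ∈ stab B := by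
  refine stab_induction (P := fun q => q * (c₀ B).mkHom (shift B) ∈ stab B)
    (isClosed_stab.preimage (by fun_prop)) (fun x k b hx => ?_) hq
  rw [← map_mul]
  exact mkHom_mem_stab ⟨_, _, hx.mul_shift⟩

theorem star_shift_mul_shift_mul {q : (c₀ B).Quotient} (hq : q ∈ stab B) :
    star ((c₀ B).mkHom (shift B)) * ((c₀ B).mkHom (shift B) * q) = q := by
  refine stab_induction
    (P := fun q => star ((c₀ B).mkHom (shift B)) * ((c₀ B).mkHom (shift B) * q) = q)
    (isClosed_eq (by fun_prop) (by fun_prop)) (fun x k b hx => ?_) hq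
  rw [← map_star, ← map_mul, ← map_mul]
  exact hx.star_shift_mul_shift_mul.mkHom_eq hx

end ProdMat

/-- The C*-tensor product `B ⊗ K` with the algebra `K` of compact operators on `ℓ²(ℕ)`, that is, the
inductive limit of `B → M₂(B) → M₃(B) → ⋯` along the upper left corner embeddings. It is realized
in the usual way: a finite matrix over `B` is identified with the class of the sequence of its
`n × n` truncations in `∏ₙ M_n / ⨁ₙ M_n`, and `B ⊗ K` is the closure of the *-algebra of these
classes. The coefficients are taken in `M_n(B̃) ⊇ M_n(B)`, with `B̃ = B ⊕ ℂ`, only in order that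
scalar matrices can be multiplied with matrices over `B`. -/
def Stab (B : Type*) [NonUnitalCStarAlgebra B] : Type _ := ProdMat.stab B

namespace Stab

variable {B : Type*} [NonUnitalCStarAlgebra B]

instance : NonUnitalCStarAlgebra (Stab B) :=
  inferInstanceAs (NonUnitalCStarAlgebra (ProdMat.stab B))

/-- The inclusion of `B ⊗ K` into `∏ₙ M_n(B̃) / ⨁ₙ M_n(B̃)`. -/
def incl (B : Type*) [NonUnitalCStarAlgebra B] : Stab B →⋆ₙₐ[ℂ] (ProdMat.c₀ B).Quotient :=
  NonUnitalStarSubalgebraClass.subtype (ProdMat.stab B)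

theorem incl_injective : Function.Injective (incl B) := Subtype.val_injective

theorem incl_mem (x : Stab B) : incl B x ∈ ProdMat.stab B := x.2

theorem norm_incl (x : Stab B) : ‖incl B x‖ = ‖x‖ := rfl

theorem continuous_incl : Continuous (incl B) := continuous_subtype_val

/-- An element of `B ⊗ K`, given as an element of `∏ₙ M_n(B̃) / ⨁ₙ M_n(B̃)`. -/
def ofMem (q : (ProdMat.c₀ B).Quotient) (hq : q ∈ ProdMat.stab B) : Stab B := ⟨q, hq⟩

theorem incl_ofMem (q : (ProdMat.c₀ B).Quotient) (hq : q ∈ ProdMat.stab B) :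
    incl B (ofMem q hq) = q := rfl

/-- The element of `B ⊗ K` given by a finite matrix over `B`. -/
def ofMatrix {k : ℕ} {b : ℕ → ℕ → B} (hb : ProdMat.IsFin k b) : Stab B :=
  ofMem ((ProdMat.c₀ B).mkHom (ProdMat.ofFin hb))
    (ProdMat.mkHom_mem_stab ⟨_, _, ProdMat.represents_ofFin hb⟩)

theorem incl_ofMatrix {k : ℕ} {b : ℕ → ℕ → B} (hb : ProdMat.IsFin k b) :
    incl B (ofMatrix hb) = (ProdMat.c₀ B).mkHom (ProdMat.ofFin hb) := rfl

/-- Left multiplication by `1 ⊗ s` on `B ⊗ K`, for the unilateral shift `s`. -/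
def shiftLeft : Stab B →L[ℂ] Stab B :=
  LinearMap.mkContinuous
    { toFun := fun x => ofMem ((ProdMat.c₀ B).mkHom (ProdMat.shift B) * incl B x)
        (ProdMat.shift_mul_mem (incl_mem x))
      map_add' := fun x y => incl_injective (by simp only [map_add, incl_ofMem, mul_add])
      map_smul' := fun c x => incl_injective (by
        simp only [map_smul, incl_ofMem, mul_smul_comm, RingHom.id_apply]) }
    ‖(ProdMat.c₀ B).mkHom (ProdMat.shift B)‖ fun x => norm_mul_le _ (incl B x)

/-- Right multiplication by `1 ⊗ s` on `B ⊗ K`, for the unilateral shift `s`. -/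
def shiftRight : Stab B →L[ℂ] Stab B :=
  LinearMap.mkContinuous
    { toFun := fun x => ofMem (incl B x * (ProdMat.c₀ B).mkHom (ProdMat.shift B))
        (ProdMat.mul_shift_mem (incl_mem x))
      map_add' := fun x y => incl_injective (by simp only [map_add, incl_ofMem, add_mul])
      map_smul' := fun c x => incl_injective (by
        simp only [map_smul, incl_ofMem, smul_mul_assoc, RingHom.id_apply]) }
    ‖(ProdMat.c₀ B).mkHom (ProdMat.shift B)‖ fun x => by
      rw [mul_comm]; exact norm_mul_le (incl B x) _

theorem incl_shiftLeft (x : Stab B) :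
    incl B (shiftLeft x) = (ProdMat.c₀ B).mkHom (ProdMat.shift B) * incl B x := rfl

theorem incl_shiftRight (x : Stab B) :
    incl B (shiftRight x) = incl B x * (ProdMat.c₀ B).mkHom (ProdMat.shift B) := rfl

/-- The multiplier `1 ⊗ s` of `B ⊗ K`, where `s` is the unilateral shift. -/
def shift (B : Type*) [NonUnitalCStarAlgebra B] : 𝓜(ℂ, Stab B) where
  fst := shiftLeft
  snd := shiftRight
  central x y := incl_injective (by
    rw [map_mul, map_mul, incl_shiftLeft, incl_shiftRight, mul_assoc])

theorem star_shift_mul_shift : star (shift B) * shift B = 1 := by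
  have hf : ∀ x, (star (shift B)).fst ((shift B).fst x) = x := fun x => by
    rw [DoubleCentralizer.star_fst]
    apply incl_injective
    change incl B (star (shiftRight (star (shiftLeft x)))) = _
    rw [map_star, incl_shiftRight, star_mul, map_star, star_star, incl_shiftLeft,
      ProdMat.star_shift_mul_shift_mul (incl_mem x)]
  have hs : ∀ x, (shift B).snd ((star (shift B)).snd x) = x := fun x => by
    rw [DoubleCentralizer.star_snd]
    apply incl_injective
    change incl B (shiftRight (star (shiftLeft (star x)))) = _
    rw [incl_shiftRight, map_star, incl_shiftLeft]
    have := congrArg star (ProdMat.star_shift_mul_shift_mul (incl_mem (star x)))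
    rw [star_mul, star_star, map_star, star_star, ← map_star] at this
    exact this
  exact DoubleCentralizer.ext _ _ _ _
    (Prod.ext (ContinuousLinearMap.ext hf) (ContinuousLinearMap.ext hs))

theorem isFin_single (c : B) :
    ProdMat.IsFin 1 (fun i j => if i = 0 ∧ j = 0 then c else 0) :=
  fun _ _ h => if_neg (by omega)

/-- The corner embedding `b ↦ b ⊗ e₀₀` of `B` into `B ⊗ K`. -/
def corner (B : Type*) [NonUnitalCStarAlgebra B] : B →⋆ₙₐ[ℂ] Stab B where
  toFun c := ofMatrix (isFin_single c)
  map_smul' r c := by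
    apply incl_injective
    rw [MonoidHom.id_apply, map_smul, incl_ofMatrix, incl_ofMatrix, ← map_smul]
    refine (ProdMat.represents_ofFin _).mkHom_eq (k := 1) (l := 1) ?_
    convert (ProdMat.represents_ofFin (isFin_single c)).smul r using 3
    rw [smul_ite, smul_zero]
  map_zero' := by
    apply incl_injective
    rw [map_zero, incl_ofMatrix, ← map_zero (ProdMat.c₀ B).mkHom]
    refine (ProdMat.represents_ofFin _).mkHom_eq (k := 1) (l := 0) ⟨?_, ?_⟩
    · simp [ProdMat.IsFin]
    · simp
      intros
      rfl
  map_add' c d := by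
    apply incl_injective
    rw [map_add, incl_ofMatrix, incl_ofMatrix, incl_ofMatrix, ← map_add]
    refine (ProdMat.represents_ofFin _).mkHom_eq (k := 1) (l := 1) ?_
    convert (ProdMat.represents_ofFin (isFin_single c)).add
      (ProdMat.represents_ofFin (isFin_single d)) using 3
    split_ifs <;> simp
  map_mul' c d := by
    apply incl_injective
    rw [map_mul, incl_ofMatrix, incl_ofMatrix, incl_ofMatrix, ← map_mul]
    refine (ProdMat.represents_ofFin _).mkHom_eq (k := 1) (l := 1) ?_
    convert (ProdMat.represents_ofFin (isFin_single c)).mul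
      (ProdMat.represents_ofFin (isFin_single d)) using 3 with i j
    rw [Finset.sum_range_one]
    by_cases hi : i = 0 <;> by_cases hj : j = 0 <;> simp [hi, hj]
  map_star' c := by
    apply incl_injective
    rw [map_star, incl_ofMatrix, incl_ofMatrix, ← map_star]
    refine (ProdMat.represents_ofFin _).mkHom_eq (k := 1) (l := 1) ?_
    convert (ProdMat.represents_ofFin (isFin_single c)).star using 3 with i j
    by_cases hi : i = 0 <;> by_cases hj : j = 0 <;> simp [hi, hj]

theorem shiftRight_corner (c : B) : shiftRight (corner B c) = 0 := by
  apply incl_injective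
  rw [incl_shiftRight, map_zero]
  change (ProdMat.c₀ B).mkHom (ProdMat.ofFin (isFin_single c)) * _ = _
  rw [← map_mul, ← map_zero (ProdMat.c₀ B).mkHom]
  refine (ProdMat.represents_ofFin _).mul_shift.mkHom_eq (l := 0) ⟨?_, ?_⟩
  · simp [ProdMat.IsFin]
  · simp
    intros
    rfl

theorem corner_mul_shift (c : B) : (corner B c : 𝓜(ℂ, Stab B)) * shift B = 0 := by
  have h : ((shiftRight (corner B c) : Stab B) : 𝓜(ℂ, Stab B)) =
      (corner B c : 𝓜(ℂ, Stab B)) * shift B := by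
    refine DoubleCentralizer.ext _ _ _ _ (Prod.ext (ContinuousLinearMap.ext fun x => ?_)
      (ContinuousLinearMap.ext fun x => ?_))
    · exact (shift B).central _ _
    · change x * shiftRight (corner B c) = shiftRight (x * corner B c)
      apply incl_injective
      rw [map_mul, incl_shiftRight, incl_shiftRight, map_mul, mul_assoc]
  rw [← h, shiftRight_corner]
  exact map_zero (DoubleCentralizer.coeHom (𝕜 := ℂ) (A := Stab B))

end Stab

namespace Stab

variable {A B C : Type*} [NonUnitalCStarAlgebra A] [NonUnitalCStarAlgebra B]
  [NonUnitalCStarAlgebra C]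

/-- The direct sum `f ⊕ g` of *-homomorphisms `f : A → C` and `g : A → M(C ⊗ K)`, viewed as a
*-homomorphism into `M(C ⊗ K)` by means of the identification `ℂ ⊕ ℓ² = ℓ²` given by
`λ ⊕ ξ ↦ λ e₀ + s ξ`, where `s` is the unilateral shift. That is, `f ⊕ g` is the block diagonal
matrix with `f` in the upper left corner: `(f ⊕ g)(a) = f(a) ⊗ e₀₀ + (1 ⊗ s) g(a) (1 ⊗ s)*`. -/
def directSum (f : A →⋆ₙₐ[ℂ] C) (g : A →⋆ₙₐ[ℂ] 𝓜(ℂ, Stab C)) : A →⋆ₙₐ[ℂ] 𝓜(ℂ, Stab C) where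
  toFun a := (corner C (f a) : 𝓜(ℂ, Stab C)) + shift C * g a * star (shift C)
  map_smul' c a := by
    have := map_smul (DoubleCentralizer.coeHom (𝕜 := ℂ) (A := Stab C)) c (corner C (f a))
    simp only [DoubleCentralizer.coeHom_apply] at this
    simp only [map_smul, this, smul_add, mul_smul_comm, smul_mul_assoc, MonoidHom.id_apply]
  map_zero' := by
    have := map_zero (DoubleCentralizer.coeHom (𝕜 := ℂ) (A := Stab C))
    simp only [DoubleCentralizer.coeHom_apply] at this
    simp only [map_zero, this, mul_zero, zero_mul, add_zero]
  map_add' a b := by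
    have := map_add (DoubleCentralizer.coeHom (𝕜 := ℂ) (A := Stab C)) (corner C (f a))
      (corner C (f b))
    simp only [DoubleCentralizer.coeHom_apply] at this
    simp only [map_add, this, mul_add, add_mul]
    abel
  map_mul' a b := by
    have h1 := map_mul (DoubleCentralizer.coeHom (𝕜 := ℂ) (A := Stab C)) (corner C (f a))
      (corner C (f b))
    simp only [DoubleCentralizer.coeHom_apply] at h1
    have h2 := corner_mul_shift (f a)
    have h3 : star (shift C) * (corner C (f b) : 𝓜(ℂ, Stab C)) = 0 := by
      have h4 := congrArg star (corner_mul_shift (star (f b)))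
      have h5 := map_star (DoubleCentralizer.coeHom (𝕜 := ℂ) (A := Stab C)) (corner C (f b))
      simp only [DoubleCentralizer.coeHom_apply] at h5
      rw [map_star, h5, star_mul, star_star, star_zero] at h4
      exact h4
    have h6 := star_shift_mul_shift (B := C)
    rw [map_mul, map_mul, map_mul, h1, mul_add, add_mul, add_mul]
    have e1 : (corner C (f a) : 𝓜(ℂ, Stab C)) * (shift C * g b * star (shift C)) = 0 := by
      rw [← mul_assoc, ← mul_assoc, h2, zero_mul, zero_mul]
    have e2 : shift C * g a * star (shift C) * (corner C (f b) : 𝓜(ℂ, Stab C)) = 0 := by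
      rw [mul_assoc, h3, mul_zero]
    have e3 : shift C * g a * star (shift C) * (shift C * g b * star (shift C)) =
        shift C * (g a * g b) * star (shift C) := by
      calc _ = shift C * g a * (star (shift C) * shift C) * g b * star (shift C) := by
            simp only [mul_assoc]
        _ = _ := by rw [h6, mul_one]; simp only [mul_assoc]
    rw [e1, e2, e3, add_zero, zero_add]
  map_star' a := by
    have h := map_star (DoubleCentralizer.coeHom (𝕜 := ℂ) (A := Stab C)) (corner C (f a))
    simp only [DoubleCentralizer.coeHom_apply] at h
    simp only [map_star, h, star_add, star_mul, star_star, mul_assoc]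

theorem directSum_apply (f : A →⋆ₙₐ[ℂ] C) (g : A →⋆ₙₐ[ℂ] 𝓜(ℂ, Stab C)) (a : A) :
    directSum f g a = (corner C (f a) : 𝓜(ℂ, Stab C)) + shift C * g a * star (shift C) := rfl

end Stab

/-! ### Functoriality of the stabilization -/

namespace ProdMat

variable {B C : Type*} [NonUnitalCStarAlgebra B] [NonUnitalCStarAlgebra C]

/-- The *-homomorphism `M_n(B̃) → M_n(C̃)` that applies (the unital extension of) `φ` entrywise. -/
def mapMat (φ : B →⋆ₙₐ[ℂ] C) (n : ℕ) : UMat B n →⋆ₙₐ[ℂ] UMat C n :=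
  CStarMatrix.mapₙₐ ((Unitization.starMap φ : Unitization ℂ B →⋆ₐ[ℂ] Unitization ℂ C) :
    Unitization ℂ B →⋆ₙₐ[ℂ] Unitization ℂ C)

theorem mapMat_apply (φ : B →⋆ₙₐ[ℂ] C) (n : ℕ) (M : UMat B n) (i j : Fin n) :
    mapMat φ n M i j = Unitization.starMap φ (M i j) := rfl

/-- The *-homomorphism `∏ₙ M_n(B̃) → ∏ₙ M_n(C̃)` induced by `φ`. -/
def map (φ : B →⋆ₙₐ[ℂ] C) : ProdMat B →⋆ₙₐ[ℂ] ProdMat C where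
  toFun x := ⟨fun n => mapMat φ n (x n), memℓp_infty ⟨‖x‖, by
    rintro _ ⟨n, rfl⟩
    exact (NonUnitalStarAlgHom.norm_apply_le (mapMat φ n) (x n)).trans (norm_apply_le x n)⟩⟩
  map_smul' c x := Subtype.ext (funext fun n => map_smul (mapMat φ n) c (x n))
  map_zero' := Subtype.ext (funext fun n => map_zero (mapMat φ n))
  map_add' x y := Subtype.ext (funext fun n => map_add (mapMat φ n) (x n) (y n))
  map_mul' x y := Subtype.ext (funext fun n => map_mul (mapMat φ n) (x n) (y n))
  map_star' x := Subtype.ext (funext fun n => map_star (mapMat φ n) (x n))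

theorem map_apply (φ : B →⋆ₙₐ[ℂ] C) (x : ProdMat B) (n : ℕ) : map φ x n = mapMat φ n (x n) := rfl

theorem Represents.map {x : ProdMat B} {k : ℕ} {b : ℕ → ℕ → B} (hx : Represents x k b)
    (φ : B →⋆ₙₐ[ℂ] C) : Represents (map φ x) k (fun i j => φ (b i j)) := by
  refine ⟨fun i j h => by simp only [hx.1 i j h, map_zero], fun n hn i j => ?_⟩
  rw [map_apply, mapMat_apply, hx.2 n hn, Unitization.starMap_inr]

/-- The *-homomorphism `∏ₙ M_n(B̃) / ⨁ₙ M_n(B̃) → ∏ₙ M_n(C̃) / ⨁ₙ M_n(C̃)` induced by `φ`. -/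
def mapQuot (φ : B →⋆ₙₐ[ℂ] C) : (c₀ B).Quotient →⋆ₙₐ[ℂ] (c₀ C).Quotient :=
  (c₀ B).lift ((c₀ C).mkHom.comp (map φ)) fun x hx => by
    rw [NonUnitalStarAlgHom.comp_apply, ClosedIdeal.mkHom_eq_zero_iff]
    exact squeeze_zero (fun n => norm_nonneg _)
      (fun n => NonUnitalStarAlgHom.norm_apply_le (mapMat φ n) (x n)) hx

theorem mapQuot_mkHom (φ : B →⋆ₙₐ[ℂ] C) (x : ProdMat B) :
    mapQuot φ ((c₀ B).mkHom x) = (c₀ C).mkHom (map φ x) := rfl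

theorem mapQuot_mem (φ : B →⋆ₙₐ[ℂ] C) {q : (c₀ B).Quotient} (hq : q ∈ stab B) :
    mapQuot φ q ∈ stab C := by
  refine stab_induction (P := fun q => mapQuot φ q ∈ stab C)
    (isClosed_stab.preimage (mapQuot φ).continuous') (fun x k b hx => ?_) hq
  rw [mapQuot_mkHom]
  exact mkHom_mem_stab ⟨_, _, hx.map φ⟩

end ProdMat

/-- The range of a *-homomorphism between C*-algebras is closed. -/
theorem NonUnitalStarAlgHom.isClosed_range' {B C : Type*} [NonUnitalCStarAlgebra B]
    [NonUnitalCStarAlgebra C] (φ : B →⋆ₙₐ[ℂ] C) : IsClosed (Set.range φ) := by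
  set ψ := (ClosedIdeal.ker φ).lift φ fun x hx => hx with hψ
  have hinj : Function.Injective ψ := by
    rw [injective_iff_map_eq_zero]
    intro q hq
    obtain ⟨x, rfl⟩ := (ClosedIdeal.ker φ).mkHom_surjective q
    exact (ClosedIdeal.mkHom_eq_zero_iff _).2 hq
  have hiso : Isometry ψ := NonUnitalStarAlgHom.isometry ψ hinj
  have hr : Set.range φ = Set.range ψ := by
    ext y
    constructor
    · rintro ⟨x, rfl⟩
      exact ⟨(ClosedIdeal.ker φ).mkHom x, rfl⟩
    · rintro ⟨q, rfl⟩
      obtain ⟨x, rfl⟩ := (ClosedIdeal.ker φ).mkHom_surjective q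
      exact ⟨x, rfl⟩
  rw [hr]
  exact hiso.isClosedEmbedding.isClosed_range

namespace Stab

variable {B C : Type*} [NonUnitalCStarAlgebra B] [NonUnitalCStarAlgebra C]

/-- The *-homomorphism `φ ⊗ id : B ⊗ K → C ⊗ K`. -/
def map (φ : B →⋆ₙₐ[ℂ] C) : Stab B →⋆ₙₐ[ℂ] Stab C where
  toFun x := ofMem (ProdMat.mapQuot φ (incl B x)) (ProdMat.mapQuot_mem φ (incl_mem x))
  map_smul' c x := incl_injective (by simp only [map_smul, incl_ofMem, MonoidHom.id_apply])
  map_zero' := incl_injective (by simp only [map_zero, incl_ofMem])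
  map_add' x y := incl_injective (by simp only [map_add, incl_ofMem])
  map_mul' x y := incl_injective (by simp only [map_mul, incl_ofMem])
  map_star' x := incl_injective (by simp only [map_star, incl_ofMem])

theorem incl_map (φ : B →⋆ₙₐ[ℂ] C) (x : Stab B) :
    incl C (map φ x) = ProdMat.mapQuot φ (incl B x) := rfl

theorem map_surjective {φ : B →⋆ₙₐ[ℂ] C} (hφ : Function.Surjective φ) :
    Function.Surjective (map φ) := by
  have hcl : IsClosed (incl C '' Set.range (map φ)) := by
    have : incl C '' Set.range (map φ) = Set.range ((incl C).comp (map φ)) := by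
      rw [← Set.range_comp]; rfl
    rw [this]
    exact NonUnitalStarAlgHom.isClosed_range' _
  intro y
  have : incl C y ∈ incl C '' Set.range (map φ) := by
    refine ProdMat.stab_induction (P := fun q => q ∈ incl C '' Set.range (map φ)) hcl
      (fun x k c hx => ?_) (incl_mem y)
    choose r hr using hφ
    have hb : ProdMat.IsFin k (fun i j => if k ≤ i ∨ k ≤ j then 0 else r (c i j)) :=
      fun i j h => if_pos h
    refine ⟨_, ⟨ofMatrix hb, rfl⟩, ?_⟩
    rw [incl_map, incl_ofMatrix, ProdMat.mapQuot_mkHom]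
    refine ((ProdMat.represents_ofFin hb).map φ).mkHom_eq (l := k) ?_
    convert hx using 3 with i j
    split_ifs with h
    · rw [map_zero, hx.1 i j h]
    · exact hr _
  obtain ⟨_, ⟨x, rfl⟩, hx⟩ := this
  exact ⟨x, incl_injective hx⟩

end Stab

/-! ### Extension of surjections to multiplier algebras -/

namespace Multiplier

variable {X Y : Type*} [NonUnitalCStarAlgebra X] [NonUnitalCStarAlgebra Y]

theorem eq_zero_of_forall_mul {y : Y} (h : ∀ z : Y, z * y = 0) : y = 0 := by
  have := h (star y)
  rwa [CStarRing.star_mul_self_eq_zero_iff] at this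

theorem eq_zero_of_forall_mul' {y : Y} (h : ∀ z : Y, y * z = 0) : y = 0 := by
  have := h (star y)
  rwa [CStarRing.mul_star_self_eq_zero_iff] at this

theorem map_fst_eq_zero {ρ : X →⋆ₙₐ[ℂ] Y} (hρ : Function.Surjective ρ) (m : 𝓜(ℂ, X)) (x : X)
    (hx : ρ x = 0) : ρ (m.fst x) = 0 := by
  refine eq_zero_of_forall_mul fun z => ?_
  obtain ⟨w, rfl⟩ := hρ z
  rw [← map_mul, ← m.central, map_mul, hx, mul_zero]

theorem map_snd_eq_zero {ρ : X →⋆ₙₐ[ℂ] Y} (hρ : Function.Surjective ρ) (m : 𝓜(ℂ, X)) (x : X)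
    (hx : ρ x = 0) : ρ (m.snd x) = 0 := by
  refine eq_zero_of_forall_mul' fun z => ?_
  obtain ⟨w, rfl⟩ := hρ z
  rw [← map_mul, m.central, map_mul, hx, zero_mul]

theorem map_eq_map_of_eq {ρ : X →⋆ₙₐ[ℂ] Y} {T : X →L[ℂ] X}
    (hT : ∀ x, ρ x = 0 → ρ (T x) = 0) {x x' : X} (h : ρ x = ρ x') : ρ (T x) = ρ (T x') := by
  rw [← sub_eq_zero, ← map_sub, ← map_sub]
  exact hT _ (by rw [map_sub, h, sub_self])

/-- The operator on `Y` induced by an operator on `X` that preserves the kernel of a surjective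
*-homomorphism `ρ : X → Y`. -/
def descend {ρ : X →⋆ₙₐ[ℂ] Y} (hρ : Function.Surjective ρ) (T : X →L[ℂ] X)
    (hT : ∀ x, ρ x = 0 → ρ (T x) = 0) : Y →L[ℂ] Y where
  toFun y := ρ (T (Function.surjInv hρ y))
  map_add' y z := by
    rw [← map_add, ← map_add]
    exact map_eq_map_of_eq hT (by simp only [map_add, Function.surjInv_eq])
  map_smul' c y := by
    rw [RingHom.id_apply, ← map_smul, ← map_smul]
    exact map_eq_map_of_eq hT (by simp only [map_smul, Function.surjInv_eq])
  cont := by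
    let ρ' : X →L[ℂ] Y := ⟨ρ, ρ.continuous'⟩
    have hq : IsQuotientMap ρ := ρ'.isQuotientMap hρ
    refine hq.continuous_iff.2 ?_
    have : (fun y => ρ (T (Function.surjInv hρ y))) ∘ ρ = fun x => ρ (T x) :=
      funext fun x => map_eq_map_of_eq hT (Function.surjInv_eq hρ _)
    change Continuous ((fun y => ρ (T (Function.surjInv hρ y))) ∘ ρ)
    rw [this]
    exact ρ.continuous'.comp T.continuous

theorem descend_apply {ρ : X →⋆ₙₐ[ℂ] Y} (hρ : Function.Surjective ρ) (T : X →L[ℂ] X)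
    (hT : ∀ x, ρ x = 0 → ρ (T x) = 0) (x : X) : descend hρ T hT (ρ x) = ρ (T x) :=
  map_eq_map_of_eq hT (Function.surjInv_eq hρ _)

/-- Multipliers of `Y` are equal if they agree on the range of a surjection. -/
theorem ext_of_surjective {ρ : X →⋆ₙₐ[ℂ] Y} (hρ : Function.Surjective ρ) {m n : 𝓜(ℂ, Y)}
    (h₁ : ∀ x, m.fst (ρ x) = n.fst (ρ x)) (h₂ : ∀ x, m.snd (ρ x) = n.snd (ρ x)) : m = n := by
  refine DoubleCentralizer.ext _ _ _ _ (Prod.ext (ContinuousLinearMap.ext fun y => ?_)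
    (ContinuousLinearMap.ext fun y => ?_))
  · obtain ⟨x, rfl⟩ := hρ y
    exact h₁ x
  · obtain ⟨x, rfl⟩ := hρ y
    exact h₂ x

/-- The multiplier of `Y` induced by a multiplier of `X`. -/
def mapFun {ρ : X →⋆ₙₐ[ℂ] Y} (hρ : Function.Surjective ρ) (m : 𝓜(ℂ, X)) : 𝓜(ℂ, Y) where
  fst := descend hρ m.fst (map_fst_eq_zero hρ m)
  snd := descend hρ m.snd (map_snd_eq_zero hρ m)
  central y z := by
    obtain ⟨x, rfl⟩ := hρ y
    obtain ⟨w, rfl⟩ := hρ z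
    rw [descend_apply, descend_apply, ← map_mul, ← map_mul, m.central]

theorem mapFun_fst {ρ : X →⋆ₙₐ[ℂ] Y} (hρ : Function.Surjective ρ) (m : 𝓜(ℂ, X)) (x : X) :
    (mapFun hρ m).fst (ρ x) = ρ (m.fst x) := descend_apply hρ _ (map_fst_eq_zero hρ m) x

theorem mapFun_snd {ρ : X →⋆ₙₐ[ℂ] Y} (hρ : Function.Surjective ρ) (m : 𝓜(ℂ, X)) (x : X) :
    (mapFun hρ m).snd (ρ x) = ρ (m.snd x) := descend_apply hρ _ (map_snd_eq_zero hρ m) x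

/-- The canonical extension `M(X) → M(Y)` of a surjective *-homomorphism `ρ : X → Y`. It is
determined by `ρ̃(m) ρ(x) = ρ(m x)` and `ρ(x) ρ̃(m) = ρ(x m)`. -/
def map {ρ : X →⋆ₙₐ[ℂ] Y} (hρ : Function.Surjective ρ) : 𝓜(ℂ, X) →⋆ₙₐ[ℂ] 𝓜(ℂ, Y) where
  toFun := mapFun hρ
  map_smul' c m := by
    refine ext_of_surjective hρ (fun x => ?_) (fun x => ?_)
    · rw [mapFun_fst]
      change ρ (c • m.fst x) = c • (mapFun hρ m).fst (ρ x)
      rw [mapFun_fst, map_smul]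
    · rw [mapFun_snd]
      change ρ (c • m.snd x) = c • (mapFun hρ m).snd (ρ x)
      rw [mapFun_snd, map_smul]
  map_zero' := by
    refine ext_of_surjective hρ (fun x => ?_) (fun x => ?_)
    · rw [mapFun_fst]; exact map_zero ρ
    · rw [mapFun_snd]; exact map_zero ρ
  map_add' m n := by
    refine ext_of_surjective hρ (fun x => ?_) (fun x => ?_)
    · rw [mapFun_fst]
      change ρ (m.fst x + n.fst x) = (mapFun hρ m).fst (ρ x) + (mapFun hρ n).fst (ρ x)
      rw [mapFun_fst, mapFun_fst, map_add]
    · rw [mapFun_snd]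
      change ρ (m.snd x + n.snd x) = (mapFun hρ m).snd (ρ x) + (mapFun hρ n).snd (ρ x)
      rw [mapFun_snd, mapFun_snd, map_add]
  map_mul' m n := by
    refine ext_of_surjective hρ (fun x => ?_) (fun x => ?_)
    · rw [mapFun_fst]
      change ρ (m.fst (n.fst x)) = (mapFun hρ m).fst ((mapFun hρ n).fst (ρ x))
      rw [mapFun_fst, mapFun_fst]
    · rw [mapFun_snd]
      change ρ (n.snd (m.snd x)) = (mapFun hρ n).snd ((mapFun hρ m).snd (ρ x))
      rw [mapFun_snd, mapFun_snd]
  map_star' m := by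
    refine ext_of_surjective hρ (fun x => ?_) (fun x => ?_)
    · rw [mapFun_fst, DoubleCentralizer.star_fst, DoubleCentralizer.star_fst, ← map_star ρ,
        mapFun_snd, ← map_star ρ]
    · rw [mapFun_snd, DoubleCentralizer.star_snd, DoubleCentralizer.star_snd, ← map_star ρ,
        mapFun_fst, ← map_star ρ]

theorem map_fst {ρ : X →⋆ₙₐ[ℂ] Y} (hρ : Function.Surjective ρ) (m : 𝓜(ℂ, X)) (x : X) :
    (map hρ m).fst (ρ x) = ρ (m.fst x) := mapFun_fst hρ m x

theorem map_snd {ρ : X →⋆ₙₐ[ℂ] Y} (hρ : Function.Surjective ρ) (m : 𝓜(ℂ, X)) (x : X) :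
    (map hρ m).snd (ρ x) = ρ (m.snd x) := mapFun_snd hρ m x

end Multiplier

/-! ### Lifting properties -/

/-- Contractive completely positive (ccp) maps between C*-algebras. -/
def IsCCP {A X : Type*} [NonUnitalCStarAlgebra A] [NonUnitalCStarAlgebra X]
    (φ : A →ₗ[ℂ] X) : Prop :=
  letI := CStarAlgebra.spectralOrder A
  letI := CStarAlgebra.spectralOrder X
  haveI := CStarAlgebra.spectralOrderedRing A
  haveI := CStarAlgebra.spectralOrderedRing X
  (∃ ψ : CompletelyPositiveMap A X, ψ.toLinearMap = φ) ∧ ∀ a, ‖φ a‖ ≤ ‖a‖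

/-- A C*-algebra is σ-unital if it has a countable approximate unit. -/
def IsSigmaUnital (B : Type*) [NonUnitalCStarAlgebra B] : Prop :=
  letI := CStarAlgebra.spectralOrder B
  ∃ e : ℕ → B, (∀ n, 0 ≤ e n ∧ ‖e n‖ ≤ 1) ∧
    ∀ b, Tendsto (fun n => e n * b) atTop (𝓝 b) ∧ Tendsto (fun n => b * e n) atTop (𝓝 b)

/-- A C*-algebra, not assumed to be unital, has a unit. -/
def HasUnit (A : Type*) [NonUnitalCStarAlgebra A] : Prop :=
  ∃ e : A, ∀ a, e * a = a ∧ a * e = a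

/-- Every ccp map `A → B/I` lifts to a ccp map `A → B`. -/
def CCPMapsLift (A : Type*) [NonUnitalCStarAlgebra A] {B : Type*} [NonUnitalCStarAlgebra B]
    (I : ClosedIdeal B) : Prop :=
  ∀ φ : A →ₗ[ℂ] I.Quotient, IsCCP φ →
    ∃ ψ : A →ₗ[ℂ] B, IsCCP ψ ∧ ∀ a, I.mkHom (ψ a) = φ a

/-- The lifting property (LP): a unital C*-algebra `A` has the LP if every ccp map from `A` into a
quotient C*-algebra lifts to a ccp map; a non-unital C*-algebra has the LP if its unitization
does. -/
def HasLP (A : Type u) [NonUnitalCStarAlgebra A] : Prop :=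
  (HasUnit A → ∀ (D : Type v) [NonUnitalCStarAlgebra D] (J : ClosedIdeal D), CCPMapsLift A J) ∧
  (¬ HasUnit A → ∀ (D : Type v) [NonUnitalCStarAlgebra D] (J : ClosedIdeal D),
    CCPMapsLift (Unitization ℂ A) J)

/-- The *-homomorphism `M(B ⊗ K) → M(B/I ⊗ K)` that extends the surjection
`B ⊗ K → B/I ⊗ K`. -/
def stabQuotientMap {B : Type*} [NonUnitalCStarAlgebra B] (I : ClosedIdeal B) :
    𝓜(ℂ, Stab B) →⋆ₙₐ[ℂ] 𝓜(ℂ, Stab I.Quotient) :=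
  Multiplier.map (Stab.map_surjective I.mkHom_surjective)

/-- For every *-homomorphism `f : A → B/I` there is a *-homomorphism `g : A → M(B/I ⊗ K)` such that
`f ⊕ g` lifts to a *-homomorphism `A → M(B ⊗ K)`. -/
def HomSummandLifts (A : Type*) [NonUnitalCStarAlgebra A] {B : Type*} [NonUnitalCStarAlgebra B]
    (I : ClosedIdeal B) : Prop :=
  ∀ f : A →⋆ₙₐ[ℂ] I.Quotient, ∃ g : A →⋆ₙₐ[ℂ] 𝓜(ℂ, Stab I.Quotient),
    ∃ F : A →⋆ₙₐ[ℂ] 𝓜(ℂ, Stab B), ∀ a, stabQuotientMap I (F a) = Stab.directSum f g a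

/-- For every *-homomorphism `f : A → B/I` there is a *-homomorphism `g : A → M(B/I ⊗ K)` such that
`f ⊕ g` lifts to a ccp map `A → M(B ⊗ K)`. -/
def HomSummandLiftsCCP (A : Type*) [NonUnitalCStarAlgebra A] {B : Type*}
    [NonUnitalCStarAlgebra B] (I : ClosedIdeal B) : Prop :=
  ∀ f : A →⋆ₙₐ[ℂ] I.Quotient, ∃ g : A →⋆ₙₐ[ℂ] 𝓜(ℂ, Stab I.Quotient),
    ∃ F : A →ₗ[ℂ] 𝓜(ℂ, Stab B), IsCCP F ∧ ∀ a, stabQuotientMap I (F a) = Stab.directSum f g a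

end

/-! The proof trades ccp maps for *-homomorphisms and back. Dilation goes one way: for separable
`A`, every ccp map `φ : A → B` is the corner `p F(·) p`, with `p = 1 ⊗ e₀₀`, of a *-homomorphism `F
: A → M(B ⊗ K)` (`Stab.exists_dilation`). Compression goes back (`exists_isCCP_compression`).

(i) ⇒ (ii): lift `f` to a ccp map and dilate the lift to `F`. The image of `F` in `M(B/I ⊗ K)` has
the multiplicative corner `f`; this forces the off-diagonal entries to vanish, so the image is `f ⊕
g` (`Stab.exists_eq_directSum`). (ii) ⇒ (iii) holds since *-homomorphisms are ccp.

(iii) for `M(B ⊗ K)` ⇒ (i) for `B`: dilate a ccp map `φ : A → B/I` to `f : A → M(B/I ⊗ K)`. For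
σ-unital `B` the map `π̃_I` is onto, so `f` is a *-homomorphism into a quotient of `M(B ⊗ K)`, and
(iii) yields a ccp lift of `f ⊕ g`. Its corner is a ccp lift of `f` to `M(B ⊗ K)`. Compressing that
by `eₙ ⊗ e₀₀`, for an approximate unit `eₙ` of `B`, gives ccp maps `A → B` that lift maps converging
pointwise to `φ`. By Arveson's theorem the liftable ccp maps are closed under pointwise limits
(`ClosedIdeal.exists_isCCP_lift_of_tendsto`), so `φ` lifts.

Arveson's theorem and the surjectivity of `π̃_I` (noncommutative Tietze,
`Multiplier.map_surjective`) rest on one device. A quasi-central approximate unit of an ideal yields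
commuting self-adjoint `k`, `L` with `k² + L² = 1`, `k` in the ideal and `L` in `1` plus the ideal.
The operation `(x, y) ↦ k x k + L y L` preserves ccp maps and norm bounds, agrees with `y` modulo
the ideal, and stays close to `x` wherever `x` and `y` are close modulo the ideal. Gluing successive
lifts therefore produces a Cauchy sequence of lifts.

The dilation is Stinespring's construction combined with Kasparov stabilization in the style of
Mingo and Phillips, carried out inside `M(B ⊗ K)` without naming the Hilbert module `E` of `Φ`. A
sequence `aᵢ` that returns infinitely often near every element has the weighted Gram matrix `Φ(aᵢ*
aⱼ) + δᵢⱼ 4⁻ⁱ`. The perturbation gives its square root `h` dense range, and the rescaled columns of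
`h` model the vectors `aᵢ ⊕ 2⁻ⁱ eᵢ` of `E ⊕ H`. Along indices tending to infinity the perturbation
disappears, which leaves vectors `k(b)` with inner products `p Φ(b* c) p`; left multiplication on
these is the required representation.

For (c) ⇒ (a), the last implication of (2) applied to unitizations shows that ccp maps on `A` lift.
If `A` has no unit, this makes *-homomorphisms on the unitization of `A` liftable by ccp maps, so
(iii) holds for the unitization with `g = 0`, and the same implication applies once more. -/

noncomputable section

open Filter Topology

/-! ### Positive kernels and completely positive maps -/

/-- A matrix `x` over a C*-algebra is positive: `x = M* M` for a rectangular matrix `M`. -/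
def PosKernel {X : Type*} [NonUnitalCStarAlgebra X] {n : ℕ} (x : Fin n → Fin n → X) : Prop :=
  ∃ (m : ℕ) (M : Fin m → Fin n → X), ∀ i j, x i j = ∑ k, star (M k i) * M k j

/-- Complete positivity, expressed by means of kernels. -/
def IsCP {A X : Type*} [NonUnitalCStarAlgebra A] [NonUnitalCStarAlgebra X]
    (φ : A →ₗ[ℂ] X) : Prop :=
  ∀ (n : ℕ) (c : Fin n → A), PosKernel fun i j => φ (star (c i) * c j)

theorem CStarAlgebra.exists_eq_star_mul_self {X : Type*} [NonUnitalCStarAlgebra X] [PartialOrder X]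
    [StarOrderedRing X] {x : X} (h : 0 ≤ x) : ∃ y, x = star y * y :=
  CStarAlgebra.nonneg_iff_eq_star_mul_self.1 h

namespace PosKernel

variable {X Y : Type*} [NonUnitalCStarAlgebra X] [NonUnitalCStarAlgebra Y] {n : ℕ}

theorem of_fintype {ι : Type*} [Fintype ι] {x : Fin n → Fin n → X} (M : ι → Fin n → X)
    (h : ∀ i j, x i j = ∑ k, star (M k i) * M k j) : PosKernel x := by
  refine ⟨Fintype.card ι, fun k => M ((Fintype.equivFin ι).symm k), fun i j => ?_⟩
  rw [h, ← Equiv.sum_comp (Fintype.equivFin ι).symm]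

theorem single (r : Fin n → X) : PosKernel fun i j => star (r i) * r j :=
  of_fintype (ι := Unit) (fun _ => r) (by simp)

theorem sum {ι : Type*} [Fintype ι] {x : ι → Fin n → Fin n → X} (h : ∀ k, PosKernel (x k)) :
    PosKernel fun i j => ∑ k, x k i j := by
  choose m M hM using h
  refine of_fintype (ι := Σ k, Fin (m k)) (fun k => M k.1 k.2) fun i j => ?_
  rw [Fintype.sum_sigma]
  simp only [hM]

theorem add {x y : Fin n → Fin n → X} (hx : PosKernel x) (hy : PosKernel y) :
    PosKernel fun i j => x i j + y i j := by
  have := sum (ι := Bool) (x := fun b => if b then x else y) (by rintro (_ | _) <;> simpa)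
  simpa using this

theorem map {x : Fin n → Fin n → X} (hx : PosKernel x) (φ : X →⋆ₙₐ[ℂ] Y) :
    PosKernel fun i j => φ (x i j) := by
  obtain ⟨m, M, hM⟩ := hx
  exact ⟨m, fun k i => φ (M k i), fun i j => by simp [hM, map_star]⟩

theorem conj {x : Fin n → Fin n → X} (hx : PosKernel x) (b : X) :
    PosKernel fun i j => star b * x i j * b := by
  obtain ⟨m, M, hM⟩ := hx
  refine ⟨m, fun k i => M k i * b, fun i j => ?_⟩
  simp [hM, Finset.mul_sum, Finset.sum_mul, mul_assoc]

section Order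

variable [PartialOrder X] [StarOrderedRing X] [PartialOrder Y] [StarOrderedRing Y]

/-- A row of the rectangular factor, placed as the first row of an otherwise zero square matrix `N`,
contributes `N* N`, so the kernel is a sum of squares; conversely a positive matrix is a single
square. For `n = 0` there is no first row, hence the case distinction. -/
theorem iff_nonneg {x : Fin n → Fin n → X} :
    PosKernel x ↔ 0 ≤ (CStarMatrix.ofMatrix (Matrix.of x) : CStarMatrix (Fin n) (Fin n) X) := by
  constructor
  · rintro ⟨m, M, hM⟩
    rcases n with _ | n
    · exact le_of_eq (CStarMatrix.ext fun i => i.elim0)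
    · have : (CStarMatrix.ofMatrix (Matrix.of x) : CStarMatrix (Fin (n + 1)) (Fin (n + 1)) X) =
          ∑ k, star (CStarMatrix.ofMatrix (Matrix.of fun i j => if i = 0 then M k j else 0)) *
            (CStarMatrix.ofMatrix (Matrix.of fun i j => if i = 0 then M k j else 0)) := by
        ext i j
        have hs : ∀ (s : Finset (Fin m)) (f : Fin m → CStarMatrix (Fin (n + 1)) (Fin (n + 1)) X),
            (∑ k ∈ s, f k) i j = ∑ k ∈ s, f k i j := by
          intro s f
          induction s using Finset.cons_induction with
          | empty => simp
          | cons a s ha ih => rw [Finset.sum_cons, Finset.sum_cons, CStarMatrix.add_apply, ih]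
        rw [hs]
        simp only [CStarMatrix.mul_apply, CStarMatrix.star_apply]
        change x i j = ∑ k, ∑ l, star (if l = 0 then M k i else 0) * (if l = 0 then M k j else 0)
        rw [hM]
        refine Finset.sum_congr rfl fun k _ => ?_
        rw [Finset.sum_eq_single 0] <;> simp +contextual
      rw [this]
      exact Finset.sum_nonneg fun k _ => star_mul_self_nonneg _
  · intro h
    obtain ⟨M, hM⟩ := CStarAlgebra.exists_eq_star_mul_self h
    refine ⟨n, fun k i => M k i, fun i j => ?_⟩
    have : (CStarMatrix.ofMatrix (Matrix.of x) : CStarMatrix (Fin n) (Fin n) X) i j =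
      (star M * M) i j := by rw [hM]
    simpa [CStarMatrix.mul_apply, CStarMatrix.star_apply] using this

-- Entrywise convergence is convergence in `M_n(X)`, whose positive cone is closed.
omit [PartialOrder X] [StarOrderedRing X] [PartialOrder Y] [StarOrderedRing Y] in
theorem of_tendsto {ι : Type*} {l : Filter ι} [l.NeBot] {x : ι → Fin n → Fin n → X}
    {y : Fin n → Fin n → X} (h : ∀ i j, Tendsto (fun t => x t i j) l (𝓝 (y i j)))
    (hx : ∀ᶠ t in l, PosKernel (x t)) : PosKernel y := by
  let _ := CStarAlgebra.spectralOrder X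
  have _ := CStarAlgebra.spectralOrderedRing X
  rw [iff_nonneg]
  have hc : Tendsto (fun t => (CStarMatrix.ofMatrix (Matrix.of (x t)) :
      CStarMatrix (Fin n) (Fin n) X)) l (𝓝 (CStarMatrix.ofMatrix (Matrix.of y))) := by
    have : Tendsto (fun t => (Matrix.of (x t) : Matrix (Fin n) (Fin n) X)) l
        (𝓝 (Matrix.of y)) := tendsto_pi_nhds.2 fun i => tendsto_pi_nhds.2 fun j => h i j
    exact this
  exact CStarAlgebra.isClosed_nonneg.mem_of_tendsto hc (hx.mono fun t ht => iff_nonneg.1 ht)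

end Order

end PosKernel

/-- Functional calculus commutes with `φ`, so the negative part of `x` is mapped to that of `φ x`,
which is zero. -/
theorem NonUnitalStarAlgHom.nonneg_of_map_nonneg {X Y : Type*} [NonUnitalCStarAlgebra X]
    [NonUnitalCStarAlgebra Y] [PartialOrder X] [StarOrderedRing X] [PartialOrder Y]
    [StarOrderedRing Y] {φ : X →⋆ₙₐ[ℂ] Y} (hφ : Function.Injective φ) {x : X} (h : 0 ≤ φ x) :
    0 ≤ x := by
  have hsa : IsSelfAdjoint x := hφ (by rw [map_star, (IsSelfAdjoint.of_nonneg h).star_eq])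
  have h1 : φ (x⁻) = (φ x)⁻ := by
    rw [CFC.negPart_def, CFC.negPart_def]
    exact NonUnitalStarAlgHomClass.map_cfcₙ (S := ℂ) φ _ x (hφ := φ.continuous')
      (hφa := IsSelfAdjoint.of_nonneg h)
  rw [← CFC.negPart_eq_zero_iff x hsa]
  apply hφ
  rw [h1, map_zero, CFC.negPart_eq_zero_iff _ (IsSelfAdjoint.of_nonneg h)]
  exact h

/-- This lets positivity be tested in a larger algebra, such as the unitization or `M(B ⊗ K)`. -/
theorem PosKernel.of_map {X Y : Type*} [NonUnitalCStarAlgebra X] [NonUnitalCStarAlgebra Y] {n : ℕ}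
    {φ : X →⋆ₙₐ[ℂ] Y} (hφ : Function.Injective φ) {x : Fin n → Fin n → X}
    (h : PosKernel fun i j => φ (x i j)) : PosKernel x := by
  let _ := CStarAlgebra.spectralOrder X
  have _ := CStarAlgebra.spectralOrderedRing X
  let _ := CStarAlgebra.spectralOrder Y
  have _ := CStarAlgebra.spectralOrderedRing Y
  rw [iff_nonneg] at h ⊢
  refine NonUnitalStarAlgHom.nonneg_of_map_nonneg (φ := CStarMatrix.mapₙₐ φ) ?_ h
  intro M N hMN
  refine CStarMatrix.ext fun i j => hφ ?_
  exact congrFun (congrFun hMN i) j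

/-! ### Contractive completely positive maps and unital extension -/

variable {A X Y : Type*} [NonUnitalCStarAlgebra A] [NonUnitalCStarAlgebra X]
  [NonUnitalCStarAlgebra Y]

/-- A positive matrix over `A` is a sum of kernels `cᵢ* cⱼ`, so complete positivity need only be
tested on these. -/
theorem isCCP_iff {φ : A →ₗ[ℂ] X} : IsCCP φ ↔ IsCP φ ∧ ∀ a, ‖φ a‖ ≤ ‖a‖ := by
  let _ := CStarAlgebra.spectralOrder A
  have _ := CStarAlgebra.spectralOrderedRing A
  let _ := CStarAlgebra.spectralOrder X
  have _ := CStarAlgebra.spectralOrderedRing X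
  refine and_congr_left fun _ => ⟨?_, fun h => ?_⟩
  · rintro ⟨ψ, rfl⟩ n c
    rw [PosKernel.iff_nonneg]
    exact ψ.map_cstarMatrix_nonneg' n _ (PosKernel.iff_nonneg.1 (PosKernel.single c))
  · refine ⟨⟨φ, fun n M hM => ?_⟩, rfl⟩
    obtain ⟨m, N, hN⟩ := (PosKernel.iff_nonneg (x := fun i j => M i j)).2 hM
    refine (PosKernel.iff_nonneg (x := fun i j => φ (M i j))).1 ?_
    simp only [hN, map_sum]
    exact PosKernel.sum fun k => h n (N k)

/-- The extension `λ + a ↦ λ e + φ(a)` of a linear map to the unitization. -/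
def unitExt (φ : A →ₗ[ℂ] X) (e : X) : Unitization ℂ A →ₗ[ℂ] X where
  toFun x := x.fst • e + φ x.snd
  map_add' x y := by simp only [Unitization.fst_add, Unitization.snd_add, map_add, add_smul]; abel
  map_smul' r x := by simp [mul_smul]

theorem unitExt_apply (φ : A →ₗ[ℂ] X) (e : X) (x : Unitization ℂ A) :
    unitExt φ e x = x.fst • e + φ x.snd := rfl

theorem unitExt_inr (φ : A →ₗ[ℂ] X) (e : X) (a : A) : unitExt φ e (a : Unitization ℂ A) = φ a := by
  simp [unitExt_apply]

theorem unitExt_one (φ : A →ₗ[ℂ] X) (e : X) : unitExt φ e 1 = e := by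
  simp [unitExt_apply]

/-- In the unitization `1 - w* w` is positive; compressing it by the unit `e` of `X`, which is not
the adjoined unit, gives `e - w* w`. -/
theorem exists_star_mul_self_eq_unit_sub {e : X} (he : ∀ x, e * x = x ∧ x * e = x) (w : X)
    (h : ‖star w * w‖ ≤ 1) : ∃ z, e - star w * w = star z * z := by
  let _ := CStarAlgebra.spectralOrder X
  have _ := CStarAlgebra.spectralOrderedRing X
  rw [← CStarAlgebra.nonneg_iff_eq_star_mul_self, ← Unitization.inr_nonneg_iff]
  have hes : star e = e := by
    have h1 := (he (star e)).1
    have h2 := congrArg star h1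
    rw [star_mul, star_star, h1] at h2
    exact h2
  have h1 : (0 : Unitization ℂ X) ≤ 1 - ((star w * w : X) : Unitization ℂ X) := by
    rw [sub_nonneg]
    refine (CStarAlgebra.norm_le_one_iff_of_nonneg _ ?_).1 (by rwa [Unitization.norm_inr])
    rw [Unitization.inr_mul, Unitization.inr_star]
    exact star_mul_self_nonneg _
  have h2 := star_left_conjugate_nonneg h1 (e : Unitization ℂ X)
  have h3 : star (e : Unitization ℂ X) * (1 - ((star w * w : X) : Unitization ℂ X)) * e =
      ((e - star w * w : X) : Unitization ℂ X) := by
    rw [← Unitization.inr_star, hes, mul_sub, mul_one, sub_mul, ← Unitization.inr_mul,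
      ← Unitization.inr_mul, ← Unitization.inr_mul, ← Unitization.inr_sub, (he _).1, (he _).1,
      (he _).2]
  rwa [h3] at h2

theorem exists_approxUnit_filter (A : Type*) [NonUnitalCStarAlgebra A] :
    ∃ l : Filter A, l.NeBot ∧ (∀ᶠ u in l, star u = u ∧ ‖u‖ ≤ 1) ∧
      ∀ a, Tendsto (· * a) l (𝓝 a) ∧ Tendsto (a * ·) l (𝓝 a) := by
  let _ := CStarAlgebra.spectralOrder A
  have _ := CStarAlgebra.spectralOrderedRing A
  have h := CStarAlgebra.increasingApproximateUnit A
  exact ⟨CStarAlgebra.approximateUnit A, inferInstance,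
    h.eventually_star_eq.and h.eventually_norm, fun a =>
      ⟨h.tendsto_mul_right a, h.tendsto_mul_left a⟩⟩

theorem IsCP.exists_apply_star_mul_self {φ : A →ₗ[ℂ] X} (h : IsCP φ) (a : A) :
    ∃ w, φ (star a * a) = star w * w := by
  let _ := CStarAlgebra.spectralOrder X
  have _ := CStarAlgebra.spectralOrderedRing X
  rw [← CStarAlgebra.nonneg_iff_eq_star_mul_self]
  obtain ⟨m, M, hM⟩ := h 1 fun _ => a
  rw [show φ (star a * a) = _ from hM 0 0]
  exact Finset.sum_nonneg fun k _ => star_mul_self_nonneg _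

theorem IsCCP.isCP {φ : A →ₗ[ℂ] X} (h : IsCCP φ) : IsCP φ := (isCCP_iff.1 h).1

theorem IsCCP.norm_le {φ : A →ₗ[ℂ] X} (h : IsCCP φ) (a : A) : ‖φ a‖ ≤ ‖a‖ := h.2 a

theorem IsCCP.continuous {φ : A →ₗ[ℂ] X} (h : IsCCP φ) : Continuous φ :=
  AddMonoidHomClass.continuous_of_bound φ 1 fun a => by rw [one_mul]; exact h.norm_le a

/-- Replace `λᵢ + aᵢ` by `λᵢ u + aᵢ` with `u` from an approximate unit of `A`, and add the positive
kernel `λ̄ᵢ λⱼ (e - φ(u* u))`. The terms in `φ(u* u)` cancel, and what remains converges to the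
kernel of the extension. -/
theorem IsCP.unitExt {φ : A →ₗ[ℂ] X} (h : IsCCP φ) {e : X} (he : ∀ x, e * x = x ∧ x * e = x) :
    IsCP (unitExt φ e) := by
  intro n c
  obtain ⟨l, hl, hl1, hl2⟩ := exists_approxUnit_filter A
  refine PosKernel.of_tendsto (l := l) (x := fun u i j =>
    φ (star ((c i).fst • u + (c i).snd) * ((c j).fst • u + (c j).snd)) +
      (star (c i).fst * (c j).fst) • (e - φ (star u * u))) (fun i j => ?_) ?_
  · have e1 : Tendsto (fun u => (star (c i).fst * (c j).fst) • e + (star (c i).fst • φ (u * (c j).snd)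
        + (c j).fst • φ (star (c i).snd * u) + φ (star (c i).snd * (c j).snd))) l
        (𝓝 ((star (c i).fst * (c j).fst) • e + (star (c i).fst • φ (c j).snd
          + (c j).fst • φ (star (c i).snd) + φ (star (c i).snd * (c j).snd)))) := by
      refine tendsto_const_nhds.add (((Tendsto.const_smul ?_ _).add (Tendsto.const_smul ?_ _)).add
        tendsto_const_nhds)
      · exact (h.continuous.tendsto _).comp (hl2 _).1
      · exact (h.continuous.tendsto _).comp (hl2 _).2
    have e2 : _root_.unitExt φ e (star (c i) * c j) = (star (c i).fst * (c j).fst) • e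
        + (star (c i).fst • φ (c j).snd
          + (c j).fst • φ (star (c i).snd) + φ (star (c i).snd * (c j).snd)) := by
      simp [unitExt_apply]
    simp only [e2]
    refine e1.congr' ?_
    filter_upwards [hl1] with u hu
    simp only [star_add, star_smul, hu.1, add_mul, mul_add, smul_mul_assoc, mul_smul_comm, map_add,
      map_smul]
    module
  · filter_upwards [hl1] with u hu
    refine (h.isCP n fun i => (c i).fst • u + (c i).snd).add ?_
    obtain ⟨w, hw⟩ := h.isCP.exists_apply_star_mul_self u
    obtain ⟨z, hz⟩ := exists_star_mul_self_eq_unit_sub he w (by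
      rw [← hw]
      refine (h.norm_le _).trans ?_
      rw [CStarRing.norm_star_mul_self]
      nlinarith [norm_nonneg u])
    rw [hw, hz]
    convert PosKernel.single fun i => (c i).fst • z using 3
    rw [star_smul, smul_mul_smul_comm]

/-- A completely positive map that preserves the units is contractive. -/
theorem IsCP.isCCP_of_map_one {φ : Unitization ℂ A →ₗ[ℂ] X} (h : IsCP φ)
    (he : ∀ x, φ 1 * x = x ∧ x * φ 1 = x) : IsCCP φ := by
  refine isCCP_iff.2 ⟨h, fun a => ?_⟩
  let _ := CStarAlgebra.spectralOrder X
  have _ := CStarAlgebra.spectralOrderedRing X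
  have h1 : ‖φ 1‖ ≤ 1 := by
    have h2 : star (φ 1) = φ 1 := by
      have h1 := (he (star (φ 1))).1
      have h2 := congrArg star h1
      rw [star_mul, star_star, h1] at h2
      exact h2
    have h3 := CStarRing.norm_star_mul_self (x := φ 1)
    rw [h2, (he _).1] at h3
    nlinarith [norm_nonneg (φ 1)]
  -- The Schwarz inequality: if `M` factors the kernel of the pair `(1, a)`, the difference of the
  -- two sides is the sum of the squares of `M k 1 - M k 0 * φ a`. Combined with `φ(a* a) ≤ ‖a‖²
  -- φ(1)` it gives contractivity.
  have hS : star (φ a) * φ a ≤ φ (star a * a) := by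
    obtain ⟨m, M, hM⟩ := h 2 ![1, a]
    have e11 : φ 1 = ∑ k, star (M k 0) * M k 0 := by simpa using hM 0 0
    have e12 : φ a = ∑ k, star (M k 0) * M k 1 := by simpa using hM 0 1
    have e22 : φ (star a * a) = ∑ k, star (M k 1) * M k 1 := by simpa using hM 1 1
    have e21 : star (φ a) = ∑ k, star (M k 1) * M k 0 := by rw [e12, star_sum]; simp
    rw [← sub_nonneg]
    have : φ (star a * a) - star (φ a) * φ a =
        ∑ k, star (M k 1 - M k 0 * φ a) * (M k 1 - M k 0 * φ a) := by
      have e : ∀ k, star (M k 1 - M k 0 * φ a) * (M k 1 - M k 0 * φ a) =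
          star (M k 1) * M k 1 - (star (M k 1) * M k 0) * φ a - star (φ a) * (star (M k 0) * M k 1)
            + star (φ a) * (star (M k 0) * M k 0) * φ a := fun k => by
        simp only [star_sub, star_mul]; noncomm_ring
      simp only [e, Finset.sum_add_distrib, Finset.sum_sub_distrib, ← Finset.sum_mul,
        ← Finset.mul_sum, ← e11, ← e12, ← e22, ← e21]
      rw [(he _).2]; abel
    rw [this]
    exact Finset.sum_nonneg fun k _ => star_mul_self_nonneg _
  have hT : φ (star a * a) ≤ (‖a‖ ^ 2 : ℝ) • φ 1 := by
    have h4 : star a * a ≤ algebraMap ℝ (Unitization ℂ A) (‖a‖ ^ 2) :=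
      CStarAlgebra.star_mul_le_algebraMap_norm_sq
    rw [← sub_nonneg, CStarAlgebra.nonneg_iff_eq_star_mul_self] at h4
    obtain ⟨d, hd⟩ := h4
    obtain ⟨w, hw⟩ := h.exists_apply_star_mul_self d
    rw [← hd, map_sub, Algebra.algebraMap_eq_smul_one] at hw
    rw [← sub_nonneg]
    have : φ ((‖a‖ ^ 2 : ℝ) • (1 : Unitization ℂ A)) = (‖a‖ ^ 2 : ℝ) • φ 1 :=
      φ.map_smul_of_tower _ _
    rw [this] at hw
    rw [hw]
    exact star_mul_self_nonneg _
  have h5 : ‖star (φ a) * φ a‖ ≤ ‖(‖a‖ ^ 2 : ℝ) • φ 1‖ :=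
    CStarAlgebra.norm_le_norm_of_nonneg_of_le (star_mul_self_nonneg _) (hS.trans hT)
  rw [CStarRing.norm_star_mul_self, norm_smul, Real.norm_of_nonneg (by positivity)] at h5
  have h6 : ‖φ a‖ ^ 2 ≤ ‖a‖ ^ 2 := by nlinarith [sq_nonneg ‖a‖]
  exact le_of_sq_le_sq h6 (norm_nonneg _) 

theorem IsCCP.unitExt {φ : A →ₗ[ℂ] X} (h : IsCCP φ) {e : X} (he : ∀ x, e * x = x ∧ x * e = x) :
    IsCCP (unitExt φ e) :=
  (IsCP.unitExt h he).isCCP_of_map_one (by rwa [unitExt_one])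

theorem NonUnitalStarAlgHom.isCCP (f : A →⋆ₙₐ[ℂ] X) : IsCCP (f : A →ₗ[ℂ] X) := by
  refine isCCP_iff.2 ⟨fun n c => ?_, fun a => NonUnitalStarAlgHom.norm_apply_le f a⟩
  simpa [map_star] using PosKernel.single fun i => f (c i)

theorem IsCCP.comp_hom {φ : A →ₗ[ℂ] X} (h : IsCCP φ) (f : Y →⋆ₙₐ[ℂ] A) :
    IsCCP (φ ∘ₗ (f : Y →ₗ[ℂ] A)) := by
  refine isCCP_iff.2 ⟨fun n c => ?_, fun a => ?_⟩
  · simpa [map_star] using h.isCP n fun i => f (c i)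
  · exact (h.norm_le _).trans (NonUnitalStarAlgHom.norm_apply_le f a)

theorem IsCCP.hom_comp {φ : A →ₗ[ℂ] X} (h : IsCCP φ) (f : X →⋆ₙₐ[ℂ] Y) :
    IsCCP ((f : X →ₗ[ℂ] Y) ∘ₗ φ) :=
  isCCP_iff.2 ⟨fun n c => (h.isCP n c).map f,
    fun a => (NonUnitalStarAlgHom.norm_apply_le f _).trans (h.norm_le a)⟩

theorem IsCCP.of_hom_comp {φ : A →ₗ[ℂ] X} {f : X →⋆ₙₐ[ℂ] Y} (hf : Function.Injective f)
    (h : IsCCP ((f : X →ₗ[ℂ] Y) ∘ₗ φ)) : IsCCP φ :=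
  isCCP_iff.2 ⟨fun n c => (h.isCP n c).of_map hf, fun a => by
    have := h.norm_le a
    have h2 : ‖f (φ a)‖ = ‖φ a‖ := NonUnitalStarAlgHom.norm_map f hf _
    rw [← h2]
    exact this⟩

theorem IsCCP.of_tendsto {ι : Type*} {l : Filter ι} [l.NeBot] {ψ : ι → A →ₗ[ℂ] X}
    {φ : A →ₗ[ℂ] X} (hψ : ∀ t, IsCCP (ψ t)) (h : ∀ a, Tendsto (fun t => ψ t a) l (𝓝 (φ a))) :
    IsCCP φ :=
  isCCP_iff.2 ⟨fun n c => PosKernel.of_tendsto (fun i j => h (star (c i) * c j))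
    (Eventually.of_forall fun t => (hψ t).isCP n c),
    fun a => le_of_tendsto (h a).norm (Eventually.of_forall fun t => (hψ t).norm_le a)⟩

end

noncomputable section

open Filter Topology

/-! ### Quasi-central approximate units -/

namespace ClosedIdeal

variable {B : Type*} [NonUnitalCStarAlgebra B] (I : ClosedIdeal B)

/-- A closed ideal, as a *-subalgebra. -/
def toStarSubalgebra : NonUnitalStarSubalgebra ℂ B where
  __ := I.toSubmodule
  mul_mem' {x _} _ hy := I.mul_mem_left x hy
  star_mem' hx := I.star_mem hx

/-- The positive contractions of an ideal. -/
def positiveContractions : Set B :=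
  {r | r ∈ I.toSubmodule ∧ (0 : Unitization ℂ B) ≤ r ∧ (r : Unitization ℂ B) ≤ 1}

theorem convex_positiveContractions : Convex ℝ I.positiveContractions := by
  rintro r ⟨hr, hr0, hr1⟩ s ⟨hs, hs0, hs1⟩ a b ha hb hab
  have e : ((a • r + b • s : B) : Unitization ℂ B) = a • (r : Unitization ℂ B) + b • s := by
    simp
  refine ⟨I.toSubmodule.add_mem ?_ ?_, ?_, ?_⟩
  · simpa using I.toSubmodule.smul_mem (a : ℂ) hr
  · simpa using I.toSubmodule.smul_mem (b : ℂ) hs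
  · rw [e]
    exact add_nonneg (smul_nonneg ha hr0) (smul_nonneg hb hs0)
  · rw [e]
    calc a • (r : Unitization ℂ B) + b • (s : Unitization ℂ B) ≤ a • (1 : Unitization ℂ B) + b • 1 :=
          add_le_add (smul_le_smul_of_nonneg_left hr1 ha) (smul_le_smul_of_nonneg_left hs1 hb)
      _ = 1 := by rw [← add_smul, hab, one_smul]

variable {I}

theorem star_eq_of_mem_positiveContractions {r : B} (h : r ∈ I.positiveContractions) :
    star r = r :=
  Unitization.inr_injective (R := ℂ) (by
    rw [Unitization.inr_star, (IsSelfAdjoint.of_nonneg h.2.1).star_eq])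

theorem norm_le_one_of_mem_positiveContractions {r : B} (h : r ∈ I.positiveContractions) :
    ‖r‖ ≤ 1 := by
  rw [← Unitization.norm_inr (𝕜 := ℂ)]
  exact (CStarAlgebra.norm_le_one_iff_of_nonneg _ h.2.1).2 h.2.2

theorem norm_sub_mul_le_of_mem_positiveContractions {r : B} (h : r ∈ I.positiveContractions)
    (y : B) : ‖y - r * y‖ ≤ ‖y‖ := by
  have h1 : ‖(1 : Unitization ℂ B) - r‖ ≤ 1 :=
    (CStarAlgebra.norm_le_one_iff_of_nonneg _ (sub_nonneg.2 h.2.2)).2 (sub_le_self _ h.2.1)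
  have : ((y - r * y : B) : Unitization ℂ B) = (1 - r) * y := by simp [sub_mul]
  rw [← Unitization.norm_inr (𝕜 := ℂ), this]
  refine (norm_mul_le _ _).trans ?_
  rw [Unitization.norm_inr]
  nlinarith [norm_nonneg y]

variable (I)

theorem exists_approxUnit_filter : ∃ l : Filter B, l.NeBot ∧ (∀ᶠ r in l, r ∈ I.positiveContractions) ∧
    ∀ x ∈ I.toSubmodule, Tendsto (· * x) l (𝓝 x) ∧ Tendsto (x * ·) l (𝓝 x) := by
  have hc : IsClosed (I.toStarSubalgebra : Set B) := I.isClosed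
  let _ : NonUnitalCStarAlgebra I.toStarSubalgebra := inferInstance
  let _ := CStarAlgebra.spectralOrder I.toStarSubalgebra
  have _ := CStarAlgebra.spectralOrderedRing I.toStarSubalgebra
  have h := CStarAlgebra.increasingApproximateUnit I.toStarSubalgebra
  refine ⟨(CStarAlgebra.approximateUnit I.toStarSubalgebra).map Subtype.val, inferInstance, ?_, ?_⟩
  · rw [eventually_map]
    filter_upwards [h.eventually_nonneg, h.eventually_norm] with r h0 h1
    have h2 : (0 : Unitization ℂ B) ≤ ((r : B) : Unitization ℂ B) := by
      obtain ⟨y, hy⟩ := CStarAlgebra.exists_eq_star_mul_self h0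
      have : (r : B) = star (y : B) * y := congrArg Subtype.val hy
      rw [this, Unitization.inr_mul, Unitization.inr_star]
      exact star_mul_self_nonneg _
    refine ⟨r.2, h2, (CStarAlgebra.norm_le_one_iff_of_nonneg _ h2).1 ?_⟩
    rw [Unitization.norm_inr]
    exact h1
  · intro x hx
    simp only [tendsto_map'_iff]
    exact ⟨(continuous_subtype_val.tendsto _).comp (h.tendsto_mul_right ⟨x, hx⟩),
      (continuous_subtype_val.tendsto _).comp (h.tendsto_mul_left ⟨x, hx⟩)⟩

/-- For a bounded functional `g`, the functionals `y ↦ g (y - r y)` on an ideal are uniformly small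
if `r` is far enough in the approximate unit. -/
theorem exists_forall_apply_sub_mul_le (g : B →L[ℝ] ℝ) {ε : ℝ} (hε : 0 < ε) :
    ∃ x ∈ I.toSubmodule, ∃ κ > 0, ∀ r ∈ I.positiveContractions, ‖x - r * x‖ ≤ κ →
      ∀ y ∈ I.toSubmodule, |g (y - r * y)| ≤ ε * ‖y‖ := by
  set g' : I.toSubmodule.restrictScalars ℝ →L[ℝ] ℝ :=
    g.comp (I.toSubmodule.restrictScalars ℝ).subtypeL with hg'
  set G := ‖g'‖ with hG
  have hG0 : 0 ≤ G := g'.opNorm_nonneg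
  -- The final estimate is `g d ≤ 3 G t + ε / 4`, and this choice makes `3 G t` at most `3 ε / 4`.
  set t : ℝ := ε / (4 * (G + 1)) with ht
  have ht0 : 0 < t := by positivity
  have htG : t * (4 * (G + 1)) = ε := by rw [ht]; field_simp
  have hgle : ∀ z ∈ I.toSubmodule, g z ≤ G * ‖z‖ := fun z hz =>
    (le_abs_self _).trans (g'.le_opNorm ⟨z, hz⟩)
  -- A vector that almost attains the norm of `g` on the ideal, with the sign chosen so that `g x`
  -- itself is nearly maximal.
  obtain ⟨x, hxI, hx1, hx⟩ : ∃ x ∈ I.toSubmodule, ‖x‖ ≤ 1 ∧ G - t * ε / 4 ≤ g x := by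
    obtain ⟨x, hx1, hx⟩ := g'.exists_lt_apply_of_lt_opNorm (r := G - t * ε / 4)
      (by have : 0 < t * ε := by positivity
          linarith)
    rcases le_total 0 (g' x) with h | h
    · exact ⟨x, x.2, hx1.le, by rw [Real.norm_of_nonneg h] at hx; exact hx.le⟩
    · refine ⟨-x, I.toSubmodule.neg_mem x.2, by rw [norm_neg]; exact hx1.le, ?_⟩
      rw [Real.norm_of_nonpos h] at hx
      rw [map_neg]; exact hx.le
  refine ⟨x, hxI, t, ht0, fun r hr hκ => ?_⟩
  have key : ∀ y ∈ I.toSubmodule, ‖y‖ ≤ 1 → g (y - r * y) ≤ ε := by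
    intro y hy hy1
    set d := y - r * y with hd
    have hd1 : ‖d‖ ≤ 1 := (norm_sub_mul_le_of_mem_positiveContractions hr y).trans hy1
    have hdI : d ∈ I.toSubmodule := I.toSubmodule.sub_mem hy (I.mul_mem_left _ hy)
    have hzI : x + t • d ∈ I.toSubmodule := by
      refine I.toSubmodule.add_mem hxI ?_
      simpa using I.toSubmodule.smul_mem (t : ℂ) hdI
    -- Since `r` is self-adjoint, `x* d` is small: `x` and `d` have almost orthogonal ranges. Thus
    -- adding `t d` to `x` raises the norm only to order `t²`, whereas `g` changes by `t g(d)`. As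
    -- `g x` is nearly maximal, `g d` must be small.
    have hxd : star x * d = star (x - r * x) * y := by
      rw [hd, star_sub, star_mul, star_eq_of_mem_positiveContractions hr]
      noncomm_ring
    have h1 : ‖star x * d‖ ≤ t := by
      rw [hxd]
      refine (norm_mul_le _ _).trans ?_
      rw [norm_star]
      nlinarith [norm_nonneg y, norm_nonneg (x - r * x)]
    have h1' : ‖star d * x‖ ≤ t := by rwa [← norm_star, star_mul, star_star]
    have h2 : ‖x + t • d‖ * ‖x + t • d‖ ≤ 1 + 2 * t * t + t * t := by
      rw [← CStarRing.norm_star_mul_self]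
      have e : star (x + t • d) * (x + t • d) =
          star x * x + t • (star x * d) + t • (star d * x) + (t * t) • (star d * d) := by
        rw [star_add, star_smul, star_trivial t]
        simp only [add_mul, mul_add, smul_mul_assoc, mul_smul_comm]
        module
      rw [e]
      refine (norm_add_le _ _).trans (add_le_add ((norm_add_le _ _).trans
        ((add_le_add ((norm_add_le _ _).trans (add_le_add (b := 1) (d := t * t) ?_ ?_))
          (b := 1 + t * t) (d := t * t) ?_).trans (by linarith))) ?_)
      · rw [CStarRing.norm_star_mul_self]; nlinarith [norm_nonneg x]
      · rw [norm_smul, Real.norm_of_nonneg ht0.le]; gcongr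
      · rw [norm_smul, Real.norm_of_nonneg ht0.le]; gcongr
      · rw [norm_smul, Real.norm_of_nonneg (by positivity), CStarRing.norm_star_mul_self]
        have : ‖d‖ * ‖d‖ ≤ 1 := by nlinarith [norm_nonneg d]
        nlinarith [mul_pos ht0 ht0]
    have h3 : ‖x + t • d‖ ≤ 1 + 3 * t * t := by
      by_contra h
      push Not at h
      nlinarith [norm_nonneg (x + t • d), mul_pos ht0 ht0]
    have h4 := hgle _ hzI
    rw [map_add, map_smul, smul_eq_mul] at h4
    have h5 : G * ‖x + t • d‖ ≤ G * (1 + 3 * t * t) := by gcongr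
    have h6 : t * g d ≤ t * (G * (3 * t) + ε / 4) := by nlinarith
    have h7 := le_of_mul_le_mul_left h6 ht0
    nlinarith
  intro y hy
  rcases eq_or_ne y 0 with rfl | hy0
  · simp
  have hn : 0 < ‖y‖ := norm_pos_iff.2 hy0
  have hsm : ∀ c : ℝ, c • y ∈ I.toSubmodule := fun c => by
    simpa using I.toSubmodule.smul_mem (c : ℂ) hy
  have k1 := key (‖y‖⁻¹ • y) (hsm _) (by rw [norm_smul, norm_inv, norm_norm, inv_mul_cancel₀ hn.ne'])
  have k2 := key ((-‖y‖⁻¹) • y) (hsm _) (by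
    rw [norm_smul, norm_neg, norm_inv, norm_norm, inv_mul_cancel₀ hn.ne'])
  rw [mul_smul_comm, ← smul_sub, map_smul, smul_eq_mul] at k1 k2
  rw [inv_mul_le_iff₀ hn] at k1
  rw [neg_mul, ← mul_neg, inv_mul_le_iff₀ hn] at k2
  rw [abs_le]
  constructor <;> nlinarith

/-- Commutators with an approximate unit of an ideal tend weakly to zero. -/
theorem tendsto_apply_commutator {l : Filter B} (hl : ∀ᶠ r in l, r ∈ I.positiveContractions)
    (hl' : ∀ x ∈ I.toSubmodule, Tendsto (· * x) l (𝓝 x)) (g : B →L[ℝ] ℝ) (b : B) :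
    Tendsto (fun r => g (r * b - b * r)) l (𝓝 0) := by
  rw [Metric.tendsto_nhds]
  intro ε hε
  set δ := ε / (4 * (‖b‖ + 1)) with hδ
  have hb := norm_nonneg b
  have hδ0 : 0 < δ := by positivity
  have hδε : δ * (4 * (‖b‖ + 1)) = ε := by rw [hδ]; field_simp
  -- Composing `g` with the involution turns the error `y - y r` of right multiplication into one of
  -- left multiplication.
  let st : B →L[ℝ] B := (starL' ℝ (A := B) : B →L[ℝ] B)
  obtain ⟨x, hx, κ, hκ, h⟩ := I.exists_forall_apply_sub_mul_le g hδ0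
  obtain ⟨x', hx', κ', hκ', h'⟩ := I.exists_forall_apply_sub_mul_le (g.comp st) hδ0
  have ev : ∀ x ∈ I.toSubmodule, ∀ κ > 0, ∀ᶠ r in l, ‖x - r * x‖ ≤ κ := fun x hx κ hκ => by
    have := Metric.tendsto_nhds.1 (hl' x hx) κ hκ
    filter_upwards [this] with r hr
    rw [dist_comm, dist_eq_norm] at hr
    exact hr.le
  filter_upwards [hl, ev x hx κ hκ, ev x' hx' κ' hκ'] with r hr h1 h2
  have hrs := star_eq_of_mem_positiveContractions hr
  have hr1 := norm_le_one_of_mem_positiveContractions hr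
  have a1 := h r hr h1 (b * r) (I.mul_mem_left _ hr.1)
  have a2 := h' r hr h2 (star (r * b)) (I.star_mem (I.mul_mem_right _ hr.1))
  have e2 : (g.comp st) (star (r * b) - r * star (r * b)) = g (r * b - r * b * r) := by
    change g (star (star (r * b) - r * star (r * b))) = _
    simp only [star_sub, star_mul, star_star, hrs]
  rw [e2, norm_star] at a2
  have n1 : ‖b * r‖ ≤ ‖b‖ := (norm_mul_le _ _).trans (by nlinarith)
  have n2 : ‖r * b‖ ≤ ‖b‖ := (norm_mul_le _ _).trans (by nlinarith)
  -- Inserting `r b r` splits the commutator into errors of the approximate unit at `r b` and at `b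
  -- r`, which lie in the ideal and have norm at most `‖b‖`.
  have e : g (r * b - b * r) = g (r * b - r * b * r) - g (b * r - r * (b * r)) := by
    rw [← map_sub]; congr 1; noncomm_ring
  rw [Real.dist_eq, sub_zero, e]
  refine (abs_sub _ _).trans_lt ?_
  nlinarith

/-- Existence of quasi-central approximate units. -/
theorem exists_quasicentral {ι κ : Type*} [Finite ι] [Finite κ] (S : ι → B) (T : κ → B)
    (hT : ∀ j, T j ∈ I.toSubmodule) {ε : ℝ} (hε : 0 < ε) : ∃ r ∈ I.positiveContractions,
      (∀ i, ‖r * S i - S i * r‖ ≤ ε) ∧ ∀ j, ‖T j - r * T j‖ ≤ ε := by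
  classical
  have _ := Fintype.ofFinite ι
  have _ := Fintype.ofFinite κ
  obtain ⟨l, hl, hl1, hl2⟩ := I.exists_approxUnit_filter
  let Γ : B → (ι → B) × (κ → B) := fun r => (fun i => r * S i - S i * r, fun j => T j - r * T j)
  have hconv : Convex ℝ (Γ '' I.positiveContractions) := by
    rintro _ ⟨r, hr, rfl⟩ _ ⟨s, hs, rfl⟩ a b ha hb hab
    refine ⟨a • r + b • s, I.convex_positiveContractions hr hs ha hb hab, ?_⟩
    refine Prod.ext (funext fun i => ?_) (funext fun j => ?_)
    · change (a • r + b • s) * S i - S i * (a • r + b • s) =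
        a • (r * S i - S i * r) + b • (s * S i - S i * s)
      simp only [add_mul, mul_add, smul_mul_assoc, mul_smul_comm, smul_sub]
      abel
    · change T j - (a • r + b • s) * T j = a • (T j - r * T j) + b • (T j - s * T j)
      nth_rewrite 1 [← one_smul ℝ (T j)]
      rw [← hab]
      simp only [add_mul, smul_mul_assoc, smul_sub, add_smul]
      abel
  -- Mazur's argument: a functional separating `0` from the closed convex hull of the errors would
  -- exceed a positive constant on all of them, but its values tend to `0` along the approximate
  -- unit. Convexity thus upgrades weak to norm convergence, for all finitely many conditions at
  -- once.
  have h0 : (0 : (ι → B) × (κ → B)) ∈ closure (Γ '' I.positiveContractions) := by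
    by_contra h0
    obtain ⟨f, u, hu0, hu⟩ := geometric_hahn_banach_point_closed hconv.closure isClosed_closure h0
    rw [map_zero] at hu0
    have hdec : ∀ r, f (Γ r) =
        ∑ i, f (ContinuousLinearMap.inl ℝ _ _ (ContinuousLinearMap.single ℝ (fun _ : ι => B) i
          (r * S i - S i * r))) +
        ∑ j, f (ContinuousLinearMap.inr ℝ _ _ (ContinuousLinearMap.single ℝ (fun _ : κ => B) j
          (T j - r * T j))) := by
      intro r
      rw [← map_sum, ← map_sum, ← map_sum, ← map_sum, ← map_add]
      congr 1
      refine Prod.ext ?_ ?_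
      · simpa [Prod.fst_sum, Prod.snd_sum] using (Finset.univ_sum_single (fun i => r * S i - S i * r)).symm
      · simpa [Prod.fst_sum, Prod.snd_sum] using (Finset.univ_sum_single (fun j => T j - r * T j)).symm
    have hlim : Tendsto (fun r => f (Γ r)) l (𝓝 (∑ i : ι, 0 + ∑ j : κ, 0)) := by
      simp only [hdec]
      refine (tendsto_finsetSum _ fun i _ => ?_).add (tendsto_finsetSum _ fun j _ => ?_)
      · exact I.tendsto_apply_commutator hl1 (fun x hx => (hl2 x hx).1)
          (f.comp ((ContinuousLinearMap.inl ℝ (ι → B) (κ → B)).comp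
            (ContinuousLinearMap.single ℝ (fun _ : ι => B) i))) (S i)
      · have h1 : Tendsto (fun r => T j - r * T j) l (𝓝 (T j - T j)) :=
          tendsto_const_nhds.sub (hl2 _ (hT j)).1
        rw [sub_self] at h1
        have h2 := ((f.comp ((ContinuousLinearMap.inr ℝ (ι → B) (κ → B)).comp
            (ContinuousLinearMap.single ℝ (fun _ : κ => B) j))).continuous.tendsto 0).comp h1
        rw [map_zero] at h2
        exact h2
    simp only [Finset.sum_const_zero, add_zero] at hlim
    have : u ≤ 0 := ge_of_tendsto hlim (hl1.mono fun r hr =>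
      (hu _ (subset_closure ⟨r, hr, rfl⟩)).le)
    linarith
  obtain ⟨_, ⟨r, hr, rfl⟩, hd⟩ := Metric.mem_closure_iff.1 h0 ε hε
  rw [dist_zero_left] at hd
  refine ⟨r, hr, fun i => ?_, fun j => ?_⟩
  · exact (norm_le_pi_norm (Γ r).1 i).trans ((norm_fst_le (Γ r)).trans hd.le)
  · exact (norm_le_pi_norm (Γ r).2 j).trans ((norm_snd_le (Γ r)).trans hd.le)

end ClosedIdeal

end

noncomputable section

open Filter Topology

/-! ### Gluing modulo an ideal -/

theorem norm_le_one_of_mul_self_add_mul_self {U : Type*} [CStarAlgebra U] {k l : U}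
    (hk : star k = k) (hl : star l = l) (h : k * k + l * l = 1) : ‖l‖ ≤ 1 := by
  let _ := CStarAlgebra.spectralOrder U
  have _ := CStarAlgebra.spectralOrderedRing U
  have h0 : 0 ≤ l * l := by simpa [hl] using star_mul_self_nonneg l
  have h1 : l * l ≤ 1 := by
    rw [← h]; exact le_add_of_nonneg_left (by simpa [hk] using star_mul_self_nonneg k)
  have h2 := (CStarAlgebra.norm_le_one_iff_of_nonneg _ h0).2 h1
  have h3 := CStarRing.norm_star_mul_self (x := l)
  rw [hl] at h3
  nlinarith [norm_nonneg l]

/-- With `z = k x k + l y l`, the element `k x* x k + l y* y l - z* z` equals `d* d` for `d = l x k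
- k y l`. The first two terms are bounded by `c² (k² + l²) = c²`. -/
theorem norm_conj_add_conj_le {U : Type*} [CStarAlgebra U] {k l : U} (hk : star k = k)
    (hl : star l = l) (hkl : k * l = l * k) (h : k * k + l * l = 1) {x y : U} {c : ℝ}
    (hx : ‖x‖ ≤ c) (hy : ‖y‖ ≤ c) : ‖k * x * k + l * y * l‖ ≤ c := by
  let _ := CStarAlgebra.spectralOrder U
  have _ := CStarAlgebra.spectralOrderedRing U
  have hc : 0 ≤ c := (norm_nonneg x).trans hx
  set z := k * x * k + l * y * l with hz
  have hb : ∀ x : U, ‖x‖ ≤ c → star x * x ≤ algebraMap ℝ U (c ^ 2) := fun x hx =>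
    CStarAlgebra.star_mul_le_algebraMap_norm_sq.trans
      (algebraMap_mono U (pow_le_pow_left₀ (norm_nonneg x) hx 2))
  have h1 : star z * z ≤ k * (star x * x) * k + l * (star y * y) * l := by
    rw [← sub_nonneg]
    have e1 : star (l * x * k - k * y * l) * (l * x * k - k * y * l) =
        k * star x * (l * l) * x * k - k * star x * (l * k) * y * l - l * star y * (k * l) * x * k
          + l * star y * (k * k) * y * l := by
      simp only [star_sub, star_mul, hk, hl]; noncomm_ring
    have e2 : star z * z = k * star x * (k * k) * x * k + k * star x * (k * l) * y * l
        + l * star y * (l * k) * x * k + l * star y * (l * l) * y * l := by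
      simp only [hz, star_add, star_mul, hk, hl]; noncomm_ring
    have e3 : k * k = 1 - l * l := by rw [← h]; abel
    have : k * (star x * x) * k + l * (star y * y) * l - star z * z =
        star (l * x * k - k * y * l) * (l * x * k - k * y * l) := by
      rw [e1, e2, hkl, e3]; noncomm_ring
    rw [this]
    exact star_mul_self_nonneg _
  have h2 : k * (star x * x) * k + l * (star y * y) * l ≤ algebraMap ℝ U (c ^ 2) := by
    have a1 := star_left_conjugate_le_conjugate (hb x hx) k
    have a2 := star_left_conjugate_le_conjugate (hb y hy) l
    rw [hk] at a1
    rw [hl] at a2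
    refine (add_le_add a1 a2).trans (le_of_eq ?_)
    rw [← Algebra.commutes, ← Algebra.commutes, mul_assoc, mul_assoc, ← mul_add, h, mul_one]
  have h3 := (CStarAlgebra.norm_le_iff_le_algebraMap _ (by positivity)
    (star_mul_self_nonneg z)).2 (h1.trans h2)
  rw [CStarRing.norm_star_mul_self] at h3
  exact le_of_sq_le_sq (by nlinarith) hc 

namespace ClosedIdeal

variable {B : Type*} [NonUnitalCStarAlgebra B] (I : ClosedIdeal B)

/-- A pair of commuting self-adjoint elements `k ∈ I` and `l ∈ 1 + I` such that `k² + l² = 1`. -/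
structure GluingPair where
  k : B
  l : B
  k_mem : k ∈ I.toSubmodule
  l_mem : l ∈ I.toSubmodule
  star_k : star k = k
  star_l : star (1 + (l : Unitization ℂ B)) = 1 + l
  comm : (k : Unitization ℂ B) * (1 + l) = (1 + l) * k
  sum_sq : (k : Unitization ℂ B) * k + (1 + l) * (1 + l) = 1

namespace GluingPair

variable {I} (P : I.GluingPair)

/-- The map `(x, y) ↦ k x k + l y l`. -/
def glue (x y : B) : B := P.k * x * P.k + (y + P.l * y + y * P.l + P.l * y * P.l)

theorem inr_glue (x y : B) : (P.glue x y : Unitization ℂ B) =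
    P.k * x * P.k + (1 + (P.l : Unitization ℂ B)) * y * (1 + P.l) := by
  simp only [glue, Unitization.inr_add, Unitization.inr_mul]
  noncomm_ring

theorem norm_glue_le {x y : B} {c : ℝ} (hx : ‖x‖ ≤ c) (hy : ‖y‖ ≤ c) : ‖P.glue x y‖ ≤ c := by
  rw [← Unitization.norm_inr (𝕜 := ℂ), inr_glue]
  refine norm_conj_add_conj_le ?_ P.star_l P.comm P.sum_sq ?_ ?_
  · rw [← Unitization.inr_star, P.star_k]
  · rwa [Unitization.norm_inr]
  · rwa [Unitization.norm_inr]

theorem mkHom_glue (x y : B) : I.mkHom (P.glue x y) = I.mkHom y := by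
  rw [mkHom_eq_iff, glue]
  have : P.k * x * P.k + (y + P.l * y + y * P.l + P.l * y * P.l) - y =
    P.k * x * P.k + (P.l * y + y * P.l + P.l * y * P.l) := by abel
  rw [this]
  exact add_mem (I.mul_mem_left _ P.k_mem) (add_mem (add_mem (I.mul_mem_right _ P.l_mem)
    (I.mul_mem_left _ P.l_mem)) (I.mul_mem_left _ P.l_mem))

/-- Gluing of linear maps. -/
def glueMap {A : Type*} [NonUnitalCStarAlgebra A] (φ ψ : A →ₗ[ℂ] B) : A →ₗ[ℂ] B where
  toFun a := P.glue (φ a) (ψ a)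
  map_add' a b := by simp only [glue, map_add, mul_add, add_mul]; abel
  map_smul' c a := by
    simp only [glue, map_smul, mul_smul_comm, smul_mul_assoc, RingHom.id_apply, smul_add]

theorem glueMap_apply {A : Type*} [NonUnitalCStarAlgebra A] (φ ψ : A →ₗ[ℂ] B) (a : A) :
    P.glueMap φ ψ a = P.glue (φ a) (ψ a) := rfl

theorem isCCP_glueMap {A : Type*} [NonUnitalCStarAlgebra A] {φ ψ : A →ₗ[ℂ] B} (hφ : IsCCP φ)
    (hψ : IsCCP ψ) : IsCCP (P.glueMap φ ψ) := by
  refine isCCP_iff.2 ⟨fun n c => ?_, fun a => P.norm_glue_le (hφ.norm_le a) (hψ.norm_le a)⟩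
  refine PosKernel.of_map (φ := Unitization.inrNonUnitalStarAlgHom ℂ B)
    Unitization.inr_injective ?_
  have h1 := ((hφ.isCP n c).map (Unitization.inrNonUnitalStarAlgHom ℂ B)).conj
    (P.k : Unitization ℂ B)
  have h2 := ((hψ.isCP n c).map (Unitization.inrNonUnitalStarAlgHom ℂ B)).conj
    (1 + (P.l : Unitization ℂ B))
  rw [← Unitization.inr_star, P.star_k] at h1
  rw [P.star_l] at h2
  convert h1.add h2 using 3
  exact P.inr_glue _ _

/-- With `L = 1 + l`, writing `x = (k² + L²) x` exhibits the error as two commutators with `x` and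
the term `L (y - x) L`, which is controlled by the class of `y - x` in the quotient. -/
theorem glue_sub_eq (x y : B) :
    ((P.glue x y - x : B) : Unitization ℂ B) =
      P.k * (x * P.k - P.k * x) + (1 + (P.l : Unitization ℂ B)) * (x * (1 + (P.l : Unitization ℂ B))
        - (1 + (P.l : Unitization ℂ B)) * x) + (1 + (P.l : Unitization ℂ B)) * (y - x : B) * (1 + P.l)
      := by
  calc ((P.glue x y - x : B) : Unitization ℂ B) =
      P.k * x * P.k + (1 + (P.l : Unitization ℂ B)) * y * (1 + P.l) -
        ((P.k : Unitization ℂ B) * P.k + (1 + (P.l : Unitization ℂ B)) * (1 + P.l)) * x := by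
        rw [P.sum_sq, one_mul, Unitization.inr_sub, inr_glue]
    _ = _ := by rw [Unitization.inr_sub]; noncomm_ring

end GluingPair

/-- Quasi-central gluing pairs. -/
theorem exists_gluingPair {ι : Type*} [Finite ι] (S : ι → B) {ε : ℝ} (hε : 0 < ε) :
    ∃ P : I.GluingPair, ∀ i,
      ‖(S i : Unitization ℂ B) * P.k - P.k * S i‖ ≤ ε ∧
      ‖(S i : Unitization ℂ B) * (1 + (P.l : Unitization ℂ B)) - (1 + (P.l : Unitization ℂ B)) * S i‖
        ≤ ε ∧
      ‖(1 + (P.l : Unitization ℂ B)) * S i * (1 + P.l)‖ ≤ ‖I.mkHom (S i)‖ + ε := by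
  -- Commutators with `r`, `w`, `1 + l` and `k` will be bounded by `δ`, `2δ`, `4δ` and `6δ` in turn.
  set δ := ε / 6 with hδ
  have hδ0 : 0 < δ := by positivity
  -- Lifts of almost minimal norm: `S i` differs from `S' i` by an element of the ideal, which `r`
  -- is made to fix almost exactly.
  choose S' hS' hS'n using fun i => I.exists_norm_lt (I.mkHom (S i)) hδ0
  have hT : ∀ i, S i - S' i ∈ I.toSubmodule := fun i => I.mkₗ_eq_iff.1 (hS' i).symm
  obtain ⟨r, hr, hr1, hr2⟩ := I.exists_quasicentral S (fun i => S i - S' i) hT hδ0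
  set R : Unitization ℂ B := (r : Unitization ℂ B) with hR
  have hRsa : star R = R := by
    rw [hR, ← Unitization.inr_star, star_eq_of_mem_positiveContractions hr]
  have hRn : ‖R‖ ≤ 1 := by
    rw [hR, Unitization.norm_inr]; exact norm_le_one_of_mem_positiveContractions hr
  have hsa : IsSelfAdjoint R := hRsa
  -- The rational parametrization of the circle: `w = (1 + r²)⁻¹`, `k = 2 r w` and `1 + l = 2 w - 1
  -- = (1 - r²) w`. Avoiding square roots reduces all commutator estimates to that of `r` by
  -- algebra.
  set f : ℝ → ℝ := fun t => (1 + t * t)⁻¹ with hf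
  have hpos : ∀ t : ℝ, 0 < 1 + t * t := fun t => by nlinarith [mul_self_nonneg t]
  have hfc : Continuous f := by
    refine Continuous.inv₀ (by fun_prop) fun t => (hpos t).ne'
  set w : Unitization ℂ B := cfc f R with hw
  have hwsa : star w = w := (cfc_predicate f R : IsSelfAdjoint _)
  have hwn : ‖w‖ ≤ 1 := by
    refine norm_cfc_le zero_le_one fun t _ => ?_
    rw [hf, Real.norm_of_nonneg (inv_nonneg.2 (hpos t).le)]
    exact inv_le_one_of_one_le₀ (by nlinarith [mul_self_nonneg t])
  have hRw : R * w = w * R := (cfc_commute_cfc (fun t => t) f R).eq |> fun h => by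
    rwa [cfc_id' ℝ R] at h
  have hw1 : (1 + R * R) * w = 1 := by
    have e : (1 + R * R) = cfc (fun t : ℝ => 1 + t * t) R := by
      rw [cfc_add R (fun _ : ℝ => (1 : ℝ)) (fun t => t * t), cfc_const_one ℝ R,
        cfc_mul (fun t : ℝ => t) (fun t => t) R, cfc_id' ℝ R]
    rw [e, hw, ← cfc_mul (fun t : ℝ => 1 + t * t) f R, ← cfc_const_one ℝ R]
    exact cfc_congr fun t _ => mul_inv_cancel₀ (hpos t).ne'
  have hw2 : w * (1 + R * R) = 1 := by
    refine Eq.trans ?_ hw1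
    simp only [mul_add, add_mul, mul_one, one_mul]
    rw [← mul_assoc, ← hRw, mul_assoc, ← hRw, mul_assoc]
  set k : B := (2 : ℂ) • (R * w).snd with hk
  set l : B := -((2 : ℂ) • (R * (R * w)).snd) with hl
  have hinr : ∀ z : Unitization ℂ B, ((R * z).snd : Unitization ℂ B) = R * z := fun z => by
    refine Unitization.ext ?_ ?_
    · simp [hR]
    · simp
  have hmem : ∀ z : Unitization ℂ B, (R * z).snd ∈ I.toSubmodule := fun z => by
    have : (R * z).snd = z.fst • r + r * z.snd := by simp [hR]
    rw [this]
    exact add_mem (I.toSubmodule.smul_mem _ hr.1) (I.mul_mem_right _ hr.1)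
  have hkU : (k : Unitization ℂ B) = R * w + R * w := by
    rw [hk, Unitization.inr_smul, hinr, two_smul]
  have hlU : (1 + (l : Unitization ℂ B)) = w + w - 1 := by
    rw [hl, Unitization.inr_neg, Unitization.inr_smul, hinr, two_smul]
    have : R * (R * w) = 1 - w := by rw [← hw1]; noncomm_ring
    rw [this]; noncomm_ring
  have hk0 : star (k : Unitization ℂ B) = k := by
    rw [hkU, star_add, star_mul, hwsa, hRsa, hRw]
  have hl0 : star (1 + (l : Unitization ℂ B)) = 1 + l := by
    rw [hlU, star_sub, star_add, hwsa, star_one]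
  have hcomm : (k : Unitization ℂ B) * (1 + l) = (1 + l) * k := by
    rw [hkU, hlU]
    simp only [mul_sub, sub_mul, mul_add, add_mul, mul_one, one_mul]
    rw [mul_assoc R w w, ← mul_assoc w R w, ← hRw, mul_assoc]
    abel
  have hsq : (k : Unitization ℂ B) * k + (1 + l) * (1 + l) = 1 := by
    rw [hkU, hlU]
    have e1 : R * w * (R * w) = w - w * w := by
      have : R * w * (R * w) = (R * R) * w * w := by
        rw [hRw, mul_assoc w R, ← mul_assoc R w R, hRw]
        have h3 : w * (R * R) = R * R * w := by rw [← mul_assoc, ← hRw, mul_assoc, ← hRw, mul_assoc]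
        calc w * (w * R * R) = w * (w * (R * R)) := by rw [mul_assoc w R R]
          _ = _ := by rw [h3, ← mul_assoc, h3]
      rw [this]
      have h4 : R * R * w = 1 - w := by rw [← hw1]; noncomm_ring
      rw [h4]; noncomm_ring
    have e2 : (R * w + R * w) * (R * w + R * w) = 4 • (R * w * (R * w)) := by noncomm_ring
    rw [e2, e1]; noncomm_ring
  refine ⟨⟨k, l, I.toSubmodule.smul_mem _ (hmem _), I.toSubmodule.neg_mem
    (I.toSubmodule.smul_mem _ (hmem _)), Unitization.inr_injective (R := ℂ)
      (by rw [Unitization.inr_star, hk0]), hl0, hcomm, hsq⟩, fun i => ?_⟩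
  set b : Unitization ℂ B := (S i : Unitization ℂ B) with hb
  have hRb : ‖R * b - b * R‖ ≤ δ := by
    rw [hR, hb, ← Unitization.inr_mul, ← Unitization.inr_mul, ← Unitization.inr_sub,
      Unitization.norm_inr]
    exact hr1 i
  have hbound : ∀ {x y : Unitization ℂ B} {a c : ℝ}, ‖x‖ ≤ a → ‖y‖ ≤ c → ‖x * y‖ ≤ a * c :=
    fun hx hy => (norm_mul_le _ _).trans (mul_le_mul hx hy (norm_nonneg _) ((norm_nonneg _).trans hx))
  have hwb : ‖b * w - w * b‖ ≤ 2 * δ := by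
    -- The commutator with an inverse is the commutator with `1 + r²` multiplied by `w` on both
    -- sides.
    have e : b * w - w * b = w * (R * (R * b - b * R) + (R * b - b * R) * R) * w := by
      have : R * (R * b - b * R) + (R * b - b * R) * R =
        (1 + R * R) * b - b * (1 + R * R) := by noncomm_ring
      rw [this, mul_sub, sub_mul, ← mul_assoc, hw2, one_mul, ← mul_assoc, mul_assoc (w * b), hw1,
        mul_one]
    rw [e]
    have h1 : ‖R * (R * b - b * R) + (R * b - b * R) * R‖ ≤ 2 * δ :=
      (norm_add_le _ _).trans ((add_le_add (hbound hRn hRb) (hbound hRb hRn)).trans (by linarith))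
    exact (hbound (hbound hwn h1) hwn).trans (by linarith)
  have hlb : ‖b * (1 + (l : Unitization ℂ B)) - (1 + (l : Unitization ℂ B)) * b‖ ≤ 4 * δ := by
    have e : b * (1 + (l : Unitization ℂ B)) - (1 + (l : Unitization ℂ B)) * b =
      (b * w - w * b) + (b * w - w * b) := by rw [hlU]; noncomm_ring
    rw [e]
    exact (norm_add_le _ _).trans (by linarith)
  have hkb : ‖b * k - k * b‖ ≤ 6 * δ := by
    have e : b * k - k * b = (R * (b * w - w * b) - (R * b - b * R) * w) +
      (R * (b * w - w * b) - (R * b - b * R) * w) := by rw [hkU]; noncomm_ring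
    have h1 : ‖R * (b * w - w * b) - (R * b - b * R) * w‖ ≤ 3 * δ :=
      (norm_sub_le _ _).trans ((add_le_add (hbound hRn hwb) (hbound hRb hwn)).trans (by linarith))
    rw [e]
    exact (norm_add_le _ _).trans (by linarith)
  have hln := norm_le_one_of_mul_self_add_mul_self hk0 hl0 hsq
  refine ⟨by linarith, by linarith, ?_⟩
  have e : b = (S' i : Unitization ℂ B) + ((S i - S' i : B) : Unitization ℂ B) := by
    rw [← Unitization.inr_add]; simp [hb]
  have h1 : ‖(1 + (l : Unitization ℂ B)) * (S' i : Unitization ℂ B) * (1 + l)‖ ≤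
      ‖I.mkHom (S i)‖ + δ := by
    refine (hbound (hbound hln (le_of_eq (Unitization.norm_inr (𝕜 := ℂ) _))) hln).trans ?_
    linarith [hS'n i]
  have h2 : ‖(1 + (l : Unitization ℂ B)) * ((S i - S' i : B) : Unitization ℂ B)‖ ≤ 2 * δ := by
    -- The factor `1 - r` almost annihilates `S i - S' i`, so only the short lift `S' i` matters.
    have e1 : (1 + (l : Unitization ℂ B)) = w * (1 + R) * (1 - R) := by
      have : w + w - 1 = w + w - w * (1 + R * R) := by rw [hw2]
      rw [hlU, this]
      noncomm_ring
    rw [e1, mul_assoc]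
    have h3 : ‖(1 - R) * ((S i - S' i : B) : Unitization ℂ B)‖ ≤ δ := by
      rw [sub_mul, one_mul, hR, ← Unitization.inr_mul, ← Unitization.inr_sub, Unitization.norm_inr]
      exact hr2 i
    have h4 : ‖(1 : Unitization ℂ B) + R‖ ≤ 2 := by
      refine (norm_add_le _ _).trans ?_
      rw [CStarRing.norm_one]; linarith
    exact (hbound (hbound hwn h4) h3).trans (by linarith)
  have h3 := hbound h2 hln
  change ‖(1 + (l : Unitization ℂ B)) * b * (1 + l)‖ ≤ _
  rw [e, mul_add (1 + (l : Unitization ℂ B)), add_mul _ _ (1 + (l : Unitization ℂ B))]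
  refine (norm_add_le _ _).trans ?_
  linarith

theorem GluingPair.norm_k_le {I : ClosedIdeal B} (P : I.GluingPair) :
    ‖(P.k : Unitization ℂ B)‖ ≤ 1 :=
  norm_le_one_of_mul_self_add_mul_self P.star_l (by rw [← Unitization.inr_star, P.star_k])
    (by rw [add_comm, P.sum_sq])

theorem GluingPair.norm_l_le {I : ClosedIdeal B} (P : I.GluingPair) :
    ‖1 + (P.l : Unitization ℂ B)‖ ≤ 1 :=
  norm_le_one_of_mul_self_add_mul_self (by rw [← Unitization.inr_star, P.star_k]) P.star_l P.sum_sq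

theorem GluingPair.norm_conj_add_le {I : ClosedIdeal B} (P : I.GluingPair)
    {a b c d : Unitization ℂ B} : ‖(P.k : Unitization ℂ B) * a * b +
      (1 + (P.l : Unitization ℂ B)) * c * d‖ ≤ ‖a‖ * ‖b‖ + ‖c‖ * ‖d‖ := by
  have h : ∀ k a b : Unitization ℂ B, ‖k‖ ≤ 1 → ‖k * a * b‖ ≤ ‖a‖ * ‖b‖ := fun k a b hk => by
    rw [mul_assoc]
    refine (norm_mul_le _ _).trans ((mul_le_of_le_one_left (norm_nonneg _) hk).trans
      (norm_mul_le _ _))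
  exact (norm_add_le _ _).trans (add_le_add (h _ _ _ P.norm_k_le) (h _ _ _ P.norm_l_le))

theorem GluingPair.norm_glue_sub_le {I : ClosedIdeal B} (P : I.GluingPair) {x y : B} {ε c : ℝ}
    (h1 : ‖(x : Unitization ℂ B) * P.k - P.k * x‖ ≤ ε)
    (h2 : ‖(x : Unitization ℂ B) * (1 + (P.l : Unitization ℂ B)) -
      (1 + (P.l : Unitization ℂ B)) * x‖ ≤ ε)
    (h3 : ‖(1 + (P.l : Unitization ℂ B)) * (y - x : B) * (1 + P.l)‖ ≤ c) :
    ‖P.glue x y - x‖ ≤ c + 2 * ε := by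
  rw [← Unitization.norm_inr (𝕜 := ℂ), P.glue_sub_eq]
  have h : ∀ k a : Unitization ℂ B, ‖k‖ ≤ 1 → ‖k * a‖ ≤ ‖a‖ := fun k a hk =>
    (norm_mul_le _ _).trans (mul_le_of_le_one_left (norm_nonneg _) hk)
  have h4 := h _ _ P.norm_k_le |>.trans h1
  have h5 := h _ _ P.norm_l_le |>.trans h2
  refine (norm_add_le _ _).trans ((add_le_add ((norm_add_le _ _).trans (add_le_add h4 h5)) h3).trans
    (by linarith))

/-- `glue x y` is close to `x` if `x` and `y` are close modulo the ideal. -/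
theorem exists_norm_glue_sub_le {ι : Type*} [Finite ι] (x y : ι → B) {ε : ℝ} (hε : 0 < ε) :
    ∃ P : I.GluingPair, ∀ i, ‖P.glue (x i) (y i) - x i‖ ≤ ‖I.mkHom (y i - x i)‖ + ε := by
  obtain ⟨P, hP⟩ := I.exists_gluingPair (Sum.elim x fun i => y i - x i) (ε := ε / 3) (by positivity)
  refine ⟨P, fun i => ?_⟩
  have h1 := hP (Sum.inl i)
  have h2 := hP (Sum.inr i)
  refine (P.norm_glue_sub_le h1.1 h1.2.1 h2.2.2).trans ?_
  simp only [Sum.elim_inr]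
  linarith

/-- `glue x y` is strictly close to `x` if `x` and `y` are strictly close modulo the ideal. -/
theorem exists_norm_glue_sub_mul_le {ι : Type*} [Finite ι] (x y : B) (h : ι → B) {ε : ℝ}
    (hε : 0 < ε) : ∃ P : I.GluingPair, ∀ i,
      ‖(P.glue x y - x) * h i‖ ≤ ‖I.mkHom ((y - x) * h i)‖ + ε ∧
      ‖h i * (P.glue x y - x)‖ ≤ ‖I.mkHom (h i * (y - x))‖ + ε := by
  -- Moving `h i` past the outer factors `k` and `1 + l` costs `(‖x‖ + ‖y‖) δ`; gluing the products
  -- costs `3 δ`.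
  set δ := ε / (3 + ‖x‖ + ‖y‖) with hδ
  have hδ0 : 0 < δ := by positivity
  have hδε : δ * (3 + ‖x‖ + ‖y‖) = ε := by rw [hδ]; field_simp
  obtain ⟨P, hP⟩ := I.exists_gluingPair (Sum.elim h (Sum.elim (Sum.elim (fun i => x * h i)
    (fun i => h i * x)) (Sum.elim (fun i => (y - x) * h i) (fun i => h i * (y - x))))) hδ0
  refine ⟨P, fun i => ?_⟩
  obtain ⟨hk, hl, -⟩ := hP (Sum.inl i)
  simp only [Sum.elim_inl] at hk hl
  have a1 := hP (Sum.inr (Sum.inl (Sum.inl i)))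
  have a2 := hP (Sum.inr (Sum.inl (Sum.inr i)))
  have a3 := (hP (Sum.inr (Sum.inr (Sum.inl i)))).2.2
  have a4 := (hP (Sum.inr (Sum.inr (Sum.inr i)))).2.2
  simp only [Sum.elim_inl, Sum.elim_inr] at a1 a2 a3 a4
  have nx := Unitization.norm_inr (𝕜 := ℂ) x
  have ny := Unitization.norm_inr (𝕜 := ℂ) y
  have hx0 := norm_nonneg x
  have hy0 := norm_nonneg y
  constructor
  · have b1 := P.norm_glue_sub_le (x := x * h i) (y := y * h i) a1.1 a1.2.1
      (c := ‖I.mkHom ((y - x) * h i)‖ + δ) (by rw [← sub_mul]; exact a3)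
    have b2 : ‖P.glue x y * h i - P.glue (x * h i) (y * h i)‖ ≤ ‖x‖ * δ + ‖y‖ * δ := by
      have e : ((P.glue x y * h i - P.glue (x * h i) (y * h i) : B) : Unitization ℂ B) =
          P.k * x * (-(h i * P.k - P.k * h i)) + (1 + (P.l : Unitization ℂ B)) * y *
            (-(h i * (1 + (P.l : Unitization ℂ B)) - (1 + (P.l : Unitization ℂ B)) * h i)) := by
        rw [Unitization.inr_sub, Unitization.inr_mul, P.inr_glue, P.inr_glue, Unitization.inr_mul,
          Unitization.inr_mul]
        noncomm_ring
      rw [← Unitization.norm_inr (𝕜 := ℂ), e]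
      refine P.norm_conj_add_le.trans ?_
      rw [norm_neg, norm_neg, nx, ny]
      gcongr
    have e : (P.glue x y - x) * h i = (P.glue x y * h i - P.glue (x * h i) (y * h i)) +
      (P.glue (x * h i) (y * h i) - x * h i) := by noncomm_ring
    rw [e]
    refine (norm_add_le _ _).trans ((add_le_add b2 b1).trans ?_)
    nlinarith
  · have b1 := P.norm_glue_sub_le (x := h i * x) (y := h i * y) a2.1 a2.2.1
      (c := ‖I.mkHom (h i * (y - x))‖ + δ) (by rw [← mul_sub]; exact a4)
    have b2 : ‖h i * P.glue x y - P.glue (h i * x) (h i * y)‖ ≤ δ * ‖x‖ + δ * ‖y‖ := by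
      have e : ((h i * P.glue x y - P.glue (h i * x) (h i * y) : B) : Unitization ℂ B) =
          (h i * P.k - P.k * h i) * x * P.k +
            (h i * (1 + (P.l : Unitization ℂ B)) - (1 + (P.l : Unitization ℂ B)) * h i) * y *
              (1 + (P.l : Unitization ℂ B)) := by
        rw [Unitization.inr_sub, Unitization.inr_mul, P.inr_glue, P.inr_glue, Unitization.inr_mul,
          Unitization.inr_mul]
        noncomm_ring
      have hr : ∀ {a z k : Unitization ℂ B} {r : ℝ}, ‖k‖ ≤ 1 → ‖a‖ ≤ δ → ‖z‖ = r →
          ‖a * z * k‖ ≤ δ * r := fun {a z k r} hk ha hz => by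
        refine (norm_mul_le _ _).trans ((mul_le_of_le_one_right (norm_nonneg _) hk).trans
          ((norm_mul_le _ _).trans ?_))
        rw [hz]
        exact mul_le_mul_of_nonneg_right ha (hz ▸ norm_nonneg z)
      rw [← Unitization.norm_inr (𝕜 := ℂ), e]
      exact (norm_add_le _ _).trans (add_le_add (hr P.norm_k_le hk nx) (hr P.norm_l_le hl ny))
    have e : h i * (P.glue x y - x) = (h i * P.glue x y - P.glue (h i * x) (h i * y)) +
      (P.glue (h i * x) (h i * y) - h i * x) := by noncomm_ring
    rw [e]
    refine (norm_add_le _ _).trans ((add_le_add b2 b1).trans ?_)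
    nlinarith

end ClosedIdeal

end

noncomputable section

open Filter Topology

/-! ### Limits of recursively defined sequences -/

theorem exists_seq_of_step {X : Type*} {P : ℕ → X → Prop} {R : ℕ → X → X → Prop} {x₀ : X}
    (h₀ : P 0 x₀) (step : ∀ n x, P n x → ∃ y, P (n + 1) y ∧ R n x y) :
    ∃ f : ℕ → X, (∀ n, P n (f n)) ∧ ∀ n, R n (f n) (f (n + 1)) := by
  choose! g hg using step
  let f : ℕ → X := fun n => Nat.rec x₀ g n
  have hf : ∀ n, P n (f n) := fun n => by
    induction n with
    | zero => exact h₀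
    | succ n ih => exact (hg n _ ih).1
  exact ⟨f, hf, fun n => (hg n _ (hf n)).2⟩

theorem cauchySeq_of_eventually_geometric {X : Type*} [PseudoMetricSpace X] {f : ℕ → X} {C : ℝ}
    (i : ℕ) (h : ∀ n, i ≤ n → dist (f n) (f (n + 1)) ≤ C * (1 / 2) ^ n) : CauchySeq f := by
  rw [← cauchySeq_shift i]
  refine cauchySeq_of_le_geometric (1 / 2) (C * (1 / 2) ^ i) (by norm_num) fun n => ?_
  have := h (n + i) (Nat.le_add_left i n)
  rw [show n + 1 + i = n + i + 1 by ring]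
  refine this.trans (le_of_eq ?_)
  rw [pow_add]; ring

theorem exists_diagonal_le {d : ℕ → ℕ → ℝ} (h : ∀ i, Tendsto (d i) atTop (𝓝 0)) :
    ∃ σ : ℕ → ℕ, ∀ n, n ≤ σ n ∧ ∀ i ≤ n, d i (σ n) ≤ (1 / 2) ^ n := by
  have : ∀ n, ∃ m, n ≤ m ∧ ∀ i ≤ n, d i m ≤ (1 / 2) ^ n := fun n => by
    have h1 : ∀ᶠ m in atTop, ∀ i ∈ Finset.range (n + 1), d i m ≤ (1 / 2) ^ n :=
      (Finset.eventually_all _).2 fun i _ => (h i).eventually_le_const (by positivity)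
    obtain ⟨m, hm, hm'⟩ := (h1.and (eventually_ge_atTop n)).exists
    exact ⟨m, hm', fun i hi => hm i (Finset.mem_range_succ_iff.2 hi)⟩
  choose σ hσ using this
  exact ⟨σ, hσ⟩

/-- A uniform bound carries the Cauchy property from a dense set to every point, so pointwise limits
exist and inherit the bound. -/
theorem exists_continuousLinearMap_tendsto {X Y : Type*} [NormedAddCommGroup X] [NormedSpace ℂ X]
    [NormedAddCommGroup Y] [NormedSpace ℂ Y] [CompleteSpace Y] {T : ℕ → X →ₗ[ℂ] Y} {c : ℝ}
    (hT : ∀ n x, ‖T n x‖ ≤ c * ‖x‖) (h : Dense {x | CauchySeq fun n => T n x}) :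
    ∃ L : X →L[ℂ] Y, ∀ x, Tendsto (fun n => T n x) atTop (𝓝 (L x)) := by
  have key : ∀ x, CauchySeq fun n => T n x := fun x => by
    rw [Metric.cauchySeq_iff']
    intro ε hε
    have hd : 0 < |c| + 1 := by positivity
    obtain ⟨y, hy, hxy⟩ := Metric.dense_iff.1 h x (ε / (4 * (|c| + 1))) (by positivity)
    obtain ⟨N, hN⟩ := Metric.cauchySeq_iff'.1 hxy (ε / 2) (half_pos hε)
    have hb : ∀ n, ‖T n (x - y)‖ ≤ ε / 4 := fun n => by
      rw [Metric.mem_ball, dist_comm, dist_eq_norm] at hy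
      calc ‖T n (x - y)‖ ≤ c * ‖x - y‖ := hT _ _
        _ ≤ (|c| + 1) * ‖x - y‖ := by gcongr; linarith [le_abs_self c]
        _ ≤ (|c| + 1) * (ε / (4 * (|c| + 1))) := by gcongr
        _ = ε / 4 := by field_simp
    refine ⟨N, fun n hn => ?_⟩
    have h1 := hN n hn
    rw [dist_eq_norm] at h1 ⊢
    have e : T n x - T N x = T n (x - y) + (T n y - T N y) + -(T N (x - y)) := by
      simp only [map_sub]; abel
    rw [e]
    have := hb n
    have := hb N
    have := norm_add₃_le (a := T n (x - y)) (b := T n y - T N y) (c := -(T N (x - y)))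
    rw [norm_neg] at this
    linarith
  choose L hL using fun x => cauchySeq_tendsto_of_complete (key x)
  refine ⟨(linearMapOfTendsto L T (tendsto_pi_nhds.2 hL)).mkContinuous c fun x => ?_, hL⟩
  exact le_of_tendsto (hL x).norm (Eventually.of_forall fun n => hT n x)

/-! ### Arveson's theorem on limits of liftable maps -/

namespace ClosedIdeal

variable {B : Type*} [NonUnitalCStarAlgebra B] (I : ClosedIdeal B)

/-- The set of liftable ccp maps on a separable C*-algebra is closed under pointwise limits. -/
theorem exists_isCCP_lift_of_tendsto {A : Type*} [NonUnitalCStarAlgebra A]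
    [TopologicalSpace.SeparableSpace A] {φ : A → I.Quotient} {ψ : ℕ → A →ₗ[ℂ] B}
    (hψ : ∀ n, IsCCP (ψ n)) (h : ∀ a, Tendsto (fun n => I.mkHom (ψ n a)) atTop (𝓝 (φ a))) :
    ∃ θ : A →ₗ[ℂ] B, IsCCP θ ∧ ∀ a, I.mkHom (θ a) = φ a := by
  let a := TopologicalSpace.denseSeq A
  obtain ⟨σ, hσ⟩ := exists_diagonal_le (d := fun i n => ‖I.mkHom (ψ n (a i)) - φ (a i)‖)
    fun i => tendsto_iff_norm_sub_tendsto_zero.1 (h (a i))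
  -- Each `θ` is glued with the next `ψ (σ (n + 1))`: modulo the ideal the result is the new map,
  -- but on the first `n + 1` dense points it moves by at most `2⁻⁽ⁿ⁺¹⁾ + 2⁻ⁿ` (distances to `φ` in
  -- the quotient) plus `2⁻ⁿ` (gluing error). This makes the steps summable although the `ψ n`
  -- themselves need not converge.
  obtain ⟨θ, hθ, hR⟩ := exists_seq_of_step
    (P := fun n (θ : A →ₗ[ℂ] B) => IsCCP θ ∧ ∀ x, I.mkHom (θ x) = I.mkHom (ψ (σ n) x))
    (R := fun n θ θ' => ∀ i ≤ n, ‖θ' (a i) - θ (a i)‖ ≤ 3 * (1 / 2) ^ n)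
    (x₀ := ψ (σ 0)) ⟨hψ _, fun _ => rfl⟩ (fun n θ hθ => by
      obtain ⟨P, hP⟩ := I.exists_norm_glue_sub_le (fun i : Fin (n + 1) => θ (a i))
        (fun i : Fin (n + 1) => ψ (σ (n + 1)) (a i)) (ε := (1 / 2) ^ n) (by positivity)
      refine ⟨P.glueMap θ (ψ (σ (n + 1))), ⟨P.isCCP_glueMap hθ.1 (hψ _), fun x => ?_⟩, fun i hi => ?_⟩
      · rw [P.glueMap_apply, P.mkHom_glue]
      · refine (hP ⟨i, Nat.lt_succ_iff.2 hi⟩).trans ?_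
        have h1 := (hσ n).2 i hi
        have h2 := (hσ (n + 1)).2 i (hi.trans n.le_succ)
        have h3 : ((1 : ℝ) / 2) ^ (n + 1) ≤ (1 / 2) ^ n :=
          pow_le_pow_of_le_one (by norm_num) (by norm_num) n.le_succ
        rw [map_sub, hθ.2]
        have := norm_sub_le_norm_sub_add_norm_sub (I.mkHom (ψ (σ (n + 1)) (a i))) (φ (a i))
          (I.mkHom (ψ (σ n) (a i)))
        rw [norm_sub_rev (φ (a i))] at this
        linarith)
  obtain ⟨L, hL⟩ := exists_continuousLinearMap_tendsto (T := θ) (c := 1)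
    (fun n x => by rw [one_mul]; exact (hθ n).1.norm_le x) (by
      refine (TopologicalSpace.denseRange_denseSeq A).mono ?_
      rintro _ ⟨i, rfl⟩
      refine cauchySeq_of_eventually_geometric (C := 3) i fun n hn => ?_
      rw [dist_comm, dist_eq_norm]
      exact hR n i hn)
  refine ⟨L, IsCCP.of_tendsto (fun n => (hθ n).1) hL, fun x => ?_⟩
  have h1 := (I.mkHom.continuous'.tendsto _).comp (hL x)
  have h2 : Tendsto σ atTop atTop := tendsto_atTop_mono (fun n => (hσ n).1) tendsto_id
  refine tendsto_nhds_unique h1 (((h x).comp h2).congr fun n => ?_)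
  exact ((hθ n).2 x).symm

end ClosedIdeal

/-! ### Lifting multipliers along a surjection -/

namespace Multiplier

variable {X Y : Type*} [NonUnitalCStarAlgebra X] [NonUnitalCStarAlgebra Y]

theorem fst_mul (m : 𝓜(ℂ, X)) (x y : X) : m.fst (x * y) = m.fst x * y := by
  rw [← sub_eq_zero]
  refine eq_zero_of_forall_mul fun z => ?_
  rw [mul_sub, ← mul_assoc, ← m.central, ← m.central, mul_assoc, sub_self]

theorem snd_mul (m : 𝓜(ℂ, X)) (x y : X) : m.snd (x * y) = x * m.snd y := by
  rw [← sub_eq_zero]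
  refine eq_zero_of_forall_mul' fun z => ?_
  rw [sub_mul, mul_assoc, m.central, m.central, mul_assoc, sub_self]

/-- The induced map on the quotient by the kernel is injective, hence isometric. -/
theorem _root_.ClosedIdeal.norm_mkHom_ker (ρ : X →⋆ₙₐ[ℂ] Y) (x : X) :
    ‖(ClosedIdeal.ker ρ).mkHom x‖ = ‖ρ x‖ := by
  have hinj : Function.Injective ((ClosedIdeal.ker ρ).lift ρ fun x hx => hx) := by
    rw [injective_iff_map_eq_zero]
    intro q hq
    obtain ⟨x, rfl⟩ := (ClosedIdeal.ker ρ).mkHom_surjective q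
    exact (ClosedIdeal.mkHom_eq_zero_iff _).2 hq
  exact (NonUnitalStarAlgHom.norm_map _ hinj _).symm

/-- The noncommutative Tietze extension theorem. -/
theorem map_surjective {ρ : X →⋆ₙₐ[ℂ] Y} (hρ : Function.Surjective ρ) {u : ℕ → X}
    (hu : ∀ n, ‖u n‖ ≤ 1) (hul : ∀ x, Tendsto (fun n => u n * x) atTop (𝓝 x))
    (hur : ∀ x, Tendsto (fun n => x * u n) atTop (𝓝 x)) : Function.Surjective (map hρ) := by
  intro m
  set I := ClosedIdeal.ker ρ
  -- Bounded lifts of `m ρ(uₙ)`. Their images converge strictly to `m`, but the lifts need not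
  -- converge strictly in `X`; gluing modulo `ker ρ` repairs this.
  have hlift : ∀ n, ∃ w, ρ w = m.fst (ρ (u n)) ∧ ‖w‖ ≤ ‖m‖ + 1 := fun n => by
    obtain ⟨w', hw'⟩ := hρ (m.fst (ρ (u n)))
    obtain ⟨w, hw, hn⟩ := I.exists_norm_lt (I.mkHom w') one_pos
    have e : ρ w = ρ w' := by
      rw [← sub_eq_zero, ← map_sub]; exact I.mkₗ_eq_iff.1 hw
    refine ⟨w, e.trans hw', hn.le.trans ?_⟩
    rw [ClosedIdeal.norm_mkHom_ker, hw']
    gcongr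
    refine (m.fst.le_opNorm _).trans ?_
    rw [DoubleCentralizer.norm_fst]
    exact mul_le_of_le_one_right (norm_nonneg _) ((NonUnitalStarAlgHom.norm_apply_le ρ _).trans (hu n))
  choose w hw hwn using hlift
  have hw1 : ∀ x, Tendsto (fun n => ρ (w n * x)) atTop (𝓝 (m.fst (ρ x))) := fun x => by
    refine (((m.fst.continuous.comp ρ.continuous').tendsto x).comp (hul x)).congr fun n => ?_
    simp only [Function.comp_apply, map_mul, hw, fst_mul]
  have hw2 : ∀ x, Tendsto (fun n => ρ (x * w n)) atTop (𝓝 (m.snd (ρ x))) := fun x => by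
    have hc : Continuous fun z => ρ z := ρ.continuous'
    obtain ⟨y, hy⟩ := hρ (m.snd (ρ x))
    have := (hc.tendsto y).comp (hur y)
    rw [hy] at this
    refine this.congr fun n => ?_
    simp only [Function.comp_apply, map_mul, hw, hy, m.central]
  obtain ⟨σ, hσ⟩ := exists_diagonal_le
    (d := fun i n => ‖ρ (w n * u i) - m.fst (ρ (u i))‖ + ‖ρ (u i * w n) - m.snd (ρ (u i))‖)
    fun i => by
      simpa using (tendsto_iff_norm_sub_tendsto_zero.1 (hw1 (u i))).add
        (tendsto_iff_norm_sub_tendsto_zero.1 (hw2 (u i)))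
  have hσ' : Tendsto σ atTop atTop := tendsto_atTop_mono (fun n => (hσ n).1) tendsto_id
  -- The corrected lifts keep the norm bound and the images of `w (σ n)`, and their increments are
  -- summable after multiplication by each fixed `u i` on either side.
  obtain ⟨θ, hθ, hR⟩ := exists_seq_of_step
    (P := fun n (x : X) => ‖x‖ ≤ ‖m‖ + 1 ∧ ρ x = ρ (w (σ n)))
    (R := fun n x x' => ∀ i ≤ n, ‖(x' - x) * u i‖ ≤ 3 * (1 / 2) ^ n ∧
      ‖u i * (x' - x)‖ ≤ 3 * (1 / 2) ^ n)
    (x₀ := w (σ 0)) ⟨hwn _, rfl⟩ (fun n x hx => by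
      obtain ⟨P, hP⟩ := I.exists_norm_glue_sub_mul_le x (w (σ (n + 1)))
        (fun i : Fin (n + 1) => u i) (ε := (1 / 2) ^ n) (by positivity)
      refine ⟨P.glue x (w (σ (n + 1))), ⟨P.norm_glue_le hx.1 (hwn _), ?_⟩, fun i hi => ?_⟩
      · rw [← sub_eq_zero, ← map_sub]
        exact I.mkₗ_eq_iff.1 (P.mkHom_glue x (w (σ (n + 1))))
      · have h1 := (hσ n).2 i hi
        have h2 := (hσ (n + 1)).2 i (hi.trans n.le_succ)
        have h3 : ((1 : ℝ) / 2) ^ (n + 1) ≤ (1 / 2) ^ n :=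
          pow_le_pow_of_le_one (by norm_num) (by norm_num) n.le_succ
        have p1 := norm_nonneg (ρ (w (σ n) * u i) - m.fst (ρ (u i)))
        have p2 := norm_nonneg (ρ (u i * w (σ n)) - m.snd (ρ (u i)))
        have p3 := norm_nonneg (ρ (w (σ (n + 1)) * u i) - m.fst (ρ (u i)))
        have p4 := norm_nonneg (ρ (u i * w (σ (n + 1))) - m.snd (ρ (u i)))
        have q := hP ⟨i, Nat.lt_succ_iff.2 hi⟩
        constructor
        · refine q.1.trans ?_
          rw [ClosedIdeal.norm_mkHom_ker, map_mul, map_sub, hx.2, ← map_sub, ← map_mul, sub_mul,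
            map_sub]
          have := norm_sub_le_norm_sub_add_norm_sub (ρ (w (σ (n + 1)) * u i)) (m.fst (ρ (u i)))
            (ρ (w (σ n) * u i))
          rw [norm_sub_rev (m.fst (ρ (u i)))] at this
          linarith
        · refine q.2.trans ?_
          rw [ClosedIdeal.norm_mkHom_ker, map_mul, map_sub, hx.2, ← map_sub, ← map_mul, mul_sub,
            map_sub]
          have := norm_sub_le_norm_sub_add_norm_sub (ρ (u i * w (σ (n + 1)))) (m.snd (ρ (u i)))
            (ρ (u i * w (σ n)))
          rw [norm_sub_rev (m.snd (ρ (u i)))] at this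
          linarith)
  have hc : ∀ n x, ‖θ n * x‖ ≤ (‖m‖ + 1) * ‖x‖ := fun n x =>
    (norm_mul_le _ _).trans (by gcongr; exact (hθ n).1)
  have hc' : ∀ n x, ‖x * θ n‖ ≤ (‖m‖ + 1) * ‖x‖ := fun n x =>
    (norm_mul_le _ _).trans (by rw [mul_comm]; gcongr; exact (hθ n).1)
  -- Left multiplications by `θ n` are Cauchy at the products `u i * x`, which are dense since `u`
  -- is an approximate unit; the limit is the left half of the multiplier. The right half is
  -- obtained from `x * u i`.
  obtain ⟨L, hL⟩ := exists_continuousLinearMap_tendsto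
    (T := fun n => LinearMap.mulLeft ℂ (θ n)) (c := ‖m‖ + 1) hc (fun x => by
      refine mem_closure_of_tendsto (hul x) (Eventually.of_forall fun i => ?_)
      refine cauchySeq_of_eventually_geometric (C := 3 * ‖x‖) i fun n hn => ?_
      rw [dist_comm, dist_eq_norm]
      simp only [LinearMap.mulLeft_apply]
      rw [← mul_assoc, ← mul_assoc, ← sub_mul, ← sub_mul]
      refine (norm_mul_le _ _).trans ?_
      rw [mul_right_comm]
      gcongr
      exact (hR n i hn).1)
  obtain ⟨R, hR'⟩ := exists_continuousLinearMap_tendsto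
    (T := fun n => LinearMap.mulRight ℂ (θ n)) (c := ‖m‖ + 1) hc' (fun x => by
      refine mem_closure_of_tendsto (hur x) (Eventually.of_forall fun i => ?_)
      refine cauchySeq_of_eventually_geometric (C := 3 * ‖x‖) i fun n hn => ?_
      rw [dist_comm, dist_eq_norm]
      simp only [LinearMap.mulRight_apply]
      rw [mul_assoc, mul_assoc, ← mul_sub, ← mul_sub]
      refine (norm_mul_le _ _).trans ?_
      rw [mul_right_comm, mul_comm]
      gcongr
      exact (hR n i hn).2)
  simp only [LinearMap.mulLeft_apply, LinearMap.mulRight_apply] at hL hR'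
  refine ⟨⟨(L, R), fun x y => ?_⟩, ext_of_surjective hρ (fun x => ?_) fun x => ?_⟩
  · refine tendsto_nhds_unique ((hR' x).mul_const y) (((hL y).const_mul x).congr fun n => ?_)
    rw [mul_assoc]
  · rw [map_fst]
    refine tendsto_nhds_unique ((ρ.continuous'.tendsto _).comp (hL x))
      (((hw1 x).comp hσ').congr fun n => ?_)
    simp only [Function.comp_apply, map_mul, (hθ n).2]
  · rw [map_snd]
    refine tendsto_nhds_unique ((ρ.continuous'.tendsto _).comp (hR' x))
      (((hw2 x).comp hσ').congr fun n => ?_)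
    simp only [Function.comp_apply, map_mul, (hθ n).2]

end Multiplier

end

noncomputable section

open Filter Topology

/-- A map which agrees with a compression of a ccp map by a contraction is ccp. -/
theorem IsCCP.of_conj_eq {A X Y : Type*} [NonUnitalCStarAlgebra A] [NonUnitalCStarAlgebra X]
    [NonUnitalCStarAlgebra Y] {j : Y →⋆ₙₐ[ℂ] X} (hj : Function.Injective j) {ψ : A →ₗ[ℂ] Y}
    {F : A →ₗ[ℂ] X} {z : X} (hz : ‖z‖ ≤ 1) (hF : IsCCP F)
    (h : ∀ a, j (ψ a) = star z * F a * z) : IsCCP ψ := by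
  refine IsCCP.of_hom_comp hj (isCCP_iff.2 ⟨fun n c => ?_, fun a => ?_⟩)
  · have := (hF.isCP n c).conj z
    simpa [h] using this
  · change ‖j (ψ a)‖ ≤ _
    rw [h]
    calc _ ≤ ‖star z‖ * ‖F a‖ * ‖z‖ :=
          (norm_mul_le _ _).trans (mul_le_mul_of_nonneg_right (norm_mul_le _ _) (norm_nonneg _))
      _ ≤ 1 * ‖a‖ * 1 := by
          rw [norm_star]
          gcongr
          exact hF.norm_le a
      _ = ‖a‖ := by ring

/-! ### Multiplier algebras -/

namespace Multiplier

variable {X Y : Type*} [NonUnitalCStarAlgebra X] [NonUnitalCStarAlgebra Y]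

theorem coe_zero : ((0 : X) : 𝓜(ℂ, X)) = 0 := map_zero (DoubleCentralizer.coeHom (𝕜 := ℂ) (A := X))

theorem coe_add (x y : X) : ((x + y : X) : 𝓜(ℂ, X)) = x + y :=
  map_add (DoubleCentralizer.coeHom (𝕜 := ℂ) (A := X)) x y

theorem coe_mul (x y : X) : ((x * y : X) : 𝓜(ℂ, X)) = x * y :=
  map_mul (DoubleCentralizer.coeHom (𝕜 := ℂ) (A := X)) x y

theorem coe_star (x : X) : ((star x : X) : 𝓜(ℂ, X)) = star (x : 𝓜(ℂ, X)) :=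
  map_star (DoubleCentralizer.coeHom (𝕜 := ℂ) (A := X)) x

theorem coe_injective : Function.Injective (DoubleCentralizer.coeHom (𝕜 := ℂ) (A := X)) := by
  rw [injective_iff_map_eq_zero]
  intro x hx
  refine eq_zero_of_forall_mul' fun z => ?_
  exact congrArg (fun m : 𝓜(ℂ, X) => m.fst z) hx

theorem norm_coe (x : X) : ‖(x : 𝓜(ℂ, X))‖ = ‖x‖ :=
  NonUnitalStarAlgHom.norm_map (DoubleCentralizer.coeHom (𝕜 := ℂ) (A := X)) coe_injective x

theorem continuous_coe : Continuous fun x : X => (x : 𝓜(ℂ, X)) :=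
  (DoubleCentralizer.coeHom (𝕜 := ℂ) (A := X)).continuous'

/-- The norm of a multiplier is the norm of its left part, so the left part determines it. -/
theorem eq_of_forall_fst {m n : 𝓜(ℂ, X)} (h : ∀ x, m.fst x = n.fst x) : m = n := by
  rw [← sub_eq_zero, ← norm_eq_zero, ← DoubleCentralizer.norm_fst, norm_eq_zero]
  ext x
  change m.fst x - n.fst x = 0
  rw [h, sub_self]

theorem mul_coe (m : 𝓜(ℂ, X)) (x : X) : m * (x : 𝓜(ℂ, X)) = (m.fst x : X) :=
  eq_of_forall_fst fun y => fst_mul m x y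

theorem coe_mul_multiplier (m : 𝓜(ℂ, X)) (x : X) : (x : 𝓜(ℂ, X)) * m = (m.snd x : X) :=
  eq_of_forall_fst fun y => (m.central x y).symm

theorem map_coe {ρ : X →⋆ₙₐ[ℂ] Y} (hρ : Function.Surjective ρ) (x : X) :
    map hρ (x : 𝓜(ℂ, X)) = (ρ x : Y) := by
  refine eq_of_forall_fst fun y => ?_
  obtain ⟨z, rfl⟩ := hρ y
  rw [map_fst]
  exact map_mul ρ x z

theorem map_one {ρ : X →⋆ₙₐ[ℂ] Y} (hρ : Function.Surjective ρ) : map hρ 1 = 1 := by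
  refine eq_of_forall_fst fun y => ?_
  obtain ⟨z, rfl⟩ := hρ y
  rw [map_fst]
  rfl

end Multiplier

/-! ### Matrix units in the stabilization -/

namespace Stab

open Multiplier

variable {B C : Type*} [NonUnitalCStarAlgebra B] [NonUnitalCStarAlgebra C]

theorem isFin_single' (i j : ℕ) (c : B) :
    ProdMat.IsFin (max i j + 1) (fun i' j' => if i' = i ∧ j' = j then c else 0) :=
  fun _ _ h => if_neg (by omega)

/-- The element `c ⊗ e_{ij}` of `B ⊗ K`. -/
def single (i j : ℕ) (c : B) : Stab B := ofMatrix (isFin_single' i j c)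

theorem star_single (i j : ℕ) (c : B) : star (single i j c) = single j i (star c) := by
  apply incl_injective
  rw [map_star]
  change star ((ProdMat.c₀ B).mkHom (ProdMat.ofFin (isFin_single' i j c))) = _
  rw [← map_star]
  refine (ProdMat.represents_ofFin _).star.mkHom_eq (l := max j i + 1) ?_
  convert ProdMat.represents_ofFin (isFin_single' j i (star c)) using 3 with i' j'
  by_cases hi : i' = j <;> by_cases hj : j' = i <;> simp [hi, hj]

theorem shiftLeft_single (i j : ℕ) (c : B) : shiftLeft (single i j c) = single (i + 1) j c := by
  apply incl_injective
  rw [incl_shiftLeft]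
  change _ * (ProdMat.c₀ B).mkHom (ProdMat.ofFin (isFin_single' i j c)) = _
  rw [← map_mul]
  refine (ProdMat.represents_ofFin _).shift_mul.mkHom_eq (l := max (i + 1) j + 1) ?_
  convert ProdMat.represents_ofFin (isFin_single' (i + 1) j c) using 3 with i' j'
  rcases i' with _ | i' <;> simp

theorem shift_mul_single (i j : ℕ) (c : B) :
    shift B * (single i j c : 𝓜(ℂ, Stab B)) = single (i + 1) j c := by
  rw [mul_coe, ← shiftLeft_single]; rfl

theorem single_mul_star_shift (i j : ℕ) (c : B) :
    (single i j c : 𝓜(ℂ, Stab B)) * star (shift B) = single i (j + 1) c := by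
  have h : ∀ j, single i j c = star (single j i (star c)) := fun j => by
    rw [star_single, star_star]
  rw [h, h, coe_star, coe_star, ← star_mul, shift_mul_single]

/-- The corner embedding of `B` into the multiplier algebra of `B ⊗ K`. -/
def cornerM (B : Type*) [NonUnitalCStarAlgebra B] : B →⋆ₙₐ[ℂ] 𝓜(ℂ, Stab B) :=
  (DoubleCentralizer.coeHom (𝕜 := ℂ) (A := Stab B)).comp (corner B)

theorem cornerM_apply (c : B) : cornerM B c = (corner B c : 𝓜(ℂ, Stab B)) := rfl

/-- With this formula all computations in `B ⊗ K` reduce to algebra with the shift and the corner,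
governed by `s* s = 1` and `c s = 0` for corner elements `c`. -/
theorem coe_single (i j : ℕ) (c : B) :
    (single i j c : 𝓜(ℂ, Stab B)) = shift B ^ i * cornerM B c * star (shift B) ^ j := by
  have h : ∀ i, (single i 0 c : 𝓜(ℂ, Stab B)) = shift B ^ i * cornerM B c := fun i => by
    induction i with
    | zero => rw [pow_zero, one_mul]; rfl
    | succ i ih => rw [← shift_mul_single, ih, pow_succ', mul_assoc]
  induction j with
  | zero => rw [pow_zero, mul_one, h]
  | succ j ih => rw [← single_mul_star_shift, ih, pow_succ, mul_assoc]

theorem represents_sum_single (b : ℕ → ℕ → B) (S : Finset (ℕ × ℕ)) :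
    ∃ x k, incl B (∑ q ∈ S, single q.1 q.2 (b q.1 q.2)) = (ProdMat.c₀ B).mkHom x ∧
      ProdMat.Represents x k (fun i j => if (i, j) ∈ S then b i j else 0) := by
  classical
  induction S using Finset.induction_on with
  | empty =>
    refine ⟨0, 0, by simp, fun _ _ _ => by simp, fun n _ i j => ?_⟩
    simp only [Finset.notMem_empty, if_false, Unitization.inr_zero]
    rfl
  | insert q S hq ih =>
    obtain ⟨x, k, hx, hR⟩ := ih
    obtain ⟨m, h1, h2⟩ := (ProdMat.represents_ofFin
      (isFin_single' q.1 q.2 (b q.1 q.2))).exists_common hR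
    refine ⟨ProdMat.ofFin (isFin_single' q.1 q.2 (b q.1 q.2)) + x, m, ?_, ?_⟩
    rotate_left
    · convert h1.add h2 using 3 with i j
      by_cases h : (i, j) = q
      · subst h; simp [hq]
      · have h' : ¬ (i = q.1 ∧ j = q.2) := fun h' => h (Prod.ext h'.1 h'.2)
        simp [h, h']
    · rw [Finset.sum_insert hq, map_add, hx, map_add]
      rfl

/-- A closed condition which is stable under sums holds on `B ⊗ K` if it holds for the elements
`b ⊗ e_{ij}`. -/
theorem induction {P : Stab B → Prop} (hP : IsClosed {y | P y}) (zero : P 0)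
    (add : ∀ x y, P x → P y → P (x + y)) (h : ∀ i j c, P (single i j c)) (y : Stab B) : P y := by
  have hcl : IsClosed (incl B '' {y | P y}) := by
    have : Isometry (incl B) := NonUnitalStarAlgHom.isometry _ incl_injective
    exact this.isClosedEmbedding.isClosedMap _ hP
  have : incl B y ∈ incl B '' {y | P y} := by
    refine ProdMat.stab_induction (P := fun q => q ∈ incl B '' {y | P y}) hcl
      (fun x k b hx => ?_) (incl_mem y)
    obtain ⟨x', k', hx', hR⟩ := represents_sum_single b (Finset.range k ×ˢ Finset.range k)
    refine ⟨∑ q ∈ Finset.range k ×ˢ Finset.range k, single q.1 q.2 (b q.1 q.2), ?_, ?_⟩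
    · exact Finset.sum_induction _ P add zero fun q _ => h _ _ _
    · rw [hx']
      refine hR.mkHom_eq (l := k) ?_
      convert hx using 3 with i j
      split_ifs with hij
      · rfl
      · exact (hx.1 i j (by simp at hij; omega)).symm
  obtain ⟨z, hz, e⟩ := this
  exact incl_injective e ▸ hz

/-- The entry at `(0, 0)` is the same in all truncations and bounds their norms from below, so a
null sequence forces it to vanish. -/
theorem corner_injective : Function.Injective (corner B) := by
  rw [injective_iff_map_eq_zero]
  intro c hc
  have h1 : (ProdMat.c₀ B).mkHom (ProdMat.ofFin (isFin_single c)) = 0 := by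
    rw [← incl_ofMatrix]; exact (congrArg (incl B) hc).trans (map_zero _)
  rw [ClosedIdeal.mkHom_eq_zero_iff] at h1
  have h2 : Tendsto (fun n => ‖(ProdMat.ofFin (isFin_single c)) n‖) atTop (𝓝 0) := h1
  rw [← norm_le_zero_iff]
  refine ge_of_tendsto h2 ?_
  filter_upwards [eventually_gt_atTop 0] with n hn
  have := CStarMatrix.norm_entry_le_norm (M := ProdMat.ofFin (isFin_single c) n) (i := ⟨0, hn⟩)
    (j := ⟨0, hn⟩)
  rw [ProdMat.ofFin_apply] at this
  simpa [Unitization.norm_inr] using this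

theorem cornerM_injective : Function.Injective (cornerM B) :=
  coe_injective.comp corner_injective

theorem norm_cornerM (c : B) : ‖cornerM B c‖ = ‖c‖ :=
  NonUnitalStarAlgHom.norm_map _ cornerM_injective c

/-! ### The shift and the rank one projection -/

theorem cornerM_mul_shift (c : B) : cornerM B c * shift B = 0 := corner_mul_shift c

theorem star_shift_mul_cornerM (c : B) : star (shift B) * cornerM B c = 0 := by
  rw [← star_star c, map_star, ← star_mul, cornerM_mul_shift, star_zero]

variable (B) in
/-- The projection `1 ⊗ e₀₀` in the multiplier algebra of `B ⊗ K`. -/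
def proj : 𝓜(ℂ, Stab B) := 1 - shift B * star (shift B)

theorem star_proj : star (proj B) = proj B := by simp [proj]

theorem star_shift_mul_proj : star (shift B) * proj B = 0 := by
  rw [proj, mul_sub, mul_one, ← mul_assoc, star_shift_mul_shift, one_mul, sub_self]

theorem proj_mul_shift : proj B * shift B = 0 := by
  rw [proj, sub_mul, one_mul, mul_assoc, star_shift_mul_shift, mul_one, sub_self]

theorem proj_mul_proj : proj B * proj B = proj B := by
  nth_rewrite 1 [proj]
  rw [sub_mul, one_mul, mul_assoc, star_shift_mul_proj, mul_zero, sub_zero]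

theorem proj_mul_cornerM (c : B) : proj B * cornerM B c = cornerM B c := by
  rw [proj, sub_mul, one_mul, mul_assoc, star_shift_mul_cornerM, mul_zero, sub_zero]

theorem cornerM_mul_proj (c : B) : cornerM B c * proj B = cornerM B c := by
  rw [proj, mul_sub, mul_one, ← mul_assoc, cornerM_mul_shift, zero_mul, sub_zero]

theorem proj_add : proj B + shift B * star (shift B) = 1 := by rw [proj, sub_add_cancel]

theorem star_shift_pow_mul_shift_pow (n : ℕ) : star (shift B) ^ n * shift B ^ n = 1 := by
  induction n with
  | zero => simp
  | succ n ih =>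
    rw [pow_succ, pow_succ', mul_assoc, ← mul_assoc (star _), star_shift_mul_shift, one_mul, ih]

theorem proj_mul_shift_pow {n : ℕ} (hn : n ≠ 0) : proj B * shift B ^ n = 0 := by
  obtain ⟨n, rfl⟩ := Nat.exists_eq_succ_of_ne_zero hn
  rw [pow_succ', ← mul_assoc, proj_mul_shift, zero_mul]

theorem star_shift_pow_mul_proj {n : ℕ} (hn : n ≠ 0) : star (shift B) ^ n * proj B = 0 := by
  have := congrArg star (proj_mul_shift_pow (B := B) hn)
  rwa [star_mul, star_pow, star_proj, star_zero] at this

theorem proj_mul_star_pow_mul_pow_mul_proj (i j : ℕ) :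
    proj B * star (shift B) ^ i * (shift B ^ j * proj B) = if i = j then proj B else 0 := by
  rcases lt_trichotomy i j with h | rfl | h
  · obtain ⟨k, rfl⟩ := Nat.exists_eq_add_of_lt h
    rw [if_neg h.ne, add_assoc, pow_add (shift B) i, mul_assoc, mul_assoc, ← mul_assoc (star _ ^ i),
      star_shift_pow_mul_shift_pow, one_mul, ← mul_assoc, proj_mul_shift_pow (by omega), zero_mul]
  · rw [if_pos rfl, mul_assoc, ← mul_assoc (star _ ^ i), star_shift_pow_mul_shift_pow, one_mul,
      proj_mul_proj]
  · obtain ⟨k, rfl⟩ := Nat.exists_eq_add_of_lt h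
    rw [if_neg h.ne', add_assoc, add_comm j, pow_add (star (shift B)), mul_assoc, mul_assoc,
      ← mul_assoc (star _ ^ j), star_shift_pow_mul_shift_pow, one_mul,
      star_shift_pow_mul_proj (by omega), mul_zero]

/-- Every `c ⊗ e_{ij}` begins with the factor `sⁱ p`, so a multiplier is determined by its columns.
-/
theorem eq_zero_of_forall_mul_shift_pow {m : 𝓜(ℂ, Stab B)}
    (h : ∀ i, m * (shift B ^ i * proj B) = 0) : m = 0 := by
  refine eq_of_forall_fst fun y => ?_
  refine (induction (P := fun y => m.fst y = 0) (isClosed_eq (by fun_prop) continuous_const)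
    (map_zero _) (fun x y hx hy => by rw [map_add, hx, hy, add_zero]) (fun i j c => ?_) y)
  refine coe_injective (?_ : ((_ : Stab B) : 𝓜(ℂ, Stab B)) = ((0 : Stab B) : 𝓜(ℂ, Stab B)))
  rw [← mul_coe, coe_single, ← proj_mul_cornerM, coe_zero, ← mul_assoc (shift B ^ i), ← mul_assoc,
    ← mul_assoc, h, zero_mul, zero_mul]

/-- The corner of a matrix unit is in the image of `B`, and that image is closed, so the claim
extends to all of `B ⊗ K`. -/
theorem exists_cornerM_eq (y : Stab B) :
    ∃ c, proj B * (y : 𝓜(ℂ, Stab B)) * proj B = cornerM B c := by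
  have hcl : IsClosed (Set.range (cornerM B)) := NonUnitalStarAlgHom.isClosed_range' _
  have hcont : Continuous fun y : Stab B => proj B * (y : 𝓜(ℂ, Stab B)) * proj B :=
    (continuous_mul_const (proj B)).comp
      ((continuous_const_mul (proj B)).comp (Multiplier.continuous_coe (X := Stab B)))
  have hP : IsClosed {y : Stab B | ∃ c, cornerM B c = proj B * (y : 𝓜(ℂ, Stab B)) * proj B} :=
    hcl.preimage hcont
  have hs : ∀ i j (c : B), ∃ d, cornerM B d = proj B * (single i j c : 𝓜(ℂ, Stab B)) * proj B := by
    intro i j c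
    rw [coe_single]
    by_cases hi : i = 0
    · by_cases hj : j = 0
      · exact ⟨c, by rw [hi, hj, pow_zero, pow_zero, one_mul, mul_one, proj_mul_cornerM,
          cornerM_mul_proj]⟩
      · exact ⟨0, by rw [map_zero, mul_assoc, mul_assoc (_ * _), star_shift_pow_mul_proj hj,
          mul_zero, mul_zero]⟩
    · exact ⟨0, by rw [map_zero, ← mul_assoc, ← mul_assoc, proj_mul_shift_pow hi, zero_mul,
          zero_mul, zero_mul]⟩
  obtain ⟨c, hc⟩ := induction hP ⟨0, by rw [coe_zero, map_zero, mul_zero, zero_mul]⟩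
    (fun x y ⟨c, hc⟩ ⟨d, hd⟩ => ⟨c + d, by rw [map_add, hc, hd, coe_add, mul_add, add_mul]⟩) hs y
  exact ⟨c, hc.symm⟩

/-- Compression of multipliers of `B ⊗ K` to the corner. -/
theorem exists_compression (b : B) : ∃ κ : 𝓜(ℂ, Stab B) →ₗ[ℂ] B,
    ∀ m, cornerM B (κ m) = star (cornerM B b) * m * cornerM B b := by
  have h : ∀ m, ∃ c, cornerM B c = star (cornerM B b) * m * cornerM B b := fun m => by
    -- The corner of `m` need not come from `B`, but `m (b ⊗ e₀₀)` already lies in `B ⊗ K`.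
    obtain ⟨c, hc⟩ := exists_cornerM_eq (m.fst (corner B b))
    rw [← mul_coe, ← mul_assoc] at hc
    refine ⟨star b * c, ?_⟩
    rw [map_mul, ← hc, map_star, ← cornerM_apply]
    have h1 : star (cornerM B b) * proj B = star (cornerM B b) := by
      rw [← map_star, cornerM_mul_proj]
    rw [mul_assoc (proj B * m), cornerM_mul_proj, mul_assoc (proj B), ← mul_assoc, h1, mul_assoc]
  choose κ hκ using h
  refine ⟨⟨⟨κ, fun m n => cornerM_injective ?_⟩, fun r m => cornerM_injective ?_⟩, hκ⟩
  · simp only [map_add, hκ, mul_add, add_mul]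
  · simp only [map_smul, hκ, RingHom.id_apply, mul_smul_comm, smul_mul_assoc]

/-! ### Approximate units of the stabilization -/

variable (B) in
/-- The block diagonal embedding `b ↦ b ⊗ 1_n` of `B` into the multiplier algebra of `B ⊗ K`. -/
def diag : ℕ → (B →⋆ₙₐ[ℂ] 𝓜(ℂ, Stab B))
  | 0 => 0
  | n + 1 => directSum (NonUnitalStarAlgHom.id ℂ B) (diag n)

theorem diag_succ (n : ℕ) (b : B) :
    diag B (n + 1) b = cornerM B b + shift B * diag B n b * star (shift B) := rfl

theorem exists_coe_eq_diag (n : ℕ) (b : B) : ∃ x : Stab B, (x : 𝓜(ℂ, Stab B)) = diag B n b := by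
  induction n with
  | zero => exact ⟨0, coe_zero⟩
  | succ n ih =>
    obtain ⟨x, hx⟩ := ih
    rw [diag_succ, ← hx, mul_coe, coe_mul_multiplier, cornerM_apply, ← coe_add]
    exact ⟨_, rfl⟩

theorem diag_mul_single {n i : ℕ} (hi : i < n) (j : ℕ) (b c : B) :
    diag B n b * (single i j c : 𝓜(ℂ, Stab B)) = single i j (b * c) := by
  rw [coe_single, coe_single, map_mul, ← mul_assoc, ← mul_assoc, ← mul_assoc]
  congr 1
  induction i generalizing n with
  | zero =>
    obtain ⟨n, rfl⟩ := Nat.exists_eq_succ_of_ne_zero hi.ne'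
    rw [pow_zero, mul_one, one_mul, diag_succ, add_mul, mul_assoc, mul_assoc,
      star_shift_mul_cornerM, mul_zero, mul_zero, add_zero]
  | succ i ih =>
    obtain ⟨n, rfl⟩ := Nat.exists_eq_succ_of_ne_zero (Nat.ne_zero_of_lt hi)
    rw [diag_succ, add_mul, pow_succ', ← mul_assoc, cornerM_mul_shift, zero_mul, zero_add,
      ← mul_assoc, mul_assoc _ _ (shift B), star_shift_mul_shift, mul_one, mul_assoc (shift B),
      mul_assoc (shift B), ih (by omega)]
    simp only [mul_assoc]

/-- Take `uₙ = eₙ ⊗ 1ₙ`. Once `n > i` the block covers row `i`, so `uₙ` acts on `c ⊗ e_{ij}` as `eₙ`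
acts on `c`; contractivity extends the convergence to all of `B ⊗ K`. -/
theorem exists_approxUnit (h : IsSigmaUnital B) : ∃ u : ℕ → Stab B, (∀ n, ‖u n‖ ≤ 1) ∧
    (∀ x, Tendsto (fun n => u n * x) atTop (𝓝 x)) ∧
    ∀ x, Tendsto (fun n => x * u n) atTop (𝓝 x) := by
  obtain ⟨e, he, hl⟩ := h
  have hes : ∀ n, star (e n) = e n := fun n => by
    let _ := CStarAlgebra.spectralOrder B
    have _ := CStarAlgebra.spectralOrderedRing B
    exact (IsSelfAdjoint.of_nonneg (he n).1).star_eq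
  choose u hu using fun n => exists_coe_eq_diag n (e n)
  have hus : ∀ n, star (u n) = u n := fun n => by
    refine coe_injective (?_ : ((_ : Stab B) : 𝓜(ℂ, Stab B)) = ((_ : Stab B) : 𝓜(ℂ, Stab B)))
    rw [coe_star, hu, ← map_star, hes]
  have hun : ∀ n, ‖u n‖ ≤ 1 := fun n => by
    rw [← norm_coe, hu]
    exact (NonUnitalStarAlgHom.norm_apply_le _ _).trans (he n).2
  have key : ∀ x, Tendsto (fun n => u n * x) atTop (𝓝 x) := fun x => by
    refine induction (P := fun x => Tendsto (fun n => u n * x) atTop (𝓝 x)) ?_ (by simp) ?_ ?_ x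
    · refine isClosed_of_closure_subset fun x hx => ?_
      simp only [Set.mem_ofPred_eq, Metric.tendsto_atTop, dist_eq_norm]
      intro ε hε
      obtain ⟨y, hy, hxy⟩ := Metric.mem_closure_iff.1 hx (ε / 3) (by positivity)
      simp only [Set.mem_ofPred_eq, Metric.tendsto_atTop, dist_eq_norm] at hy
      obtain ⟨N, hN⟩ := hy (ε / 3) (by positivity)
      refine ⟨N, fun n hn => ?_⟩
      have e : u n * x - x = u n * (x - y) + (u n * y - y) + -(x - y) := by noncomm_ring
      rw [e]
      have h1 : ‖u n * (x - y)‖ ≤ ‖x - y‖ :=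
        (norm_mul_le _ _).trans (mul_le_of_le_one_left (norm_nonneg _) (hun n))
      have h2 := norm_add₃_le (a := u n * (x - y)) (b := u n * y - y) (c := -(x - y))
      rw [norm_neg] at h2
      rw [dist_eq_norm] at hxy
      linarith [hN n hn]
    · intro x y hx hy
      simpa [mul_add] using hx.add hy
    · intro i j c
      have h1 : Tendsto (fun n => single i j (e n * c)) atTop (𝓝 (single i j c)) := by
        have hi : IsInducing fun x : Stab B => (x : 𝓜(ℂ, Stab B)) :=
          (NonUnitalStarAlgHom.isometry _ coe_injective).isUniformInducing.isInducing
        rw [hi.tendsto_nhds_iff]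
        have hc : Continuous fun c => shift B ^ i * cornerM B c * star (shift B) ^ j :=
          (continuous_const.mul (cornerM B).continuous').mul continuous_const
        have := (hc.tendsto c).comp (hl c).1
        simp only [← coe_single] at this
        exact this
      refine h1.congr' ?_
      filter_upwards [eventually_gt_atTop i] with n hn
      refine coe_injective (?_ : ((_ : Stab B) : 𝓜(ℂ, Stab B)) = ((_ : Stab B) : 𝓜(ℂ, Stab B)))
      rw [coe_mul, hu, diag_mul_single hn]
  refine ⟨u, hun, key, fun x => ?_⟩
  simpa [star_mul, hus] using (key (star x)).star

/-! ### Functoriality -/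

theorem map_corner (φ : B →⋆ₙₐ[ℂ] C) (b : B) : map φ (corner B b) = corner C (φ b) := by
  apply incl_injective
  rw [incl_map]
  change ProdMat.mapQuot φ ((ProdMat.c₀ B).mkHom (ProdMat.ofFin (isFin_single b))) = _
  rw [ProdMat.mapQuot_mkHom]
  refine ((ProdMat.represents_ofFin (isFin_single b)).map φ).mkHom_eq (l := 1) ?_
  convert ProdMat.represents_ofFin (isFin_single (φ b)) using 3 with i j
  split_ifs <;> simp

theorem map_shiftLeft (φ : B →⋆ₙₐ[ℂ] C) (y : Stab B) :
    map φ (shiftLeft y) = shiftLeft (map φ y) := by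
  apply incl_injective
  rw [incl_map, incl_shiftLeft, incl_shiftLeft, incl_map]
  refine ProdMat.stab_induction
    (P := fun q => ProdMat.mapQuot φ ((ProdMat.c₀ B).mkHom (ProdMat.shift B) * q) =
      (ProdMat.c₀ C).mkHom (ProdMat.shift C) * ProdMat.mapQuot φ q)
    (isClosed_eq ((ProdMat.mapQuot φ).continuous'.comp (continuous_const_mul _))
      (continuous_const.mul (ProdMat.mapQuot φ).continuous')) (fun x k b hx => ?_) (incl_mem y)
  rw [← map_mul, ProdMat.mapQuot_mkHom, ProdMat.mapQuot_mkHom, ← map_mul]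
  refine (hx.shift_mul.map φ).mkHom_eq (l := k + 1) ?_
  convert (hx.map φ).shift_mul using 3 with i j
  split_ifs <;> simp

end Stab

/-! ### The quotient map on corners, shifts and multipliers -/

section QuotientMap

open Stab Multiplier

variable {B : Type*} [NonUnitalCStarAlgebra B] (I : ClosedIdeal B)

theorem stabQuotientMap_cornerM (b : B) :
    stabQuotientMap I (cornerM B b) = cornerM I.Quotient (I.mkHom b) := by
  rw [cornerM_apply, stabQuotientMap, map_coe, map_corner, cornerM_apply]

theorem stabQuotientMap_one : stabQuotientMap I 1 = 1 := Multiplier.map_one _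

theorem stabQuotientMap_shift : stabQuotientMap I (shift B) = shift I.Quotient := by
  refine eq_of_forall_fst fun y => ?_
  obtain ⟨x, rfl⟩ := map_surjective I.mkHom_surjective y
  rw [stabQuotientMap, map_fst]
  exact map_shiftLeft _ x

theorem stabQuotientMap_proj : stabQuotientMap I (proj B) = proj I.Quotient := by
  rw [proj, map_sub, stabQuotientMap_one, map_mul, map_star, stabQuotientMap_shift, proj]

theorem stabQuotientMap_surjective (h : IsSigmaUnital B) :
    Function.Surjective (stabQuotientMap I) := by
  obtain ⟨u, h1, h2, h3⟩ := exists_approxUnit h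
  exact Multiplier.map_surjective _ h1 h2 h3

end QuotientMap

end

noncomputable section

open Filter Topology

/-! ### Approximate factorization -/

/-- If `z z* ≤ C N` then `z` belongs to the closed right ideal generated by `N`. -/
theorem CStarAlgebra.exists_norm_sub_mul_le {U : Type*} [CStarAlgebra U] [PartialOrder U]
    [StarOrderedRing U] {N z : U} {C : ℝ} (hN : 0 ≤ N) (h : z * star z ≤ C • N)
    {δ : ℝ} (hδ : 0 < δ) : ∃ y, ‖z - N * y‖ ≤ δ := by
  set C' := |C| + 1
  have hC' : 0 < C' := by positivity
  -- With `y = (N + ε)⁻¹ z` the remainder is `f(N) z` for `f(t) = ε / (t + ε)`. Its squared norm is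
  -- at most `|C|` times the supremum of `f(t)² t`, which is at most `ε`. The `1` in `C'` avoids
  -- division by zero.
  set ε := δ ^ 2 / C' with hε
  have hε0 : 0 < ε := by positivity
  have hNs : IsSelfAdjoint N := IsSelfAdjoint.of_nonneg hN
  have hden : ∀ t : ℝ, 0 < |t| + ε := fun t => by positivity
  set f : ℝ → ℝ := fun t => ε / (|t| + ε) with hf
  set g : ℝ → ℝ := fun t => (|t| + ε)⁻¹ with hg
  have hgc : Continuous g := Continuous.inv₀ (by fun_prop) fun t => (hden t).ne'
  have hfc : Continuous f := Continuous.div (by fun_prop) (by fun_prop) fun t => (hden t).ne'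
  have hspec : ∀ t ∈ spectrum ℝ N, 0 ≤ t := fun t ht => spectrum_nonneg_of_nonneg hN ht
  have e1 : N * cfc g N = 1 - cfc f N := by
    nth_rewrite 1 [← cfc_id ℝ N]
    rw [← cfc_mul _ _ N (by fun_prop) hgc.continuousOn, ← cfc_const_one ℝ N,
      ← cfc_sub (fun _ => (1 : ℝ)) f N (by fun_prop) hfc.continuousOn]
    refine cfc_congr fun t ht => ?_
    have := (hden t).ne'
    have h0 := hspec t ht
    simp only [id, hf, hg]
    field_simp
    rw [abs_of_nonneg h0]; ring
  have e2 : cfc f N * N * cfc f N = cfc (fun t => f t * t * f t) N := by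
    rw [cfc_mul (fun t => f t * t) f N (by fun_prop) hfc.continuousOn,
      cfc_mul f (fun t => t) N hfc.continuousOn (by fun_prop), cfc_id' ℝ N]
  have hfs : star (cfc f N) = cfc f N := (cfc_predicate f N).star_eq
  refine ⟨cfc g N * z, ?_⟩
  rw [← mul_assoc, e1, sub_mul, one_mul, sub_sub_cancel]
  have h1 : ‖cfc f N * z‖ * ‖cfc f N * z‖ ≤ δ * δ := by
    rw [← CStarRing.norm_self_mul_star, star_mul, hfs]
    have h2 : cfc f N * z * (star z * cfc f N) ≤ C • (cfc f N * N * cfc f N) := by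
      have := star_left_conjugate_le_conjugate h (cfc f N)
      rw [hfs] at this
      simpa only [mul_assoc, mul_smul_comm, smul_mul_assoc] using this
    have h3 : 0 ≤ cfc f N * z * (star z * cfc f N) := by
      have := mul_star_self_nonneg (cfc f N * z)
      rwa [star_mul, hfs] at this
    refine (CStarAlgebra.norm_le_norm_of_nonneg_of_le h3 h2).trans ?_
    rw [norm_smul, e2, Real.norm_eq_abs]
    have h4 : ‖cfc (fun t => f t * t * f t) N‖ ≤ ε := by
      refine norm_cfc_le hε0.le fun t ht => ?_
      have h0 := hspec t ht
      have := hden t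
      simp only [hf]
      rw [abs_of_nonneg h0, Real.norm_eq_abs, abs_of_nonneg (by positivity)]
      rw [div_mul_eq_mul_div, div_mul_div_comm, div_le_iff₀ (by positivity)]
      nlinarith [mul_nonneg h0 hε0.le, mul_nonneg h0 h0, mul_nonneg hε0.le (mul_nonneg h0 h0),
        mul_pos hε0 hε0, mul_nonneg h0 (mul_nonneg hε0.le hε0.le), pow_pos hε0 3]
    calc |C| * _ ≤ C' * ε := by
          gcongr
          simp [C']
      _ = δ * δ := by rw [hε]; field_simp
  nlinarith [norm_nonneg (cfc f N * z)]

namespace Stab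

open Multiplier

variable {B : Type*} [NonUnitalCStarAlgebra B]

variable (B) in
/-- The multiplier `1 ⊗ e_{m0}` of `B ⊗ K`. -/
def col (m : ℕ) : 𝓜(ℂ, Stab B) := shift B ^ m * proj B

theorem col_mul_proj (m : ℕ) : col B m * proj B = col B m := by
  rw [col, mul_assoc, proj_mul_proj]

theorem star_col_mul_col (i j : ℕ) :
    star (col B i) * col B j = if i = j then proj B else 0 := by
  rw [col, col, star_mul, star_pow, star_proj, proj_mul_star_pow_mul_pow_mul_proj]

theorem norm_proj_le : ‖proj B‖ ≤ 1 := by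
  have h := CStarRing.norm_star_mul_self (x := proj B)
  rw [star_proj, proj_mul_proj] at h
  nlinarith [norm_nonneg (proj B)]

theorem norm_col_le (m : ℕ) : ‖col B m‖ ≤ 1 := by
  have h := CStarRing.norm_star_mul_self (x := col B m)
  rw [star_col_mul_col, if_pos rfl] at h
  nlinarith [norm_nonneg (col B m), norm_proj_le (B := B)]

theorem eq_of_forall_mul_col {m n : 𝓜(ℂ, Stab B)} (h : ∀ i, m * col B i = n * col B i) :
    m = n := by
  rw [← sub_eq_zero]
  refine eq_zero_of_forall_mul_shift_pow fun i => ?_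
  rw [sub_mul, sub_eq_zero]
  exact h i

theorem eq_of_forall_star_col_mul_mul_col {m n : 𝓜(ℂ, Stab B)}
    (h : ∀ i j, star (col B i) * m * col B j = star (col B i) * n * col B j) : m = n := by
  refine eq_of_forall_mul_col fun j => star_injective (eq_of_forall_mul_col fun i => ?_)
  refine star_injective ?_
  simpa only [star_mul, star_star, mul_assoc] using h i j

/-- Since `c ⊗ e_{ij}` is the `i`-th column applied to `c ⊗ e_{0j}`, the ranges of the columns span
a dense subspace. -/
theorem mem_closure_of_col {S : Submodule ℂ (Stab B)}
    (h : ∀ m x, (col B m).fst x ∈ S.topologicalClosure) : S.topologicalClosure = ⊤ := by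
  rw [eq_top_iff]
  intro x _
  refine induction (P := fun x => x ∈ S.topologicalClosure) S.isClosed_topologicalClosure
    (Submodule.zero_mem _) (fun x y => Submodule.add_mem _) (fun i j c => ?_) x
  have : single i j c = (col B i).fst (single 0 j c) := by
    refine coe_injective (?_ : ((_ : Stab B) : 𝓜(ℂ, Stab B)) = ((_ : Stab B) : 𝓜(ℂ, Stab B)))
    rw [← mul_coe, coe_single, coe_single, pow_zero, one_mul, col, ← mul_assoc,
      mul_assoc _ (proj B), proj_mul_cornerM]
  rw [this]
  exact h _ _

/-! ### Gram operators -/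

variable {𝔸 : Type*} [CStarAlgebra 𝔸]

/-- Weights which make the Gram operators convergent. -/
def weight (a : ℕ → 𝔸) (m : ℕ) : ℝ := (1 / 2) ^ m / (1 + ‖a m‖)

theorem weight_pos (a : ℕ → 𝔸) (m : ℕ) : 0 < weight a m := by
  rw [weight]; positivity

theorem weight_mul (a : ℕ → 𝔸) (m : ℕ) : weight a m * (1 + ‖a m‖) = (1 / 2) ^ m := by
  rw [weight]; field_simp

/-- The term of index `(i, j)` of the Gram operator. -/
def gramTerm (Φ : 𝔸 →ₗ[ℂ] 𝓜(ℂ, Stab B)) (a : ℕ → 𝔸) (x : 𝔸) (η : ℕ → ℝ) (q : ℕ × ℕ) :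
    𝓜(ℂ, Stab B) :=
  (weight a q.1 * weight a q.2) • (col B q.1 * (Φ (star (a q.1) * x * a q.2) +
    (if q.1 = q.2 then η q.1 else 0) • 1) * star (col B q.2))

/-- The operator whose matrix with respect to the columns of `B ⊗ K` is, up to weights,
`Φ(aᵢ* x aⱼ) + δᵢⱼ ηᵢ`. -/
def gram (Φ : 𝔸 →ₗ[ℂ] 𝓜(ℂ, Stab B)) (a : ℕ → 𝔸) (x : 𝔸) (η : ℕ → ℝ) : 𝓜(ℂ, Stab B) :=
  ∑' q, gramTerm Φ a x η q

variable {Φ : 𝔸 →ₗ[ℂ] 𝓜(ℂ, Stab B)} (a : ℕ → 𝔸)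

theorem summable_gramTerm (hΦ : IsCCP Φ) (x : 𝔸) {η : ℕ → ℝ} (hη : ∀ i, 0 ≤ η i ∧ η i ≤ 1) :
    Summable (gramTerm Φ a x η) := by
  have h1 : Summable fun q : ℕ × ℕ => (‖x‖ + 1) * (((1 : ℝ) / 2) ^ q.1 * (1 / 2) ^ q.2) :=
    (summable_geometric_two.mul_of_nonneg summable_geometric_two (fun n => by positivity)
      (fun n => by positivity)).mul_left _
  refine Summable.of_norm_bounded h1 fun q => ?_
  obtain ⟨i, j⟩ := q
  have hw := weight_pos a i
  have hw' := weight_pos a j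
  have h2 : ‖Φ (star (a i) * x * a j) + (if i = j then η i else 0) • (1 : 𝓜(ℂ, Stab B))‖ ≤
      (‖x‖ + 1) * ((1 + ‖a i‖) * (1 + ‖a j‖)) := by
    have h3 : ‖Φ (star (a i) * x * a j)‖ ≤ ‖a i‖ * ‖x‖ * ‖a j‖ := by
      refine (hΦ.norm_le _).trans ((norm_mul_le _ _).trans ?_)
      gcongr
      exact (norm_mul_le _ _).trans (by rw [norm_star])
    have h4 : ‖(if i = j then η i else 0) • (1 : 𝓜(ℂ, Stab B))‖ ≤ 1 := by
      rw [norm_smul]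
      have h5 : ‖(1 : 𝓜(ℂ, Stab B))‖ ≤ 1 := by
        have := CStarRing.norm_star_mul_self (x := (1 : 𝓜(ℂ, Stab B)))
        rw [star_one, one_mul] at this
        nlinarith [norm_nonneg (1 : 𝓜(ℂ, Stab B))]
      refine mul_le_one₀ ?_ (norm_nonneg _) h5
      split_ifs
      · rw [Real.norm_eq_abs, abs_of_nonneg (hη i).1]; exact (hη i).2
      · simp
    have := norm_nonneg x
    have := norm_nonneg (a i)
    have := norm_nonneg (a j)
    refine (norm_add_le _ _).trans ((add_le_add h3 h4).trans ?_)
    nlinarith [mul_nonneg (norm_nonneg x) (norm_nonneg (a i)),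
      mul_nonneg (norm_nonneg x) (norm_nonneg (a j)),
      mul_nonneg (norm_nonneg (a i)) (norm_nonneg (a j))]
  calc ‖gramTerm Φ a x η (i, j)‖ ≤ weight a i * weight a j *
        (1 * ((‖x‖ + 1) * ((1 + ‖a i‖) * (1 + ‖a j‖))) * 1) := by
        rw [gramTerm, norm_smul, Real.norm_eq_abs, abs_of_nonneg (by positivity)]
        refine mul_le_mul_of_nonneg_left ?_ (by positivity)
        refine (norm_mul_le _ _).trans (mul_le_mul ((norm_mul_le _ _).trans
          (mul_le_mul (norm_col_le _) h2 (norm_nonneg _) zero_le_one)) ?_ (norm_nonneg _)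
          (by positivity))
        rw [norm_star]; exact norm_col_le _
    _ = (‖x‖ + 1) * ((weight a i * (1 + ‖a i‖)) * (weight a j * (1 + ‖a j‖))) := by ring
    _ = _ := by rw [weight_mul, weight_mul]

/-- The columns are orthogonal with common square `p`, so a single term of the series survives.
Identities between Gram operators thus become identities between entries. -/
theorem star_col_mul_gram_mul_col (hΦ : IsCCP Φ) (x : 𝔸) {η : ℕ → ℝ} (hη : ∀ i, 0 ≤ η i ∧ η i ≤ 1) (i j : ℕ) :
    star (col B i) * gram Φ a x η * col B j = (weight a i * weight a j) •
      (proj B * (Φ (star (a i) * x * a j) + (if i = j then η i else 0) • 1) * proj B) := by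
  have hs := summable_gramTerm a hΦ x hη
  rw [gram, ← hs.tsum_mul_left, ← (hs.mul_left _).tsum_mul_right]
  have e : ∀ q : ℕ × ℕ, star (col B i) * gramTerm Φ a x η q * col B j =
      (weight a q.1 * weight a q.2) • ((star (col B i) * col B q.1) *
        (Φ (star (a q.1) * x * a q.2) + (if q.1 = q.2 then η q.1 else 0) • 1) *
        (star (col B q.2) * col B j)) := fun q => by
    simp only [gramTerm, mul_smul_comm, smul_mul_assoc, mul_assoc]
  rw [tsum_eq_single (i, j)]
  · rw [e, star_col_mul_col, star_col_mul_col, if_pos rfl, if_pos rfl]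
  · intro q hq
    rw [e, star_col_mul_col, star_col_mul_col]
    by_cases h1 : i = q.1
    · have h2 : q.2 ≠ j := fun h2 => hq (Prod.ext h1.symm h2)
      rw [if_neg h2, mul_zero, smul_zero]
    · rw [if_neg h1, zero_mul, zero_mul, smul_zero]

/-- Complete positivity makes the kernel `Φ((d aᵢ)* (d aⱼ))` a sum of squares, so each square
partial sum is positive, the `η` part being a positive diagonal. Square partial sums converge to the
operator. -/
theorem gram_nonneg [PartialOrder 𝓜(ℂ, Stab B)] [StarOrderedRing 𝓜(ℂ, Stab B)]
    (hΦ : IsCCP Φ) (d : 𝔸) {η : ℕ → ℝ} (hη : ∀ i, 0 ≤ η i ∧ η i ≤ 1) : 0 ≤ gram Φ a (star d * d) η := by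
  have hs := (summable_gramTerm a hΦ (star d * d) hη).hasSum
  have ht : Tendsto (fun n => Finset.range n ×ˢ Finset.range n) atTop
      (atTop : Filter (Finset (ℕ × ℕ))) := by
    refine tendsto_atTop_finset_of_monotone (fun m n h => ?_) fun q => ⟨max q.1 q.2 + 1, ?_⟩
    · exact Finset.product_subset_product (Finset.range_mono h) (Finset.range_mono h)
    · simp only [Finset.mem_product, Finset.mem_range]
      omega
  refine CStarAlgebra.isClosed_nonneg.mem_of_tendsto (hs.comp ht) (Eventually.of_forall fun n => ?_)
  obtain ⟨m, M, hM⟩ := hΦ.isCP n fun i => d * a i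
  have e : ∑ q ∈ Finset.range n ×ˢ Finset.range n, gramTerm Φ a (star d * d) η q =
      ∑ k, star (∑ j : Fin n, weight a j • (M k j * star (col B j))) *
        (∑ j : Fin n, weight a j • (M k j * star (col B j))) +
      ∑ i : Fin n, (weight a i * weight a i * η i) • (col B i * star (col B i)) := by
    have h1 : ∀ i j : Fin n, gramTerm Φ a (star d * d) η (i, j) =
        ∑ k, star (weight a i • (M k i * star (col B i))) *
          (weight a j • (M k j * star (col B j))) +
        if i = j then (weight a i * weight a j * η i) • (col B i * star (col B j)) else 0 := by
      intro i j
      have h2 : star (a i) * (star d * d) * a j = star (d * a i) * (d * a j) := by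
        simp only [star_mul, mul_assoc]
      have h3 : ((i : ℕ) = j) ↔ i = j := Fin.val_inj
      have h4 : Φ (star (a i) * (star d * d) * a j) = ∑ k, star (M k i) * M k j := by
        rw [h2]; exact hM i j
      rw [gramTerm]
      dsimp only
      rw [h4]
      simp only [mul_add, add_mul, smul_add, star_smul, star_mul, star_star,
        star_trivial, smul_mul_smul_comm, Finset.mul_sum, Finset.sum_mul, Finset.smul_sum, h3,
        mul_assoc]
      congr 1
      split_ifs
      · simp only [mul_smul_comm, smul_mul_assoc, one_mul, smul_smul, mul_assoc]
      · simp
    rw [Finset.sum_product, Finset.sum_range]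
    simp only [Finset.sum_range, h1, Finset.sum_add_distrib, Finset.sum_ite_eq, Finset.mem_univ,
      if_true, star_sum, Finset.sum_mul_sum]
    congr 1
    exact (Finset.sum_congr rfl fun i _ => Finset.sum_comm).trans Finset.sum_comm
  change 0 ≤ ∑ q ∈ Finset.range n ×ˢ Finset.range n, gramTerm Φ a (star d * d) η q
  rw [e]
  refine add_nonneg (Finset.sum_nonneg fun k _ => star_mul_self_nonneg _)
    (Finset.sum_nonneg fun i _ => ?_)
  have := weight_pos a i
  have := (hη i).1
  exact smul_nonneg (by positivity) (mul_star_self_nonneg _)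

end Stab

end

noncomputable section

open Filter Topology

/-! ### Factorization of multipliers through a multiplier with dense range -/

namespace Multiplier

variable {X : Type*} [NonUnitalCStarAlgebra X]

theorem norm_fst_apply_le (m : 𝓜(ℂ, X)) (x : X) : ‖m.fst x‖ ≤ ‖m‖ * ‖x‖ := by
  rw [← DoubleCentralizer.norm_fst]
  exact m.fst.le_opNorm x

theorem eq_of_mul_eq_mul {h T S : 𝓜(ℂ, X)} (hd : DenseRange h.fst) (e : T * h = S * h) : T = S := by
  refine eq_of_forall_fst fun x => ?_
  refine congrFun (hd.equalizer T.fst.continuous S.fst.continuous (funext fun y => ?_)) x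
  exact congrArg (fun m : 𝓜(ℂ, X) => m.fst y) e

theorem norm_fst_apply_le_of_le [PartialOrder 𝓜(ℂ, X)] [StarOrderedRing 𝓜(ℂ, X)]
    {h R : 𝓜(ℂ, X)} {C : ℝ} (hR : star R * R ≤ C • (star h * h)) (x : X) :
    ‖R.fst x‖ ≤ √|C| * ‖h.fst x‖ := by
  have h1 : star (R * (x : 𝓜(ℂ, X))) * (R * (x : 𝓜(ℂ, X))) ≤
      C • (star (h * (x : 𝓜(ℂ, X))) * (h * (x : 𝓜(ℂ, X)))) := by
    have := star_left_conjugate_le_conjugate hR (x : 𝓜(ℂ, X))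
    simpa only [star_mul, mul_assoc, mul_smul_comm, smul_mul_assoc] using this
  have h2 := CStarAlgebra.norm_le_norm_of_nonneg_of_le (star_mul_self_nonneg _) h1
  rw [norm_smul, CStarRing.norm_star_mul_self, CStarRing.norm_star_mul_self, mul_coe, mul_coe,
    norm_coe, norm_coe, Real.norm_eq_abs] at h2
  refine le_of_sq_le_sq ?_ (by positivity)
  rw [mul_pow, Real.sq_sqrt (abs_nonneg C), sq, sq]
  exact h2

/-- Douglas factorization `T = R h⁻¹`: the first inequality makes `h x ↦ R x` bounded on the dense
range of `h`. A multiplier also needs an adjoint; the candidate is `R' h⁻¹`, and `h R = R'* h` says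
exactly that the two are adjoint on the range of `h`. -/
theorem exists_mul_eq [PartialOrder 𝓜(ℂ, X)] [StarOrderedRing 𝓜(ℂ, X)] {h R R' : 𝓜(ℂ, X)}
    {C C' : ℝ} (hs : star h = h) (hd : DenseRange h.fst) (hR : star R * R ≤ C • (h * h))
    (hR' : star R' * R' ≤ C' • (h * h)) (e : h * R = star R' * h) : ∃ T, T * h = R := by
  have key : ∀ {R : 𝓜(ℂ, X)} {C : ℝ}, star R * R ≤ C • (h * h) →
      ∃ L : X →L[ℂ] X, ∀ x, L (h.fst x) = R.fst x := fun {R C} hR => by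
    refine ⟨(R.fst : X →ₗ[ℂ] X).extendOfNorm (h.fst : X →ₗ[ℂ] X), fun x => ?_⟩
    refine LinearMap.extendOfNorm_eq (f := (R.fst : X →ₗ[ℂ] X)) (e := (h.fst : X →ₗ[ℂ] X)) hd
      ⟨√|C|, fun x => ?_⟩ x
    exact norm_fst_apply_le_of_le (by rwa [hs]) x
  obtain ⟨L, hL⟩ := key hR
  obtain ⟨L', hL'⟩ := key hR'
  let S : X →L[ℂ] X := (((starₗᵢ ℂ : X ≃ₗᵢ⋆[ℂ] X) : X →L⋆[ℂ] X).comp L').comp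
    ((starₗᵢ ℂ : X ≃ₗᵢ⋆[ℂ] X) : X →L⋆[ℂ] X)
  have hS : ∀ x, S x = star (L' (star x)) := fun x => rfl
  have hfs : ∀ (m : 𝓜(ℂ, X)) x y, star (m.fst x) * y = star x * (star m).fst y := fun m x y => by
    rw [← (star m).central, DoubleCentralizer.star_snd, star_star]
  have hcen : ∀ x y, star (L' x) * y = star x * L y := by
    intro x y
    refine congrFun (hd.equalizer (g := fun x => star (L' x) * y) (h := fun x => star x * L y)
      (by fun_prop) (by fun_prop) (funext fun x' => ?_)) x
    refine congrFun (hd.equalizer (g := fun y => star (L' (h.fst x')) * y)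
      (h := fun y => star (h.fst x') * L y) (by fun_prop) (by fun_prop) (funext fun y' => ?_)) y
    simp only [Function.comp_apply]
    rw [hL, hL', hfs, hfs, hs]
    congr 1
    exact (congrArg (fun m : 𝓜(ℂ, X) => m.fst y') e).symm
  refine ⟨⟨(L, S), fun x y => ?_⟩, eq_of_forall_fst hL⟩
  rw [hS, hcen, star_star]

end Multiplier

/-! ### The root of the Gram operator and its frame vectors -/

namespace Stab

open Multiplier

variable {B : Type*} [NonUnitalCStarAlgebra B] {𝔸 : Type*} [CStarAlgebra 𝔸]
  {Φ : 𝔸 →ₗ[ℂ] 𝓜(ℂ, Stab B)} {a : ℕ → 𝔸}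

theorem geometric_mem (i : ℕ) : 0 ≤ ((1 : ℝ) / 4) ^ i ∧ ((1 : ℝ) / 4) ^ i ≤ 1 :=
  ⟨by positivity, pow_le_one₀ (by norm_num) (by norm_num)⟩

variable (Φ a) in
/-- A positive square root, with dense range, of the Gram operator of a sequence. -/
structure GramRoot where
  h : 𝓜(ℂ, Stab B)
  star_h : star h = h
  mul_self : h * h = gram Φ a 1 fun i => (1 / 4) ^ i
  dense : DenseRange h.fst

/-- Deleting the perturbation at index `m` leaves a positive operator, so a positive multiple of
`col m * star (col m)` lies below `N`. Hence the range of `col m` is in the closure of the range of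
`N`, which is contained in that of `h`; the columns span densely. -/
theorem exists_gramRoot (hΦ : IsCCP Φ) (a : ℕ → 𝔸) : Nonempty (GramRoot Φ a) := by
  let _ := CStarAlgebra.spectralOrder 𝓜(ℂ, Stab B)
  have _ := CStarAlgebra.spectralOrderedRing 𝓜(ℂ, Stab B)
  have key : ∀ {η : ℕ → ℝ}, (∀ i, 0 ≤ η i ∧ η i ≤ 1) → 0 ≤ gram Φ a 1 η := fun hη => by
    have := gram_nonneg a hΦ 1 hη
    rwa [star_one, one_mul] at this
  set N := gram Φ a 1 fun i => (1 / 4) ^ i with hN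
  have hN0 : 0 ≤ N := key geometric_mem
  have hh : CFC.sqrt N * CFC.sqrt N = N := CFC.sqrt_mul_sqrt_self N hN0
  refine ⟨⟨CFC.sqrt N, (IsSelfAdjoint.of_nonneg (CFC.sqrt_nonneg N)).star_eq, hh, ?_⟩⟩
  set h := CFC.sqrt N
  have hcol : ∀ m x, (col B m).fst x ∈ (LinearMap.range (h.fst : Stab B →ₗ[ℂ] Stab B)).topologicalClosure := by
    intro m x
    set c : ℝ := weight a m * weight a m * (1 / 4) ^ m
    have hc : 0 < c := by have := weight_pos a m; positivity
    set η : ℕ → ℝ := fun i => if i = m then 0 else (1 / 4) ^ i with hη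
    have hη1 : ∀ i, 0 ≤ η i ∧ η i ≤ 1 := fun i => by
      simp only [hη]; split_ifs
      · simp
      · exact geometric_mem i
    have e : N = gram Φ a 1 η + c • (col B m * star (col B m)) := by
      refine eq_of_forall_star_col_mul_mul_col fun i j => ?_
      rw [mul_add, add_mul, hN, star_col_mul_gram_mul_col a hΦ _ geometric_mem,
        star_col_mul_gram_mul_col a hΦ _ hη1]
      have e1 : star (col B i) * c • (col B m * star (col B m)) * col B j =
          c • ((star (col B i) * col B m) * (star (col B m) * col B j)) := by
        simp only [mul_smul_comm, smul_mul_assoc, mul_assoc]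
      rw [e1, star_col_mul_col, star_col_mul_col]
      by_cases hij : i = j
      · subst hij
        by_cases him : i = m
        · subst him
          simp only [if_true, hη, zero_smul, add_zero, mul_add, add_mul, smul_add, mul_one,
            proj_mul_proj, mul_smul_comm, smul_mul_assoc, smul_smul, c]
        · simp only [if_true, hη, him, if_false, zero_mul, smul_zero, add_zero]
      · by_cases him : i = m
        · have : m ≠ j := fun hm => hij (him.trans hm)
          simp [hij, this]
        · simp [hij, him]
    have hle : col B m * star (col B m) ≤ c⁻¹ • N := by
      rw [e, smul_add, smul_smul, inv_mul_cancel₀ hc.ne', one_smul]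
      exact le_add_of_nonneg_left (smul_nonneg (by positivity) (key hη1))
    refine Metric.mem_closure_iff.2 fun ε hε => ?_
    obtain ⟨y, hy⟩ := CStarAlgebra.exists_norm_sub_mul_le hN0 hle
      (δ := ε / (2 * (‖x‖ + 1))) (by positivity)
    refine ⟨h.fst (h.fst (y.fst x)), ⟨_, rfl⟩, ?_⟩
    have e2 : (col B m).fst x - h.fst (h.fst (y.fst x)) = (col B m - N * y).fst x := by
      rw [← hh]; rfl
    rw [dist_eq_norm, e2]
    calc _ ≤ ‖col B m - N * y‖ * ‖x‖ := norm_fst_apply_le _ _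
      _ ≤ ε / (2 * (‖x‖ + 1)) * (‖x‖ + 1) := by gcongr; linarith
      _ = ε / 2 := by field_simp
      _ < ε := half_lt_self hε
  have := mem_closure_of_col hcol
  intro x
  have hx : x ∈ (LinearMap.range (h.fst : Stab B →ₗ[ℂ] Stab B)).topologicalClosure := by
    rw [this]; trivial
  exact hx

namespace GramRoot

variable (G : GramRoot Φ a)

/-- The vectors of the frame associated with a Gram operator. -/
def vec (m : ℕ) : 𝓜(ℂ, Stab B) := (weight a m)⁻¹ • (G.h * col B m)

theorem vec_mul_proj (m : ℕ) : G.vec m * proj B = G.vec m := by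
  rw [vec, smul_mul_assoc, mul_assoc, col_mul_proj]

theorem h_mul_col (m : ℕ) : G.h * col B m = weight a m • G.vec m := by
  rw [vec, smul_smul, mul_inv_cancel₀ (weight_pos a m).ne', one_smul]

/-- These are the inner products of the vectors `aᵢ ⊕ 2⁻ⁱ eᵢ` in `E ⊕ H`, where `E` is the
Stinespring module of `Φ`: the frame is a copy of these vectors over `B ⊗ K`. -/
theorem star_vec_mul_vec (hΦ : IsCCP Φ) (i j : ℕ) : star (G.vec i) * G.vec j =
    proj B * (Φ (star (a i) * a j) + (if i = j then (1 / 4 : ℝ) ^ i else 0) • 1) * proj B := by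
  have h1 := star_col_mul_gram_mul_col a hΦ 1 geometric_mem i j
  have e : star (G.vec i) * G.vec j = ((weight a i)⁻¹ * (weight a j)⁻¹) •
      (star (col B i) * gram Φ a 1 (fun i => (1 / 4) ^ i) * col B j) := by
    rw [← G.mul_self, vec, vec, star_smul, star_mul, G.star_h, star_trivial, smul_mul_smul_comm]
    simp only [mul_assoc]
  have hi := (weight_pos a i).ne'
  have hj := (weight_pos a j).ne'
  rw [e, h1, smul_smul, mul_one]
  have : (weight a i)⁻¹ * (weight a j)⁻¹ * (weight a i * weight a j) = 1 := by field_simp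
  rw [this, one_smul]

end GramRoot

/-- The indices at which the sequence `a` is close to `b`. -/
def near (a : ℕ → 𝔸) (b : 𝔸) : Filter ℕ := comap a (𝓝 b) ⊓ atTop

theorem tendsto_near (a : ℕ → 𝔸) (b : 𝔸) : Tendsto a (near a b) (𝓝 b) :=
  tendsto_comap.mono_left inf_le_left

theorem near_le (a : ℕ → 𝔸) (b : 𝔸) : near a b ≤ atTop := inf_le_right

/-- The pairing function lets the sequence visit each point of a dense sequence infinitely often, so
indices near `b` can be taken arbitrarily large and the perturbation `4⁻ⁱ` vanishes along them. -/
theorem exists_near_neBot (𝔸 : Type*) [CStarAlgebra 𝔸] [TopologicalSpace.SeparableSpace 𝔸] :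
    ∃ a : ℕ → 𝔸, ∀ b, (near a b).NeBot := by
  refine ⟨fun m => TopologicalSpace.denseSeq 𝔸 m.unpair.1, fun b => ?_⟩
  rw [near, inf_neBot_iff]
  rintro s ⟨t, ht, hts⟩ s' hs'
  obtain ⟨N, hN⟩ := mem_atTop_sets.1 hs'
  obtain ⟨i, hi⟩ := (TopologicalSpace.denseRange_denseSeq 𝔸).exists_mem_open isOpen_interior
    ⟨b, mem_interior_iff_mem_nhds.2 ht⟩
  refine ⟨Nat.pair i N, hts ?_, hN _ (Nat.right_le_pair i N)⟩
  simpa using interior_subset hi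

namespace GramRoot

variable (G : GramRoot Φ a)

theorem norm_proj_mul_mul_proj_le (m : 𝓜(ℂ, Stab B)) : ‖proj B * m * proj B‖ ≤ ‖m‖ :=
  calc _ ≤ ‖proj B‖ * ‖m‖ * ‖proj B‖ :=
        (norm_mul_le _ _).trans (mul_le_mul_of_nonneg_right (norm_mul_le _ _) (norm_nonneg _))
    _ ≤ 1 * ‖m‖ * 1 := by gcongr <;> exact norm_proj_le
    _ = ‖m‖ := by ring

theorem norm_one_le : ‖(1 : 𝓜(ℂ, Stab B))‖ ≤ 1 := by
  have := CStarRing.norm_star_mul_self (x := (1 : 𝓜(ℂ, Stab B)))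
  rw [star_one, one_mul] at this
  nlinarith [norm_nonneg (1 : 𝓜(ℂ, Stab B))]

theorem norm_vec_sub_vec_le (hΦ : IsCCP Φ) (i j : ℕ) :
    ‖G.vec i - G.vec j‖ * ‖G.vec i - G.vec j‖ ≤
      ‖a i - a j‖ * ‖a i - a j‖ + ((1 / 4) ^ i + (1 / 4) ^ j) := by
  by_cases hij : i = j
  · subst hij
    simp only [sub_self, norm_zero, mul_zero, zero_add]
    positivity
  have e : star (G.vec i - G.vec j) * (G.vec i - G.vec j) =
      proj B * (Φ (star (a i - a j) * (a i - a j)) +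
        ((1 / 4 : ℝ) ^ i + (1 / 4 : ℝ) ^ j) • 1) * proj B := by
    simp only [star_sub, sub_mul, mul_sub, G.star_vec_mul_vec hΦ, if_true, if_neg hij,
      if_neg (Ne.symm hij), map_sub, zero_smul, add_zero, add_smul, mul_add, add_mul]
    abel
  rw [← CStarRing.norm_star_mul_self, e]
  refine (norm_proj_mul_mul_proj_le _).trans ((norm_add_le _ _).trans (add_le_add ?_ ?_))
  · refine (hΦ.norm_le _).trans ?_
    rw [CStarRing.norm_star_mul_self]
  · rw [norm_smul, Real.norm_eq_abs, abs_of_nonneg (by positivity)]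
    exact mul_le_of_le_one_right (by positivity) norm_one_le

theorem exists_tendsto_vec (hΦ : IsCCP Φ) (b : 𝔸) [hb : (near a b).NeBot] :
    ∃ k, Tendsto G.vec (near a b) (𝓝 k) := by
  refine CompleteSpace.complete (f := Filter.map G.vec (near a b)) (Metric.cauchy_iff.2 ⟨inferInstance, ?_⟩)
  intro ε hε
  -- Two such indices give a squared distance below `4 δ² + 2 δ ≤ 6 δ ≤ ε² / 2`.
  set δ := min 1 (ε ^ 2 / 12) with hδ
  have hδ0 : 0 < δ := by positivity
  have hδ1 : δ ≤ 1 := min_le_left _ _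
  have hδ2 : δ ≤ ε ^ 2 / 12 := min_le_right _ _
  have h1 : ∀ᶠ m in near a b, dist (a m) b < δ := (tendsto_near a b).eventually (Metric.ball_mem_nhds b hδ0)
  have h2 : ∀ᶠ m in near a b, ((1 : ℝ) / 4) ^ m < δ :=
    ((tendsto_pow_atTop_nhds_zero_of_lt_one (by norm_num) (by norm_num)).eventually
      (gt_mem_nhds hδ0)).filter_mono (near_le a b)
  refine ⟨_, image_mem_map (h1.and h2), ?_⟩
  rintro _ ⟨i, ⟨hi1, hi2⟩, rfl⟩ _ ⟨j, ⟨hj1, hj2⟩, rfl⟩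
  rw [dist_eq_norm]
  have h3 := G.norm_vec_sub_vec_le hΦ i j
  have h4 : ‖a i - a j‖ ≤ 2 * δ := by
    rw [← dist_eq_norm]
    have := dist_triangle_right (a i) (a j) b
    linarith
  have h5 := norm_nonneg (a i - a j)
  by_contra! hcon
  nlinarith [mul_le_mul h4 h4 h5 (by positivity)]

/-- The frame vectors extend to a linear map on the whole algebra. -/
theorem exists_limit (hΦ : IsCCP Φ) (ha : ∀ b, (near a b).NeBot) :
    ∃ k : 𝔸 →ₗ[ℂ] 𝓜(ℂ, Stab B), (∀ b, Tendsto G.vec (near a b) (𝓝 (k b))) ∧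
      (∀ i b, star (G.vec i) * k b = proj B * Φ (star (a i) * b) * proj B) ∧
      ∀ b c, star (k b) * k c = proj B * Φ (star b * c) * proj B := by
  choose k hk using fun b => G.exists_tendsto_vec hΦ b (hb := ha b)
  have h1 : ∀ i b, star (G.vec i) * k b = proj B * Φ (star (a i) * b) * proj B := fun i b => by
    have t1 : Tendsto (fun m => star (G.vec i) * G.vec m) (near a b) (𝓝 (star (G.vec i) * k b)) :=
      (hk b).const_mul _
    have hc : Continuous fun x => proj B * Φ (star (a i) * x) * proj B :=
      (continuous_const.mul (hΦ.continuous.comp (continuous_const_mul _))).mul continuous_const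
    refine tendsto_nhds_unique t1 (((hc.tendsto b).comp (tendsto_near a b)).congr' ?_)
    have : ∀ᶠ m in near a b, i < m := (eventually_gt_atTop i).filter_mono (near_le a b)
    filter_upwards [this] with m hm
    rw [G.star_vec_mul_vec hΦ, if_neg hm.ne, zero_smul, add_zero]
    rfl
  have h2 : ∀ b c, star (k b) * k c = proj B * Φ (star b * c) * proj B := fun b c => by
    have t1 : Tendsto (fun m => star (G.vec m) * k c) (near a b) (𝓝 (star (k b) * k c)) :=
      (hk b).star.mul_const _
    have hc : Continuous fun x => proj B * Φ (star x * c) * proj B :=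
      (continuous_const.mul (hΦ.continuous.comp
        ((continuous_mul_const c).comp continuous_star))).mul continuous_const
    refine tendsto_nhds_unique t1 (((hc.tendsto b).comp (tendsto_near a b)).congr fun m => ?_)
    rw [h1]
    rfl
  refine ⟨⟨⟨k, fun b c => ?_⟩, fun r b => ?_⟩, hk, h1, h2⟩
  -- Linearity is read off from the inner products: the square of the defect expands, by `h2`, to
  -- zero.
  · rw [← sub_eq_zero, ← CStarRing.star_mul_self_eq_zero_iff]
    simp only [star_sub, star_add, sub_mul, mul_sub, add_mul, mul_add, h2, map_add]
    abel
  · rw [RingHom.id_apply, ← sub_eq_zero, ← CStarRing.star_mul_self_eq_zero_iff]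
    simp only [star_sub, star_smul, sub_mul, mul_sub, smul_mul_assoc, mul_smul_comm, h2, map_smul]
    module

end GramRoot

end Stab

end

noncomputable section

open Filter Topology

theorem Unitization.separableSpace (A : Type*) [NonUnitalCStarAlgebra A]
    [TopologicalSpace.SeparableSpace A] : TopologicalSpace.SeparableSpace (Unitization ℂ A) :=
  let e := (Unitization.uniformEquivProd (𝕜 := ℂ) (A := A)).symm.toHomeomorph
  e.surjective.denseRange.separableSpace e.continuous

/-! ### The representation on the frame and the dilation theorem -/

namespace Stab

open Multiplier

variable {B : Type*} [NonUnitalCStarAlgebra B] {𝔸 : Type*} [CStarAlgebra 𝔸]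
  {Φ : 𝔸 →ₗ[ℂ] 𝓜(ℂ, Stab B)} {a : ℕ → 𝔸}

variable (Φ a) in
/-- A frame: `B ⊗ K` is realized as the closed span of vectors with inner products `Φ(b* c)`, up to
small perturbations. -/
structure Frame extends GramRoot Φ a where
  k : 𝔸 →ₗ[ℂ] 𝓜(ℂ, Stab B)
  tendsto_vec : ∀ b, Tendsto toGramRoot.vec (near a b) (𝓝 (k b))
  star_vec_mul_k : ∀ i b, star (toGramRoot.vec i) * k b = proj B * Φ (star (a i) * b) * proj B
  star_k_mul_k : ∀ b c, star (k b) * k c = proj B * Φ (star b * c) * proj B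

theorem exists_frame (hΦ : IsCCP Φ) (ha : ∀ b, (near a b).NeBot) : Nonempty (Frame Φ a) := by
  obtain ⟨G⟩ := exists_gramRoot hΦ a
  obtain ⟨k, h1, h2, h3⟩ := G.exists_limit hΦ ha
  exact ⟨⟨G, k, h1, h2, h3⟩⟩

namespace Frame

variable (G : Frame Φ a)

theorem k_mul_proj (ha : ∀ b, (near a b).NeBot) (b : 𝔸) : G.k b * proj B = G.k b := by
  have := ha b
  refine tendsto_nhds_unique ((G.tendsto_vec b).mul_const (proj B)) ((G.tendsto_vec b).congr
    fun m => ?_)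
  rw [G.vec_mul_proj]

theorem norm_k_le (hΦ : IsCCP Φ) (b : 𝔸) : ‖G.k b‖ ≤ ‖b‖ := by
  have h : ‖G.k b‖ * ‖G.k b‖ ≤ ‖b‖ * ‖b‖ := by
    rw [← CStarRing.norm_star_mul_self, G.star_k_mul_k, ← CStarRing.norm_star_mul_self (x := b)]
    exact (GramRoot.norm_proj_mul_mul_proj_le _).trans (hΦ.norm_le _)
  exact abs_le_of_sq_le_sq' (by simpa [sq] using h) (norm_nonneg b) |>.2

/-- The operator which maps the square root of the Gram operator of `(aₘ)` to that of `(c aₘ)`. -/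
def opR (c : 𝔸) : 𝓜(ℂ, Stab B) := ∑' m, weight a m • (G.k (c * a m) * star (col B m))

theorem opR_mul_col (hΦ : IsCCP Φ) (ha : ∀ b, (near a b).NeBot) (c : 𝔸) (j : ℕ) :
    G.opR c * col B j = weight a j • G.k (c * a j) := by
  have hs : Summable fun m => weight a m • (G.k (c * a m) * star (col B m)) := by
    refine Summable.of_norm_bounded (summable_geometric_two.mul_left ‖c‖) fun m => ?_
    have hw := weight_pos a m
    rw [norm_smul, Real.norm_eq_abs, abs_of_pos hw]
    calc _ ≤ weight a m * (‖c‖ * (1 + ‖a m‖) * 1) := by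
          gcongr
          refine (norm_mul_le _ _).trans (mul_le_mul ?_ (by rw [norm_star]; exact norm_col_le m)
            (norm_nonneg _) (by positivity))
          refine (G.norm_k_le hΦ _).trans ((norm_mul_le _ _).trans ?_)
          gcongr
          linarith
      _ = ‖c‖ * (weight a m * (1 + ‖a m‖)) := by ring
      _ = _ := by rw [weight_mul]
  rw [opR, ← hs.tsum_mul_right, tsum_eq_single j]
  · rw [smul_mul_assoc, mul_assoc, star_col_mul_col, if_pos rfl, G.k_mul_proj ha]
  · intro m hm
    rw [smul_mul_assoc, mul_assoc, star_col_mul_col, if_neg hm, mul_zero, smul_zero]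

theorem star_mul_mul_mul (x y m n : 𝓜(ℂ, Stab B)) :
    star x * (m * n) * y = star (star m * x) * (n * y) := by
  rw [star_mul, star_star]; simp only [mul_assoc]

/-- Both sides have the entries `wᵢ wⱼ p Φ(aᵢ* c aⱼ) p`. This is the adjointness needed to divide by
`h`. -/
theorem h_mul_opR (hΦ : IsCCP Φ) (ha : ∀ b, (near a b).NeBot) (c : 𝔸) :
    G.h * G.opR c = star (G.opR (star c)) * G.h := by
  refine eq_of_forall_star_col_mul_mul_col fun i j => ?_
  have h1 : star (G.k (star c * a i)) * G.vec j = proj B * Φ (star (a i) * (c * a j)) * proj B := by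
    have h2 := congrArg star (G.star_vec_mul_k j (star c * a i))
    rw [← G.star_k_mul_k, star_mul, star_star, star_mul, star_star, G.star_k_mul_k] at h2
    rw [h2, star_mul, star_star, mul_assoc (star (a i))]
  rw [star_mul_mul_mul, star_mul_mul_mul, G.star_h, star_star, G.h_mul_col, G.h_mul_col,
    G.opR_mul_col hΦ ha, G.opR_mul_col hΦ ha, star_smul, star_smul, star_trivial (weight a i),
    smul_mul_smul_comm, smul_mul_smul_comm, h1, G.star_vec_mul_k]

/-- Entrywise, the difference is the Gram operator of `‖c‖² - c* c`, which is a square `d* d`, plus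
`‖c‖²` times the diagonal perturbation. Both are positive. -/
theorem star_opR_mul_opR_le [PartialOrder 𝓜(ℂ, Stab B)] [StarOrderedRing 𝓜(ℂ, Stab B)]
    (hΦ : IsCCP Φ) (ha : ∀ b, (near a b).NeBot) (c : 𝔸) :
    star (G.opR c) * G.opR c ≤ (‖c‖ ^ 2) • (G.h * G.h) := by
  let _ := CStarAlgebra.spectralOrder 𝔸
  have _ := CStarAlgebra.spectralOrderedRing 𝔸
  have hd := sub_nonneg.2 (CStarAlgebra.star_mul_le_algebraMap_norm_sq (a := c))
  obtain ⟨d, hd⟩ := CStarAlgebra.exists_eq_star_mul_self hd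
  have hd' : star d * d = (‖c‖ ^ 2) • (1 : 𝔸) - star c * c := by
    rw [← hd, Algebra.algebraMap_eq_smul_one]
  have h0 : ∀ i : ℕ, 0 ≤ (0 : ℝ) ∧ (0 : ℝ) ≤ 1 := fun _ => ⟨le_rfl, zero_le_one⟩
  have hn1 := gram_nonneg a hΦ d (η := fun _ => 0) h0
  have hn2 := gram_nonneg a hΦ 0 (η := fun i => (1 / 4) ^ i) geometric_mem
  rw [mul_zero] at hn2
  rw [← sub_nonneg]
  have e : (‖c‖ ^ 2) • (G.h * G.h) - star (G.opR c) * G.opR c =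
      gram Φ a (star d * d) (fun _ => 0) + (‖c‖ ^ 2) • gram Φ a 0 (fun i => (1 / 4) ^ i) := by
    refine eq_of_forall_star_col_mul_mul_col fun i j => ?_
    have hr : ∀ (r : ℝ) (x : 𝔸), Φ (r • x) = r • Φ x := fun r x => by
      rw [← Complex.coe_smul, map_smul, Complex.coe_smul]
    have e1 : star (col B i) * (star (G.opR c) * G.opR c) * col B j = (weight a i * weight a j) •
        (proj B * Φ (star (a i) * (star c * c) * a j) * proj B) := by
      rw [star_mul_mul_mul, star_star, G.opR_mul_col hΦ ha, G.opR_mul_col hΦ ha, star_smul,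
        star_trivial, smul_mul_smul_comm, G.star_k_mul_k, star_mul]
      simp only [mul_assoc]
    rw [mul_sub, sub_mul, mul_add, add_mul, e1, G.mul_self, mul_smul_comm, smul_mul_assoc,
      mul_smul_comm, smul_mul_assoc, star_col_mul_gram_mul_col a hΦ _ geometric_mem,
      star_col_mul_gram_mul_col a hΦ _ geometric_mem, star_col_mul_gram_mul_col a hΦ _ h0, hd']
    simp only [mul_sub, sub_mul, mul_smul_comm, smul_mul_assoc, mul_one, mul_zero, zero_mul,
      map_zero, zero_add, map_sub, hr, mul_add, add_mul, ite_self, zero_smul, add_zero]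
    module
  rw [e]
  exact add_nonneg hn1 (smul_nonneg (by positivity) hn2)

/-- The representation is `π(c) = opR(c) h⁻¹`. It sends the frame vector of `aₘ` to `k(c aₘ)`, so it
models left multiplication on `E` and zero on the perturbing summand; it need not be unital. Since
`h` has dense range, the algebraic identities can be checked on the frame. -/
theorem exists_rep (hΦ : IsCCP Φ) (ha : ∀ b, (near a b).NeBot) :
    ∃ π : 𝔸 →⋆ₙₐ[ℂ] 𝓜(ℂ, Stab B), ∀ c b, π c * G.k b = G.k (c * b) := by
  let _ := CStarAlgebra.spectralOrder 𝓜(ℂ, Stab B)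
  have _ := CStarAlgebra.spectralOrderedRing 𝓜(ℂ, Stab B)
  have key : ∀ c, ∃ T, T * G.h = G.opR c := fun c =>
    Multiplier.exists_mul_eq G.star_h G.dense (G.star_opR_mul_opR_le hΦ ha c)
      (G.star_opR_mul_opR_le hΦ ha (star c)) (G.h_mul_opR hΦ ha c)
  choose π hπ using key
  have hvec : ∀ c m, π c * G.vec m = G.k (c * a m) := fun c m => by
    rw [GramRoot.vec, mul_smul_comm, ← mul_assoc, hπ, G.opR_mul_col hΦ ha, smul_smul,
      inv_mul_cancel₀ (weight_pos a m).ne', one_smul]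
  have hk : ∀ c b, π c * G.k b = G.k (c * b) := fun c b => by
    have := ha b
    have hc : Continuous G.k := AddMonoidHomClass.continuous_of_bound G.k 1 fun x => by
      rw [one_mul]; exact G.norm_k_le hΦ x
    refine tendsto_nhds_unique ((G.tendsto_vec b).const_mul (π c))
      ((((hc.comp (continuous_const_mul c)).tendsto b).comp (tendsto_near a b)).congr fun m => ?_)
    rw [hvec]
    rfl
  have hext : ∀ {c} {T : 𝓜(ℂ, Stab B)}, (∀ j, T * G.vec j = G.k (c * a j)) → π c = T :=
    fun {c T} h => by
      refine Multiplier.eq_of_mul_eq_mul G.dense (eq_of_forall_mul_col fun j => ?_)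
      rw [mul_assoc, mul_assoc, G.h_mul_col, mul_smul_comm, mul_smul_comm, h, hvec]
  have hstar : ∀ c, π (star c) = star (π c) := fun c => by
    refine Multiplier.eq_of_mul_eq_mul G.dense (star_injective
      (Multiplier.eq_of_mul_eq_mul G.dense (star_injective ?_)))
    have h1 := G.h_mul_opR hΦ ha (star c)
    rw [star_star, ← hπ, ← hπ] at h1
    simp only [star_mul, star_star, G.star_h] at h1 ⊢
    rw [h1, mul_assoc]
  refine ⟨⟨⟨⟨⟨π, fun r c => hext fun j => ?_⟩, hext fun j => ?_, fun c d => hext fun j => ?_⟩,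
    fun c d => hext fun j => ?_⟩, hstar⟩, hk⟩
  · rw [MonoidHom.id_apply, smul_mul_assoc, hvec, smul_mul_assoc, map_smul]
  · rw [zero_mul, zero_mul, map_zero]
  · rw [add_mul, add_mul, hvec, hvec, map_add]
  · rw [mul_assoc, hvec, hk, mul_assoc]

end Frame

/-- Stinespring dilation of a unital ccp map into a multiplier algebra. -/
theorem exists_dilation_of_map_one [TopologicalSpace.SeparableSpace 𝔸] (hΦ : IsCCP Φ)
    (h1 : Φ 1 = 1) : ∃ F : 𝔸 →⋆ₙₐ[ℂ] 𝓜(ℂ, Stab B), ∀ c,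
      proj B * F c * proj B = proj B * Φ c * proj B := by
  obtain ⟨a, ha⟩ := exists_near_neBot 𝔸
  obtain ⟨G⟩ := exists_frame hΦ ha
  obtain ⟨π, hπ⟩ := G.exists_rep hΦ ha
  -- The cyclic vector. Since `Φ 1 = 1`, it is a partial isometry with initial projection `p`.
  set V := G.k 1
  have hV : star V * V = proj B := by
    rw [G.star_k_mul_k, star_one, one_mul, h1, mul_one, proj_mul_proj]
  have hVp : V * proj B = V := G.k_mul_proj ha 1
  have hpV : proj B * star V = star V := by
    have := congrArg star hVp
    rwa [star_mul, star_proj] at this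
  have hVs : V * shift B = 0 := by rw [← hVp, mul_assoc, proj_mul_shift, mul_zero]
  -- An isometry that carries the range of `V` onto the corner and the complement into the range of
  -- the shift. Conjugation by it stays multiplicative and places `V* π(c) V = p Φ(c) p` in the
  -- corner.
  set U := star V + shift B * (1 - V * star V) with hU
  have hsU : star U = V + (1 - V * star V) * star (shift B) := by
    rw [hU]; simp
  have hsV : star (shift B) * star V = 0 := by rw [← star_mul, hVs, star_zero]
  have hUU : star U * U = 1 := by
    have e1 : (1 - V * star V) * (1 - V * star V) = 1 - V * star V := by
      have : V * star V * (V * star V) = V * star V := by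
        rw [mul_assoc, ← mul_assoc (star V), hV, hpV]
      rw [mul_sub, sub_mul, sub_mul, this]; simp
    calc star U * U = V * star V + (V * shift B) * (1 - V * star V) +
          (1 - V * star V) * (star (shift B) * star V) +
          (1 - V * star V) * (star (shift B) * shift B) * (1 - V * star V) := by
          rw [hsU, hU]; noncomm_ring
      _ = 1 := by
          rw [hVs, hsV, star_shift_mul_shift, mul_one, e1]; simp
  have hpU : proj B * U = star V := by
    rw [hU, mul_add, hpV, ← mul_assoc, proj_mul_shift, zero_mul, add_zero]
  have hUp : star U * proj B = V := by
    have := congrArg star hpU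
    rwa [star_mul, star_proj, star_star] at this
  refine ⟨⟨⟨⟨⟨fun c => U * π c * star U, fun r c => ?_⟩, ?_, fun c d => ?_⟩, fun c d => ?_⟩,
    fun c => ?_⟩, fun c => ?_⟩
  · simp only [map_smul, mul_smul_comm, smul_mul_assoc, MonoidHom.id_apply]
  · simp only [map_zero, mul_zero, zero_mul]
  · simp only [map_add, mul_add, add_mul]
  · change U * π (c * d) * star U = U * π c * star U * (U * π d * star U)
    calc _ = U * π c * 1 * π d * star U := by rw [map_mul]; noncomm_ring
      _ = _ := by rw [← hUU]; noncomm_ring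
  · change U * π (star c) * star U = star (U * π c * star U)
    rw [map_star, star_mul, star_mul, star_star, mul_assoc]
  · change proj B * (U * π c * star U) * proj B = _
    calc _ = (proj B * U) * π c * (star U * proj B) := by noncomm_ring
      _ = _ := by rw [hpU, hUp, mul_assoc, hπ, G.star_k_mul_k, mul_one, star_one, one_mul]

/-- Every ccp map from a separable C*-algebra `A` into `B` is the compression to the corner of a
*-homomorphism from `A` into the multiplier algebra of `B ⊗ K`. -/
theorem exists_dilation {A : Type*} [NonUnitalCStarAlgebra A] [TopologicalSpace.SeparableSpace A]
    {φ : A →ₗ[ℂ] B} (hφ : IsCCP φ) :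
    ∃ F : A →⋆ₙₐ[ℂ] 𝓜(ℂ, Stab B), ∀ a, proj B * F a * proj B = cornerM B (φ a) := by
  have := Unitization.separableSpace A
  -- The unital extension to the unitization provides the hypothesis `Φ 1 = 1`; only the corner of
  -- the resulting dilation is used.
  have hΦ := (hφ.hom_comp (cornerM B)).unitExt (e := 1) fun x => ⟨one_mul x, mul_one x⟩
  obtain ⟨F, hF⟩ := exists_dilation_of_map_one hΦ (unitExt_one _ _)
  refine ⟨F.comp (Unitization.inrNonUnitalStarAlgHom ℂ A), fun a => ?_⟩
  have := hF (a : Unitization ℂ A)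
  rw [unitExt_inr] at this
  refine this.trans ?_
  change proj B * cornerM B (φ a) * proj B = _
  rw [proj_mul_cornerM, cornerM_mul_proj]

end Stab

end

noncomputable section

open Filter Topology

/-! ### Ideals of the unitization -/

theorem isSigmaUnital_of_cstarAlgebra (U : Type*) [CStarAlgebra U] : IsSigmaUnital U := by
  let _ := CStarAlgebra.spectralOrder U
  have _ := CStarAlgebra.spectralOrderedRing U
  refine ⟨fun _ => 1, fun _ => ⟨?_, ?_⟩, fun b => ⟨?_, ?_⟩⟩
  · have := star_mul_self_nonneg (1 : U)
    rwa [star_one, one_mul] at this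
  · have := CStarRing.norm_star_mul_self (x := (1 : U))
    rw [star_one, one_mul] at this
    nlinarith [norm_nonneg (1 : U)]
  · simp
  · simp

namespace ClosedIdeal

variable {B : Type*} [NonUnitalCStarAlgebra B] (I : ClosedIdeal B)

/-- An ideal of `B`, viewed as an ideal of the unitization of `B`. -/
def inr : ClosedIdeal (Unitization ℂ B) where
  carrier := {x | x.fst = 0 ∧ x.snd ∈ I.toSubmodule}
  add_mem' {x y} hx hy := ⟨by rw [Unitization.fst_add, hx.1, hy.1, add_zero],
    I.toSubmodule.add_mem hx.2 hy.2⟩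
  zero_mem' := ⟨rfl, I.toSubmodule.zero_mem⟩
  smul_mem' c x hx := ⟨by rw [Unitization.fst_smul, hx.1, smul_zero], I.toSubmodule.smul_mem c hx.2⟩
  mul_mem_left' a x hx := ⟨by rw [Unitization.fst_mul, hx.1, mul_zero], by
    rw [Unitization.snd_mul, hx.1, zero_smul, add_zero]
    exact I.toSubmodule.add_mem (I.toSubmodule.smul_mem _ hx.2) (I.mul_mem_left _ hx.2)⟩
  mul_mem_right' a x hx := ⟨by rw [Unitization.fst_mul, hx.1, zero_mul], by
    rw [Unitization.snd_mul, hx.1, zero_smul, zero_add]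
    exact I.toSubmodule.add_mem (I.toSubmodule.smul_mem _ hx.2) (I.mul_mem_right _ hx.2)⟩
  isClosed' := (isClosed_eq Unitization.continuous_fst continuous_const).inter
    (I.isClosed.preimage Unitization.continuous_snd)

theorem mem_inr {x : Unitization ℂ B} :
    x ∈ I.inr.toSubmodule ↔ x.fst = 0 ∧ x.snd ∈ I.toSubmodule := Iff.rfl

/-- The embedding of `B/I` into `B̃/I`. -/
def quotientInr : I.Quotient →⋆ₙₐ[ℂ] I.inr.Quotient :=
  I.lift (I.inr.mkHom.comp (Unitization.inrNonUnitalStarAlgHom ℂ B)) fun x hx => by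
    rw [NonUnitalStarAlgHom.comp_apply, mkHom_eq_zero_iff]
    exact ⟨rfl, hx⟩

theorem quotientInr_mkHom (b : B) :
    I.quotientInr (I.mkHom b) = I.inr.mkHom (b : Unitization ℂ B) := rfl

variable {I} {A : Type*} [NonUnitalCStarAlgebra A]

/-- A lift to the unitization of `B` has its classes in `B/I`, so its scalar part vanishes and it
already takes values in `B`. -/
theorem ccpMapsLift_of_inr (h : CCPMapsLift A I.inr) : CCPMapsLift A I := by
  intro φ hφ
  obtain ⟨ψ, hψ, hψφ⟩ := h _ (hφ.hom_comp I.quotientInr)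
  have h1 : ∀ a, ∃ b : B, ψ a = b ∧ I.mkHom b = φ a := fun a => by
    obtain ⟨b, hb⟩ := I.mkHom_surjective (φ a)
    have h2 : I.inr.mkHom (ψ a) = I.inr.mkHom (b : Unitization ℂ B) := by
      rw [hψφ, ← quotientInr_mkHom, hb]; rfl
    rw [mkHom_eq_iff, mem_inr] at h2
    rw [sub_eq_add_neg, Unitization.fst_add, Unitization.snd_add, Unitization.fst_neg,
      Unitization.snd_neg, Unitization.fst_inr, Unitization.snd_inr, neg_zero, add_zero,
      ← sub_eq_add_neg] at h2
    refine ⟨(ψ a).snd, Unitization.ext h2.1 rfl, ?_⟩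
    rw [← hb, mkHom_eq_iff]
    exact h2.2
  let θ : A →ₗ[ℂ] B :=
    { toFun := fun a => (ψ a).snd
      map_add' := fun a b => by rw [map_add, Unitization.snd_add]
      map_smul' := fun r a => by rw [map_smul, Unitization.snd_smul, RingHom.id_apply] }
  have h2 : ∀ a, ((θ a : B) : Unitization ℂ B) = ψ a ∧ I.mkHom (θ a) = φ a := fun a => by
    obtain ⟨b, hb, hb'⟩ := h1 a
    have : θ a = b := by
      change (ψ a).snd = b
      rw [hb, Unitization.snd_inr]
    rw [this]
    exact ⟨hb.symm, hb'⟩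
  refine ⟨θ, IsCCP.of_hom_comp (f := Unitization.inrNonUnitalStarAlgHom ℂ B)
    Unitization.inr_injective ?_, fun a => (h2 a).2⟩
  convert hψ using 1
  exact LinearMap.ext fun a => (h2 a).1

/-- As `D/J` has a unit, ccp maps on `A` extend to the unitization; lift the extension and restrict.
-/
theorem ccpMapsLift_of_unitization {D : Type*} [CStarAlgebra D] {J : ClosedIdeal D}
    (h : CCPMapsLift (Unitization ℂ A) J) : CCPMapsLift A J := by
  intro φ hφ
  have he : ∀ x, J.mkHom 1 * x = x ∧ x * J.mkHom 1 = x := fun x => by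
    obtain ⟨y, rfl⟩ := J.mkHom_surjective x
    rw [← map_mul, ← map_mul, one_mul, mul_one]
    exact ⟨rfl, rfl⟩
  obtain ⟨ψ, hψ, hψφ⟩ := h _ (hφ.unitExt he)
  refine ⟨_, hψ.comp_hom (Unitization.inrNonUnitalStarAlgHom ℂ A), fun a => ?_⟩
  refine (hψφ a).trans (unitExt_inr _ _ _)

end ClosedIdeal

/-- In the non-unital case the target is first replaced by its unitization, which supplies the unit
needed to extend the map. -/
theorem HasLP.ccpMapsLift {A : Type u} [NonUnitalCStarAlgebra A] (h : HasLP.{u, v} A) {B : Type v}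
    [NonUnitalCStarAlgebra B] (I : ClosedIdeal B) : CCPMapsLift A I := by
  by_cases hA : HasUnit A
  · exact h.1 hA B I
  · exact ClosedIdeal.ccpMapsLift_of_inr
      (ClosedIdeal.ccpMapsLift_of_unitization (h.2 hA (Unitization ℂ B) I.inr))

/-! ### The implications between the lifting conditions -/

section Main

open Stab

variable {A : Type*} [NonUnitalCStarAlgebra A] {B : Type*} [NonUnitalCStarAlgebra B]
  {I : ClosedIdeal B}

/-- A *-homomorphism into the multiplier algebra of `C ⊗ K` whose corner is multiplicative is block
diagonal. -/
theorem Stab.exists_eq_directSum {C : Type*} [NonUnitalCStarAlgebra C]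
    (G : A →⋆ₙₐ[ℂ] 𝓜(ℂ, Stab C)) (f : A →⋆ₙₐ[ℂ] C)
    (h : ∀ a, proj C * G a * proj C = cornerM C (f a)) :
    ∃ g : A →⋆ₙₐ[ℂ] 𝓜(ℂ, Stab C), ∀ a, G a = directSum f g a := by
  -- Since `s s* = 1 - p`, the square of this off-diagonal entry is `p G(a* a) p - p G(a*) p G(a)
  -- p`, which vanishes because the corner is multiplicative.
  have h0 : ∀ a, star (shift C) * G a * proj C = 0 := fun a => by
    rw [← CStarRing.star_mul_self_eq_zero_iff]
    have e : star (star (shift C) * G a * proj C) * (star (shift C) * G a * proj C) =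
        proj C * G (star a * a) * proj C - proj C * G (star a) * proj C * (proj C * G a * proj C) := by
      have e1 : shift C * star (shift C) = 1 - proj C := by rw [← proj_add]; abel
      calc _ = proj C * G (star a) * (shift C * star (shift C)) * G a * proj C := by
            rw [star_mul, star_mul, star_star, star_proj, ← map_star]; noncomm_ring
        _ = proj C * (G (star a) * G a) * proj C -
            proj C * G (star a) * (proj C * proj C) * G a * proj C := by
            rw [e1, proj_mul_proj]; noncomm_ring
        _ = _ := by rw [← map_mul]; noncomm_ring
    rw [e, h, h, h, ← map_mul, ← map_mul, sub_self]
  have h1 : ∀ a, proj C * G a * shift C = 0 := fun a => by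
    have := congrArg star (h0 (star a))
    rwa [star_mul, star_mul, star_star, star_proj, ← map_star, star_star, star_zero,
      ← mul_assoc] at this
  let g : A →⋆ₙₐ[ℂ] 𝓜(ℂ, Stab C) :=
    { toFun := fun a => star (shift C) * G a * shift C
      map_smul' := fun r a => by
        simp only [map_smul, mul_smul_comm, smul_mul_assoc, MonoidHom.id_apply]
      map_zero' := by simp only [map_zero, mul_zero, zero_mul]
      map_add' := fun a b => by simp only [map_add, mul_add, add_mul]
      map_mul' := fun a b => by
        have e : star (shift C) * G (a * b) * shift C =
            (star (shift C) * G a * proj C) * G b * shift C +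
            star (shift C) * G a * shift C * (star (shift C) * G b * shift C) :=
          calc _ = star (shift C) * (G a * (proj C + shift C * star (shift C)) * G b) * shift C := by
                rw [proj_add, mul_one, map_mul]
            _ = _ := by noncomm_ring
        rw [e, h0, zero_mul, zero_mul, zero_add]
      map_star' := fun a => by
        rw [map_star, star_mul, star_mul, star_star, mul_assoc] }
  refine ⟨g, fun a => ?_⟩
  rw [directSum_apply, ← cornerM_apply, ← h]
  change G a = proj C * G a * proj C +
    shift C * (star (shift C) * G a * shift C) * star (shift C)
  calc G a = (proj C + shift C * star (shift C)) * G a * (proj C + shift C * star (shift C)) := by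
        rw [proj_add, one_mul, mul_one]
    _ = proj C * G a * proj C + shift C * (star (shift C) * G a * shift C) * star (shift C) +
        (proj C * G a * shift C) * star (shift C) + shift C * (star (shift C) * G a * proj C) := by
        noncomm_ring
    _ = _ := by rw [h0, h1, mul_zero, zero_mul, add_zero, add_zero]

/-- Dilate a ccp lift of `f`. Modulo the ideal the corner of the dilation is `f`, so the dilation
becomes block diagonal there. -/
theorem CCPMapsLift.homSummandLifts [TopologicalSpace.SeparableSpace A] (h : CCPMapsLift A I) :
    HomSummandLifts A I := by
  intro f
  obtain ⟨φ, hφ, hφf⟩ := h _ (NonUnitalStarAlgHom.isCCP f)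
  obtain ⟨F, hF⟩ := exists_dilation hφ
  obtain ⟨g, hg⟩ := exists_eq_directSum ((stabQuotientMap I).comp F) f fun a => by
    have := congrArg (stabQuotientMap I) (hF a)
    rw [map_mul, map_mul, stabQuotientMap_proj, stabQuotientMap_cornerM, hφf] at this
    exact this
  exact ⟨g, F, hg⟩

theorem HomSummandLifts.homSummandLiftsCCP (h : HomSummandLifts A I) : HomSummandLiftsCCP A I := by
  intro f
  obtain ⟨g, F, hF⟩ := h f
  exact ⟨g, F, NonUnitalStarAlgHom.isCCP F, hF⟩

/-- Compressing a lift of `f` in the corner. -/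
theorem exists_isCCP_compression {C : A → 𝓜(ℂ, Stab I.Quotient)} {φ : A → I.Quotient}
    {F : A →ₗ[ℂ] 𝓜(ℂ, Stab B)} (hF : IsCCP F) (hFC : ∀ a, stabQuotientMap I (F a) = C a)
    (hC : ∀ a, proj I.Quotient * C a * proj I.Quotient = cornerM I.Quotient (φ a)) {b : B}
    (hb : ‖b‖ ≤ 1) : ∃ ψ : A →ₗ[ℂ] B, IsCCP ψ ∧
      ∀ a, I.mkHom (ψ a) = star (I.mkHom b) * φ a * I.mkHom b := by
  obtain ⟨κ, hκ⟩ := exists_compression b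
  refine ⟨κ ∘ₗ F, IsCCP.of_conj_eq cornerM_injective (by rwa [norm_cornerM]) hF fun a => hκ (F a),
    fun a => cornerM_injective ?_⟩
  rw [← stabQuotientMap_cornerM, LinearMap.comp_apply, hκ, map_mul, map_mul, map_star, hFC,
    stabQuotientMap_cornerM, map_mul, map_mul, map_star, ← hC]
  set c := cornerM I.Quotient (I.mkHom b)
  have h1 : proj I.Quotient * c = c := proj_mul_cornerM _
  have h2 : star c * proj I.Quotient = star c := by
    have := congrArg star h1
    rwa [star_mul, star_proj] at this
  calc star c * C a * c = (star c * proj I.Quotient) * C a * (proj I.Quotient * c) := by rw [h1, h2]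
    _ = _ := by noncomm_ring

theorem proj_mul_directSum_mul_proj {C : Type*} [NonUnitalCStarAlgebra C] (f : A →⋆ₙₐ[ℂ] C)
    (g : A →⋆ₙₐ[ℂ] 𝓜(ℂ, Stab C)) (a : A) :
    proj C * directSum f g a * proj C = cornerM C (f a) := by
  rw [directSum_apply, ← cornerM_apply, mul_add, add_mul, proj_mul_cornerM, cornerM_mul_proj,
    ← mul_assoc, ← mul_assoc, proj_mul_shift, zero_mul, zero_mul, zero_mul, add_zero]

/-- The hypothesis concerns *-homomorphisms and the conclusion ccp maps: a dilation of `φ` makes the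
hypothesis applicable, and two compressions followed by a limit return to `B`. -/
theorem ccpMapsLift_of_homSummandLiftsCCP [TopologicalSpace.SeparableSpace A]
    (hB : IsSigmaUnital B) (h : HomSummandLiftsCCP A (ClosedIdeal.ker (stabQuotientMap I))) :
    CCPMapsLift A I := by
  intro φ hφ
  obtain ⟨f, hf⟩ := exists_dilation hφ
  set J := ClosedIdeal.ker (stabQuotientMap I)
  -- By the Tietze theorem this is an isomorphism of `M(B ⊗ K) / ker π̃` onto `M(B/I ⊗ K)`, through
  -- which `f` is pulled back to a map into the quotient.
  set ι := J.lift (stabQuotientMap I) fun x hx => hx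
  have hinj : Function.Injective ι := by
    rw [injective_iff_map_eq_zero]
    intro q hq
    obtain ⟨x, rfl⟩ := J.mkHom_surjective q
    exact J.mkHom_eq_zero_iff.2 hq
  have hsurj : ∀ m, ∃ q, ι q = m := fun m => by
    obtain ⟨x, hx⟩ := stabQuotientMap_surjective I hB m
    exact ⟨J.mkHom x, hx⟩
  choose r hr using hsurj
  let f' : A →⋆ₙₐ[ℂ] J.Quotient :=
    { toFun := fun a => r (f a)
      map_smul' := fun c a => hinj (by simp only [map_smul, hr, MonoidHom.id_apply])
      map_zero' := hinj (by simp only [map_zero, hr])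
      map_add' := fun a b => hinj (by simp only [map_add, hr])
      map_mul' := fun a b => hinj (by simp only [map_mul, hr])
      map_star' := fun a => hinj (by simp only [map_star, hr]) }
  obtain ⟨g, F, hF, hFg⟩ := h f'
  -- The first compression: `M(B ⊗ K)` has a unit, so `b = 1` recovers the corner exactly and `ψ`
  -- lifts `f`.
  obtain ⟨ψ, hψ, hψf⟩ := exists_isCCP_compression hF hFg (proj_mul_directSum_mul_proj f' g)
    (b := 1) GramRoot.norm_one_le
  have hψ1 : ∀ a, stabQuotientMap I (ψ a) = f a := fun a => by
    have h1 := congrArg ι (hψf a)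
    rw [map_mul, map_mul, map_star] at h1
    have h2 : ι (J.mkHom 1) = 1 := stabQuotientMap_one I
    rw [h2, star_one, one_mul, mul_one] at h1
    exact h1.trans (hr (f a))
  obtain ⟨e, he, hl⟩ := hB
  -- The second compression: `B` has only an approximate unit, so `θ n` lifts `φ` multiplied on both
  -- sides by the class of `e n`, which tends to `φ`.
  choose θ hθ hθφ using fun n => exists_isCCP_compression hψ hψ1 hf (he n).2
  refine I.exists_isCCP_lift_of_tendsto hθ fun a => ?_
  simp only [hθφ]
  obtain ⟨b, hb⟩ := I.mkHom_surjective (φ a)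
  have hs : ∀ n, star (e n) = e n := fun n => by
    let _ := CStarAlgebra.spectralOrder B
    have _ := CStarAlgebra.spectralOrderedRing B
    exact (IsSelfAdjoint.of_nonneg (he n).1).star_eq
  have h1 : Tendsto (fun n => e n * b * e n) atTop (𝓝 b) := by
    have h2 : Tendsto (fun n => e n * b * e n - b * e n) atTop (𝓝 0) := by
      refine squeeze_zero_norm (fun n => ?_) (tendsto_iff_norm_sub_tendsto_zero.1 (hl b).1)
      rw [← sub_mul]
      exact (norm_mul_le _ _).trans (mul_le_of_le_one_right (norm_nonneg _) (he n).2)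
    simpa using h2.add (hl b).2
  have h2 := (I.mkHom.continuous'.tendsto b).comp h1
  rw [hb] at h2
  refine h2.congr fun n => ?_
  simp only [Function.comp_apply, map_mul, ← map_star, hs, hb]

/-- If ccp maps on `A` lift, then *-homomorphisms on the unitization of `A` have ccp lifts. -/
theorem exists_isCCP_lift_unitization [TopologicalSpace.SeparableSpace (Unitization ℂ A)]
    (h : CCPMapsLift A I) (f : Unitization ℂ A →⋆ₙₐ[ℂ] I.Quotient) :
    ∃ ψ : Unitization ℂ A →ₗ[ℂ] B, IsCCP ψ ∧ ∀ x, I.mkHom (ψ x) = f x := by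
  obtain ⟨φ, hφ, hφf⟩ := h _ (NonUnitalStarAlgHom.isCCP
    (f.comp (Unitization.inrNonUnitalStarAlgHom ℂ A)))
  have hΦ := (hφ.hom_comp (Unitization.inrNonUnitalStarAlgHom ℂ B)).unitExt (e := 1)
    fun x => ⟨one_mul x, mul_one x⟩
  set Φ := unitExt ((Unitization.inrNonUnitalStarAlgHom ℂ B : B →ₗ[ℂ] Unitization ℂ B) ∘ₗ φ) 1
  -- `Φ` takes values in the unitization of `B`, and `f 1` is merely a projection. Compressing `Φ`
  -- by a contraction `b` over a multiple of `f 1` brings the values back into `B`, with class `r²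
  -- f`.
  have key : ∀ b : B, ‖b‖ ≤ 1 → ∀ r : ℝ, I.mkHom b = r • f 1 → ∃ ψ : Unitization ℂ A →ₗ[ℂ] B,
      IsCCP ψ ∧ ∀ x, I.mkHom (ψ x) = (r * r) • f x := by
    intro b hb r hr
    let ψ : Unitization ℂ A →ₗ[ℂ] B :=
      { toFun := fun x => x.fst • (star b * b) + star b * φ x.snd * b
        map_add' := fun x y => by
          simp only [Unitization.fst_add, Unitization.snd_add, map_add, add_smul, mul_add, add_mul]
          abel
        map_smul' := fun c x => by
          simp only [Unitization.fst_smul, Unitization.snd_smul, map_smul, smul_eq_mul, mul_smul,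
            RingHom.id_apply, smul_add, mul_smul_comm, smul_mul_assoc] }
    refine ⟨ψ, IsCCP.of_conj_eq (j := Unitization.inrNonUnitalStarAlgHom ℂ B)
      Unitization.inr_injective (z := (b : Unitization ℂ B))
      (by rwa [Unitization.norm_inr]) hΦ fun x => ?_, fun x => ?_⟩
    · change (((x.fst • (star b * b) + star b * φ x.snd * b : B)) : Unitization ℂ B) =
        star (b : Unitization ℂ B) * (x.fst • (1 : Unitization ℂ B) + (φ x.snd : B)) * b
      rw [mul_add, add_mul, mul_smul_comm, smul_mul_assoc, mul_one]
      simp only [Unitization.inr_add, Unitization.inr_smul, Unitization.inr_mul, Unitization.inr_star]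
    · change I.mkHom (x.fst • (star b * b) + star b * φ x.snd * b) = _
      have h1 : star (f 1) = f 1 := by rw [← map_star, star_one]
      have h2 : f 1 * f 1 = f 1 := by rw [← map_mul, one_mul]
      have h3 : I.mkHom (φ x.snd) = f (x.snd : Unitization ℂ A) := hφf x.snd
      have h4 : f 1 * f (x.snd : Unitization ℂ A) * f 1 = f (x.snd : Unitization ℂ A) := by
        rw [← map_mul, ← map_mul, one_mul, mul_one]
      have h5 : f x = x.fst • f 1 + f (x.snd : Unitization ℂ A) := by
        rw [← map_smul, ← map_add]
        congr 1
        ext <;> simp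
      rw [map_add, map_smul, map_mul, map_mul, map_mul, map_star, hr, h3, star_smul, h1,
        star_trivial, h5]
      simp only [smul_mul_assoc, mul_smul_comm, h2, h4]
      module
  have hf1 : ‖f 1‖ ≤ 1 := by
    have h1 : star (f 1) * f 1 = f 1 := by rw [← map_star, ← map_mul, star_one, one_mul]
    have := CStarRing.norm_star_mul_self (x := f 1)
    rw [h1] at this
    nlinarith [norm_nonneg (f 1)]
  -- A lift of `f 1` of norm below `1 + 1/(n + 1)` is rescaled to a contraction; the factors tend to
  -- `1`, and closedness under limits removes them.
  have hr : ∀ n : ℕ, ∃ b : B, ‖b‖ ≤ 1 ∧ I.mkHom b = ((1 : ℝ) + 1 / ((n : ℝ) + 1))⁻¹ • f 1 := by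
    intro n
    have hn : (0 : ℝ) < 1 / ((n : ℝ) + 1) := by positivity
    obtain ⟨b, hb, hbn⟩ := I.exists_norm_lt (f 1) hn
    refine ⟨((1 : ℝ) + 1 / ((n : ℝ) + 1))⁻¹ • b, ?_, ?_⟩
    · rw [norm_smul, Real.norm_eq_abs, abs_of_pos (by positivity), inv_mul_le_one₀ (by positivity)]
      linarith
    · rw [← Complex.coe_smul, map_smul, Complex.coe_smul]
      congr 1
  choose b hb hbr using hr
  choose ψ hψ hψf using fun n => key (b n) (hb n) _ (hbr n)
  refine I.exists_isCCP_lift_of_tendsto hψ fun x => ?_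
  simp only [hψf]
  have h1 : Tendsto (fun n : ℕ => ((1 : ℝ) + 1 / ((n : ℝ) + 1))⁻¹) atTop (𝓝 1) := by
    have := (tendsto_one_div_add_atTop_nhds_zero_nat (𝕜 := ℝ)).const_add 1
    rw [add_zero] at this
    simpa using this.inv₀ one_ne_zero
  simpa using (h1.mul h1).smul_const (f x)

/-- Take `g = 0`: a ccp lift of `f`, placed in the corner, lifts `f ⊕ 0`. -/
theorem homSummandLiftsCCP_of_lifts
    (h : ∀ f : A →⋆ₙₐ[ℂ] I.Quotient, ∃ ψ : A →ₗ[ℂ] B, IsCCP ψ ∧ ∀ a, I.mkHom (ψ a) = f a) :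
    HomSummandLiftsCCP A I := by
  intro f
  obtain ⟨ψ, hψ, hψf⟩ := h f
  refine ⟨0, _, hψ.hom_comp (cornerM B), fun a => ?_⟩
  change stabQuotientMap I (cornerM B (ψ a)) = _
  rw [stabQuotientMap_cornerM, hψf, directSum_apply, cornerM_apply]
  change _ = _ + shift I.Quotient * 0 * star (shift I.Quotient)
  rw [mul_zero, zero_mul, add_zero]

end Main

/-! ### The lifting property from condition (iii) -/

/-- An arbitrary `D` is replaced by its unitization, which is σ-unital, as is the unital multiplier
algebra to which the hypothesis is applied. -/
theorem ccpMapsLift_of_forall_homSummandLiftsCCP {A : Type u} [NonUnitalCStarAlgebra A]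
    [TopologicalSpace.SeparableSpace A]
    (h : ∀ (B : Type v) [NonUnitalCStarAlgebra B], IsSigmaUnital B →
      ∀ I : ClosedIdeal B, HomSummandLiftsCCP A I)
    {D : Type v} [NonUnitalCStarAlgebra D] (J : ClosedIdeal D) : CCPMapsLift A J :=
  ClosedIdeal.ccpMapsLift_of_inr (ccpMapsLift_of_homSummandLiftsCCP
    (isSigmaUnital_of_cstarAlgebra (Unitization ℂ D))
    (h 𝓜(ℂ, Stab (Unitization ℂ D)) (isSigmaUnital_of_cstarAlgebra _) _))

/-- For non-unital `A` the preceding theorem is used twice: for `A`, which gives ccp lifts of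
*-homomorphisms on its unitization and hence condition (iii) there, and then for the unitization
itself. -/
theorem hasLP_of_forall_homSummandLiftsCCP {A : Type u} [NonUnitalCStarAlgebra A]
    [TopologicalSpace.SeparableSpace A]
    (h : ∀ (B : Type v) [NonUnitalCStarAlgebra B], IsSigmaUnital B →
      ∀ I : ClosedIdeal B, HomSummandLiftsCCP A I) : HasLP.{u, v} A := by
  refine ⟨fun _ D _ J => ccpMapsLift_of_forall_homSummandLiftsCCP h J, fun _ D _ J => ?_⟩
  have := Unitization.separableSpace A
  refine ccpMapsLift_of_forall_homSummandLiftsCCP (fun B _ _ I => homSummandLiftsCCP_of_lifts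
    (exists_isCCP_lift_unitization (ccpMapsLift_of_forall_homSummandLiftsCCP h I))) J

end

theorem mainTheorem1 (A : Type u) [NonUnitalCStarAlgebra A]
    [TopologicalSpace.SeparableSpace A] :
    List.TFAE [
      HasLP.{u, v} A,
      ∀ (B : Type v) [NonUnitalCStarAlgebra B], IsSigmaUnital B →
        ∀ I : ClosedIdeal B, HomSummandLifts A I,
      ∀ (B : Type v) [NonUnitalCStarAlgebra B], IsSigmaUnital B →
        ∀ I : ClosedIdeal B, HomSummandLiftsCCP A I] ∧
    ∀ (B : Type v) [NonUnitalCStarAlgebra B], IsSigmaUnital B → ∀ I : ClosedIdeal B,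
      (CCPMapsLift A I → HomSummandLifts A I) ∧
      (HomSummandLifts A I → HomSummandLiftsCCP A I) ∧
      (HomSummandLiftsCCP A (ClosedIdeal.ker (stabQuotientMap I)) → CCPMapsLift A I) := by
  refine ⟨?_, fun B _ hB I => ⟨CCPMapsLift.homSummandLifts, HomSummandLifts.homSummandLiftsCCP,
    ccpMapsLift_of_homSummandLiftsCCP hB⟩⟩
  tfae_have 1 → 2 := fun h B _ _ I => (h.ccpMapsLift I).homSummandLifts
  tfae_have 2 → 3 := fun h B _ hB I => (h B hB I).homSummandLiftsCCP
  tfae_have 3 → 1 := hasLP_of_forall_homSummandLiftsCCP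
  tfae_finish
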